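/- Let $\Gamma_0$ be a finite simple connected $3$-regular graph and let $p$ be an odd prime. **CFI graphs.** The graph $\mathrm{CFI}(\Gamma_0)$ is obtained from $\Gamma_0$ by replacing every vertex $v$ by a gadget. The gadget of $v$ has a pair of external vertices $a^v_w, b^v_w$ for every neighbour $w$ of $v$, and one internal vertex for every $0$-$1$-string $s$ indexed by the neighbours of $v$ with an even number of ones; the internal vertex $s$ is adjacent to $a^v_w$ if $s_w=0$ and to $b^v_w$ if $s_w=1$. For every edge $\{v,w\}$ of $\Gamma_0$ one adds the two edges $\{a^v_w,a^w_v\}$ and $\{b^v_w,b^w_v\}$. The twisted graph $\widetilde{\mathrm{CFI}}(\Gamma_0)$ is obtained by choosing one edge $\{v,w\}$ of $\Gamma_0$ (any edge is allowed) and replacing these two edges for it by $\{a^v_w,b^w_v\}$ and $\{b^v_w,a^w_v\}$. **Mekler groups.** For a finite simple graph $\Gamma$ let $$G_\Gamma=\langle x_v\ (v\in V(\Gamma)) \mid x_v^p=1,\ [[x_u,x_v],x_w]=1 \text{ for all } u,v,w;\ [x_u,x_v]=1 \text{ for } \{u,v\}\in E(\Gamma)\rangle .$$ **Weisfeiler-Leman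 algorithms.** Let $k\ge 2$. Given a colouring $\chi_0$ of $X^k$, put $$\chi_{i+1}(\bar g)=\bigl(\chi_i(\bar g),\{\!\!\{(\chi_i(\bar g_{|1\leftarrow x}),\dots,\chi_i(\bar g_{|k\leftarrow x})) \mid x\in X\}\!\!\}\bigr),$$ where $\bar g_{|j\leftarrow x}$ arises from $\bar g$ by replacing the $j$-th entry by $x$; two tuples have the same final colour if they have the same colour in every round. For groups (Version II), $\bar g\in G^k$ and $\bar h\in H^k$ have the same initial colour iff $g_i\mapsto h_i$ extends to an isomorphism $\langle g_1,\dots,g_k\rangle\to\langle h_1,\dots,h_k\rangle$. The $k$-dimensional WL algorithm *distinguishes* $G$ from $H$ if there is no bijection $G^k\to H^k$ preserving final colours, and it *identifies* $G$ if it distinguishes $G$ from every finite group not isomorphic to $G$. For graphs, two vertex tuples have the same initial colour iff mapping one to the other entrywise is an isomorphism of the induced subgraphs; $k$-WL distinguishes $\Gamma$ from $\Gamma'$ if, when run on the disjoint union, the multisets of final colours of $V(\Gamma)^k$ and $V(\Gamma')^k$ differ. The graph $\Gamma$ has WL-dimension at most $k$ if $k$-WL distinguishes it from every finite graph not isomorphic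 to it. **Theorem.** Let $G_1=G_{\mathrm{CFI}(\Gamma_0)}$ and $G_2=G_{\widetilde{\mathrm{CFI}}(\Gamma_0)}$. The $3$-dimensional WL algorithm (Version II) distinguishes $G_1$ from $G_2$. If in addition $\Gamma_0$ has (graph) WL-dimension at most $3$, then the $3$-dimensional WL algorithm (Version II) identifies $G_1$ as well as $G_2$. -/

import Mathlib

universe u

open scoped commutatorElement

/-! ### Colour refinement on `k`-tuples -/

/-- The colours available after `i` rounds of `k`-dimensional refinement, starting from initial
colours in `C`: a colour of round `i + 1` is a colour of round `i` together with a multiset of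
`k`-tuples of colours of round `i`, given by its multiplicity function. -/
def WLColor (C : Type) (k : ℕ) : ℕ → Type
  | 0 => C
  | i + 1 => WLColor C k i × ((Fin k → WLColor C k i) → ℕ∞)

/-- The colouring `χ_i` of `X^k`:
`χ_{i+1}(g) = (χ_i(g), {{ (χ_i(g|1←x), …, χ_i(g|k←x)) | x ∈ X }})`, for `k ≥ 2`. -/
noncomputable def wlColor {X : Type*} {C : Type} {k : ℕ} (χ₀ : (Fin k → X) → C) :
    (i : ℕ) → (Fin k → X) → WLColor C k i
  | 0 => χ₀
  | i + 1 => fun g =>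
      (wlColor χ₀ i g,
        fun c => Set.encard {x : X | (fun j => wlColor χ₀ i (Function.update g j x)) = c})

/-- The final colour of a tuple, recorded as the sequence of its colours in all rounds. Two tuples
have the same final colour iff no round of the refinement separates them. -/
noncomputable def wlFinalColor {X : Type*} {C : Type} {k : ℕ} (χ₀ : (Fin k → X) → C)
    (g : Fin k → X) : (i : ℕ) → WLColor C k i :=
  fun i => wlColor χ₀ i g

/-! ### The Weisfeiler-Leman algorithm for groups (Version II) -/

/-- The initial colour of a tuple of group elements in Version II: its marked isomorphism type,
encoded by the set of all words in `k` letters that are trivial on the tuple. See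
`markedType_eq_iff` for the characterization by isomorphisms of generated subgroups. -/
def markedType {G : Type*} [Group G] {k : ℕ} (g : Fin k → G) : Subgroup (FreeGroup (Fin k)) :=
  (FreeGroup.lift g).ker

/-- Two tuples have the same initial colour iff `g_i ↦ h_i` extends to an isomorphism between the
subgroups generated by the tuples. -/
theorem markedType_eq_iff {G H : Type*} [Group G] [Group H] {k : ℕ}
    (g : Fin k → G) (h : Fin k → H) :
    markedType g = markedType h ↔
      ∃ φ : Subgroup.closure (Set.range g) ≃* Subgroup.closure (Set.range h),
        ∀ i, (φ ⟨g i, Subgroup.subset_closure (Set.mem_range_self i)⟩ : H) = h i := by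
  constructor
  · intro hgh
    have hG := FreeGroup.range_lift_eq_closure (f := g)
    have hH := FreeGroup.range_lift_eq_closure (f := h)
    have hk : (FreeGroup.lift g).ker = (FreeGroup.lift h).ker := hgh
    refine ⟨(MulEquiv.subgroupCongr hG).symm.trans
      ((QuotientGroup.quotientKerEquivRange (FreeGroup.lift g)).symm.trans
        ((QuotientGroup.quotientMulEquivOfEq hk).trans
          ((QuotientGroup.quotientKerEquivRange (FreeGroup.lift h)).trans
            (MulEquiv.subgroupCongr hH)))), fun i => ?_⟩
    have key : (QuotientGroup.quotientKerEquivRange (FreeGroup.lift g)).symm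
        ((MulEquiv.subgroupCongr hG).symm
          ⟨g i, Subgroup.subset_closure (Set.mem_range_self i)⟩)
        = QuotientGroup.mk (FreeGroup.of i) := by
      rw [MulEquiv.symm_apply_eq]
      apply Subtype.ext
      change g i = FreeGroup.lift g (FreeGroup.of i)
      simp
    simp only [MulEquiv.trans_apply]
    rw [key]
    change FreeGroup.lift h (FreeGroup.of i) = h i
    simp
  · rintro ⟨φ, hφ⟩
    have e1 : FreeGroup.lift g = (Subgroup.closure (Set.range g)).subtype.comp
        (FreeGroup.lift fun i =>
          (⟨g i, Subgroup.subset_closure (Set.mem_range_self i)⟩ :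
            Subgroup.closure (Set.range g))) := by
      ext i; simp
    have e2 : FreeGroup.lift h = ((Subgroup.closure (Set.range h)).subtype.comp φ.toMonoidHom).comp
        (FreeGroup.lift fun i =>
          (⟨g i, Subgroup.subset_closure (Set.mem_range_self i)⟩ :
            Subgroup.closure (Set.range g))) := by
      ext i; simp [hφ]
    ext w
    simp only [markedType, MonoidHom.mem_ker, e1, e2, MonoidHom.comp_apply]
    simp

/-- `G ≡ H` with respect to `k`-WL in Version II: some bijection `G^k → H^k` preserves final
colours. -/
def GroupWLEquiv (k : ℕ) (G H : Type*) [Group G] [Group H] : Prop :=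
  ∃ f : (Fin k → G) ≃ (Fin k → H),
    ∀ g, wlFinalColor markedType g = wlFinalColor markedType (f g)

/-- `k`-WL (Version II) distinguishes `G` from `H`. -/
def GroupWLDistinguishes (k : ℕ) (G H : Type*) [Group G] [Group H] : Prop :=
  ¬ GroupWLEquiv k G H

/-- `k`-WL (Version II) identifies `G`: it distinguishes `G` from every finite group that is not
isomorphic to `G`. -/
def GroupWLIdentifies (k : ℕ) (G : Type u) [Group G] : Prop :=
  ∀ (H : Type u) [Group H] [Finite H], ¬ Nonempty (G ≃* H) → GroupWLDistinguishes k G H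

/-! ### The Weisfeiler-Leman algorithm for graphs -/

/-- The initial colour of a tuple of vertices: which entries are equal and which are adjacent. See
`graphType_eq_iff` for the characterization by isomorphisms of induced subgraphs. -/
def graphType {V : Type*} (Γ : SimpleGraph V) {k : ℕ} (g : Fin k → V) :
    Fin k → Fin k → Prop × Prop :=
  fun i j => (g i = g j, Γ.Adj (g i) (g j))

/-- Two tuples have the same initial colour iff `g_i ↦ h_i` is an isomorphism between the
subgraphs induced by the tuples. -/
theorem graphType_eq_iff {V : Type*} (Γ : SimpleGraph V) {k : ℕ} (g h : Fin k → V) :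
    graphType Γ g = graphType Γ h ↔
      ∃ φ : Γ.induce (Set.range g) ≃g Γ.induce (Set.range h),
        ∀ i, (φ ⟨g i, Set.mem_range_self i⟩ : V) = h i := by
  constructor
  · intro hgh
    have h1 : ∀ i j, (g i = g j ↔ h i = h j) := fun i j =>
      iff_of_eq (congrArg Prod.fst (congrFun (congrFun hgh i) j))
    have h2 : ∀ i j, (Γ.Adj (g i) (g j) ↔ Γ.Adj (h i) (h j)) := fun i j =>
      iff_of_eq (congrArg Prod.snd (congrFun (congrFun hgh i) j))
    let F : Set.range g → Set.range h := fun x => ⟨h x.2.choose, Set.mem_range_self _⟩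
    have hF : ∀ i, F ⟨g i, Set.mem_range_self i⟩ = ⟨h i, Set.mem_range_self i⟩ := fun i =>
      Subtype.ext ((h1 _ _).1 (Set.mem_range_self (f := g) i).choose_spec)
    have hbij : Function.Bijective F := by
      constructor
      · rintro ⟨_, i, rfl⟩ ⟨_, j, rfl⟩ hij
        rw [hF, hF] at hij
        exact Subtype.ext ((h1 i j).2 (congrArg Subtype.val hij))
      · rintro ⟨_, i, rfl⟩
        exact ⟨_, hF i⟩
    refine ⟨⟨Equiv.ofBijective F hbij, ?_⟩, fun i => congrArg Subtype.val (hF i)⟩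
    rintro ⟨_, i, rfl⟩ ⟨_, j, rfl⟩
    change Γ.Adj (F _).1 (F _).1 ↔ Γ.Adj (g i) (g j)
    rw [hF, hF]
    exact (h2 i j).symm
  · rintro ⟨φ, hφ⟩
    funext i j
    refine Prod.ext (propext ?_) (propext ?_)
    · change g i = g j ↔ h i = h j
      rw [← hφ i, ← hφ j, Subtype.coe_inj, φ.injective.eq_iff, Subtype.mk.injEq]
    · change Γ.Adj (g i) (g j) ↔ Γ.Adj (h i) (h j)
      rw [← hφ i, ← hφ j]
      exact (φ.map_rel_iff (a := ⟨g i, Set.mem_range_self i⟩)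
        (b := ⟨g j, Set.mem_range_self j⟩)).symm

/-- `k`-WL (for `k ≥ 2`) distinguishes the graphs `Γ` and `Γ'`: when it is run on their disjoint
union, the multisets of final colours of the tuples of `Γ` and of the tuples of `Γ'` differ, that
is, there is no bijection between these tuples preserving final colours. -/
def GraphWLDistinguishes (k : ℕ) {V W : Type*} (Γ : SimpleGraph V) (Γ' : SimpleGraph W) : Prop :=
  ¬ ∃ f : (Fin k → V) ≃ (Fin k → W),
      ∀ g : Fin k → V,
        wlFinalColor (graphType (Γ ⊕g Γ')) (fun i => Sum.inl (g i)) =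
          wlFinalColor (graphType (Γ ⊕g Γ')) (fun i => Sum.inr (f g i))

/-- `Γ` has (graph) Weisfeiler-Leman dimension at most `k`: `k`-WL distinguishes `Γ` from every
finite graph that is not isomorphic to `Γ`. -/
def GraphWLDimLE {V : Type u} (Γ : SimpleGraph V) (k : ℕ) : Prop :=
  ∀ (W : Type u) [Finite W] (Γ' : SimpleGraph W), ¬ Nonempty (Γ ≃g Γ') →
    GraphWLDistinguishes k Γ Γ'

/-! ### CFI graphs -/

/-- The vertices of the CFI graph over `Γ`. In the gadget of `v`, the external pair associated with
the edge from `v` to `w` is `ext v w _ false` (called `a`) and `ext v w _ true` (called `b`). The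
internal vertices of the gadget are the 0-1-strings, indexed by the edges at `v`, with an even
number of ones. -/
inductive CFIVertex {V : Type u} (Γ : SimpleGraph V) : Type u
  | ext (v w : V) (hvw : Γ.Adj v w) (b : Bool) : CFIVertex Γ
  | int (v : V) (s : Γ.neighborSet v → Bool) (hs : Even (Nat.card {w // s w = true})) :
      CFIVertex Γ

/-- Adjacency in the CFI graph in which exactly the edges in `T` are twisted. -/
def cfiAdj {V : Type u} (Γ : SimpleGraph V) (T : Set (Sym2 V)) : CFIVertex Γ → CFIVertex Γ → Prop
  | .ext v w _ b, .ext v' w' _ b' => v' = w ∧ w' = v ∧ (b = b' ↔ s(v, w) ∉ T)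
  | .int v s _, .ext v' w' h' b' => ∃ hv : v' = v, s ⟨w', hv ▸ h'⟩ = b'
  | .ext v w h b, .int v' s' _ => ∃ hv : v = v', s' ⟨w, hv ▸ h⟩ = b
  | .int _ _ _, .int _ _ _ => False

/-- The CFI graph over `Γ` in which exactly the edges in `T` are twisted. -/
def cfiTwist {V : Type u} (Γ : SimpleGraph V) (T : Set (Sym2 V)) : SimpleGraph (CFIVertex Γ) where
  Adj := cfiAdj Γ T
  symm := ⟨by
    rintro (⟨v, w, h, b⟩ | ⟨v, s, hs⟩) (⟨v', w', h', b'⟩ | ⟨v', s', hs'⟩) hadj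
    · obtain ⟨rfl, rfl, hb⟩ := hadj
      refine ⟨rfl, rfl, ?_⟩
      rw [Sym2.eq_swap, eq_comm]
      exact hb
    · exact hadj
    · exact hadj
    · exact hadj⟩
  loopless := ⟨by
    rintro (⟨v, w, h, b⟩ | ⟨v, s, hs⟩) hadj
    · exact h.ne hadj.1
    · exact hadj⟩

/-- The graph `CFI(Γ)`. -/
def CFI {V : Type u} (Γ : SimpleGraph V) : SimpleGraph (CFIVertex Γ) := cfiTwist Γ ∅

/-- The twisted CFI graph, in which the single edge `e` is twisted. -/
def twistedCFI {V : Type u} (Γ : SimpleGraph V) (e : Sym2 V) : SimpleGraph (CFIVertex Γ) :=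
  cfiTwist Γ {e}

/-! ### Groups from graphs -/

/-- The relations `x_i^p = 1`, `[[x_i, x_j], x_k] = 1`, and `[x_i, x_j] = 1` for every edge. -/
def meklerRels {V : Type u} (p : ℕ) (Γ : SimpleGraph V) : Set (FreeGroup V) :=
  {r | ∃ i : V, r = FreeGroup.of i ^ p} ∪
  {r | ∃ i j k : V, r = ⁅⁅FreeGroup.of i, FreeGroup.of j⁆, FreeGroup.of k⁆} ∪
  {r | ∃ i j : V, Γ.Adj i j ∧ r = ⁅FreeGroup.of i, FreeGroup.of j⁆}

/-- Mekler's group `G_Γ` of exponent `p` and nilpotency class at most `2` (for an odd prime `p`),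
generated by the vertices of `Γ`. -/
abbrev MeklerGroup {V : Type u} (p : ℕ) (Γ : SimpleGraph V) : Type u :=
  PresentedGroup (meklerRels p Γ)

/-!
Final colours of `k`-WL agree exactly on the pairs of a winning position relation of the bijective
`k`-pebble game, and predicates definable with three variables are invariant under the game with
three pebbles. Since a CFI graph `Γ` has no triangles and no `4`-cycles, the elements of its Mekler
group that are not central and have a nonabelian centralizer are the products of nontrivial powers
of a generator with central elements; so `Γ` is the commutation graph on the centralizer classes of
these elements, in the Mekler group and in every group that `3`-WL does not distinguish from it.

The supports of group elements are arbitrary sets of vertices. A pebble on an element whose support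
contains one internal vertex of every gadget lets the remaining two pebbles count, modulo four, the
ordered pairs of marked vertices in adjacent gadgets that disagree along the connecting edge. This
count is twice the number of twists, because every edge set switched by even strings has even size;
so the parity of the number of twists is determined by the colours.

For identification, the gadget structure of a CFI graph is expressed by sentences with three
variables, and the graph on the gadgets is not distinguished from the base graph. Hence a group that
`3`-WL does not distinguish from a Mekler group over a twisted CFI graph has, if the base graph is
identified, a twisted CFI graph over the same base as its commutation graph. By parity the two
twisted graphs are isomorphic, and powers and commutators of representatives of the classes then
satisfy the defining relations of the Mekler group and generate.
-/

/-! ### Back-and-forth relations and colour refinement -/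

/-- A winning position relation of the bijective `k`-pebble game on `X` and `Y`: for any related
pair of tuples there is one bijection of the ground sets such that replacing corresponding entries
by corresponding points keeps the tuples related. Only related tuples carry a bijection, so `R` is
required to relate at least one pair. -/
structure IsBackForth {X Y : Type*} {k : ℕ} (R : (Fin k → X) → (Fin k → Y) → Prop) : Prop where
  nonempty : ∃ g h, R g h
  step : ∀ g h, R g h →
    ∃ π : X ≃ Y, ∀ j x, R (Function.update g j x) (Function.update h j (π x))

theorem exists_equiv_of_encard_fiber_eq {X Y C : Type*} [Finite X] [Finite Y] {f : X → C}
    {f' : Y → C} (h : ∀ c, Set.encard {x | f x = c} = Set.encard {y | f' y = c}) :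
    ∃ π : X ≃ Y, ∀ x, f' (π x) = f x := by
  have e : ∀ c, {x // f x = c} ≃ {y // f' y = c} := fun c =>
    Classical.choice (Finite.card_eq.1 (congrArg ENat.toNat (h c)))
  exact ⟨(Equiv.sigmaFiberEquiv f).symm.trans
    ((Equiv.sigmaCongrRight e).trans (Equiv.sigmaFiberEquiv f')), fun x => (e (f x) ⟨x, rfl⟩).2⟩

theorem encard_fiber_eq_of_equiv {X Y C : Type*} {f : X → C} {f' : Y → C} (π : X ≃ Y)
    (h : ∀ x, f' (π x) = f x) (c : C) :
    Set.encard {x | f x = c} = Set.encard {y | f' y = c} := by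
  have himage : {y | f' y = c} = π '' {x | f x = c} := by
    ext y
    simp only [Equiv.image_eq_preimage_symm, Set.mem_preimage, Set.mem_ofPred_eq, ← h,
      Equiv.apply_symm_apply]
  rw [himage, π.injective.encard_image]

section WLColor

variable {X Y : Type*} {C : Type} {k : ℕ} {χ : (Fin k → X) → C} {χ' : (Fin k → Y) → C}
  {g : Fin k → X} {h : Fin k → Y}

theorem wlColor_eq_of_le {i i' : ℕ} (hi : i ≤ i') (he : wlColor χ i' g = wlColor χ' i' h) :
    wlColor χ i g = wlColor χ' i h := by
  induction i', hi using Nat.le_induction with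
  | base => exact he
  | succ n _ ih => exact ih (congrArg Prod.fst he)

theorem exists_equiv_wlColor_update_eq [Finite X] [Finite Y] {i : ℕ}
    (he : wlColor χ (i + 1) g = wlColor χ' (i + 1) h) :
    ∃ π : X ≃ Y, ∀ j x,
      wlColor χ i (Function.update g j x) = wlColor χ' i (Function.update h j (π x)) := by
  obtain ⟨π, hπ⟩ := exists_equiv_of_encard_fiber_eq (congrFun (congrArg Prod.snd he))
  exact ⟨π, fun j x => (congrFun (hπ x) j).symm⟩

theorem exists_equiv_wlFinalColor_update_eq [Finite X] [Finite Y]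
    (he : wlFinalColor χ g = wlFinalColor χ' h) :
    ∃ π : X ≃ Y, ∀ j x,
      wlFinalColor χ (Function.update g j x) = wlFinalColor χ' (Function.update h j (π x)) := by
  choose π hπ using fun i => exists_equiv_wlColor_update_eq (congrFun he (i + 1))
  -- There are finitely many bijections, so one of them works for arbitrarily late rounds.
  obtain ⟨σ, hσ⟩ := Finite.exists_infinite_fiber π
  refine ⟨σ, fun j x => funext fun i => ?_⟩
  obtain ⟨i', rfl, hlt⟩ := (Set.infinite_coe_iff.1 hσ).exists_gt i
  exact wlColor_eq_of_le hlt.le (hπ i' j x)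

theorem isBackForth_wlFinalColor_eq [Finite X] [Finite Y]
    (he : wlFinalColor χ g = wlFinalColor χ' h) :
    IsBackForth fun g h => wlFinalColor χ g = wlFinalColor χ' h :=
  ⟨⟨g, h, he⟩, fun _ _ => exists_equiv_wlFinalColor_update_eq⟩

end WLColor

namespace IsBackForth

variable {X Y : Type*} {k : ℕ} {R : (Fin k → X) → (Fin k → Y) → Prop}

theorem cons {R : (Fin (k + 1) → X) → (Fin (k + 1) → Y) → Prop} (hR : IsBackForth R) {x : X}
    {y : Y} (hne : ∃ g h, R (Fin.cons x g : Fin (k + 1) → X) (Fin.cons y h : Fin (k + 1) → Y)) :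
    IsBackForth fun (g : Fin k → X) (h : Fin k → Y) =>
      R (Fin.cons x g : Fin (k + 1) → X) (Fin.cons y h : Fin (k + 1) → Y) := by
  refine ⟨hne, fun g h hgh => ?_⟩
  obtain ⟨π, hπ⟩ := hR.step _ _ hgh
  refine ⟨π, fun j z => ?_⟩
  rw [Fin.cons_update, Fin.cons_update]
  exact hπ j.succ z

theorem exists_equiv (hR : IsBackForth R) :
    ∃ f : (Fin k → X) ≃ (Fin k → Y), ∀ g, R g (f g) := by
  obtain ⟨g, h, hgh⟩ := hR.nonempty
  induction k with
  | zero =>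
    refine ⟨Equiv.ofUnique _ _, fun g' => ?_⟩
    rwa [Subsingleton.elim g' g, Subsingleton.elim (Equiv.ofUnique _ _ g) h]
  | succ k ih =>
    obtain ⟨π, hπ⟩ := hR.step g h hgh
    have hcons : ∀ x : X, R (Fin.cons x (Fin.tail g) : Fin (k + 1) → X)
        (Fin.cons (π x) (Fin.tail h) : Fin (k + 1) → Y) := fun x => by
      have hx := hπ 0 x
      rwa [← Fin.cons_self_tail g, ← Fin.cons_self_tail h, Fin.update_cons_zero,
        Fin.update_cons_zero] at hx
    choose f hf using fun x => ih (hR.cons ⟨_, _, hcons x⟩) _ _ (hcons x)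
    refine ⟨(Fin.consEquiv fun _ => X).symm.trans ((Equiv.prodShear π f).trans
      (Fin.consEquiv fun _ => Y)), fun g' => ?_⟩
    have hg' := hf (g' 0) (Fin.tail g')
    rw [Fin.cons_self_tail] at hg'
    exact hg'

theorem exists_right (hR : IsBackForth R) (g : Fin k → X) : ∃ h, R g h :=
  let ⟨f, hf⟩ := hR.exists_equiv
  ⟨f g, hf g⟩

theorem exists_left (hR : IsBackForth R) (h : Fin k → Y) : ∃ g, R g h :=
  let ⟨f, hf⟩ := hR.exists_equiv
  ⟨f.symm h, by simpa only [Equiv.apply_symm_apply] using hf (f.symm h)⟩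

theorem wlFinalColor_eq (hR : IsBackForth R) {C : Type} {χ : (Fin k → X) → C}
    {χ' : (Fin k → Y) → C} (hχ : ∀ g h, R g h → χ g = χ' h) (g : Fin k → X) (h : Fin k → Y)
    (hgh : R g h) : wlFinalColor χ g = wlFinalColor χ' h := by
  funext i
  change wlColor χ i g = wlColor χ' i h
  induction i generalizing g h with
  | zero => exact hχ g h hgh
  | succ i ih =>
    obtain ⟨π, hπ⟩ := hR.step g h hgh
    exact Prod.ext (ih g h hgh) (funext (encard_fiber_eq_of_equiv π
      fun x => funext fun j => (ih _ _ (hπ j x)).symm))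

theorem restrict (hR : IsBackForth R) {D : Set X} {D' : Set Y}
    (hD : ∀ g h, R g h → ∀ j, g j ∈ D ↔ h j ∈ D') (hne : D.Nonempty) (hk : k ≠ 0) :
    IsBackForth fun (g : Fin k → D) (h : Fin k → D') =>
      R (Subtype.val ∘ g) (Subtype.val ∘ h) := by
  refine ⟨?_, fun g h hgh => ?_⟩
  · obtain ⟨x, hx⟩ := hne
    obtain ⟨h, hh⟩ := hR.exists_right fun _ => x
    exact ⟨fun _ => ⟨x, hx⟩, fun j => ⟨h j, (hD _ _ hh j).1 hx⟩, hh⟩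
  · obtain ⟨π, hπ⟩ := hR.step _ _ hgh
    have hmem : ∀ x, x ∈ D ↔ π x ∈ D' := fun x => by
      have j : Fin k := ⟨0, Nat.pos_of_ne_zero hk⟩
      simpa only [Function.update_self] using hD _ _ (hπ j x) j
    refine ⟨π.subtypeEquiv hmem, fun j x => ?_⟩
    rw [Function.comp_update, Function.comp_update]
    exact hπ j x

end IsBackForth

theorem card_subtype_comp {X A : Type*} [Finite X] [Finite A] (q : X → A) {m : ℕ}
    (hq : ∀ a, Nat.card {x // q x = a} = m) (P : A → Prop) :
    Nat.card {x // P (q x)} = m * Nat.card {a // P a} := by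
  let e : {x // P (q x)} ≃ Σ a : {a // P a}, {x // q x = a} :=
    { toFun := fun x => ⟨⟨q x, x.2⟩, ⟨x, rfl⟩⟩
      invFun := fun y => ⟨y.2, by rw [y.2.2]; exact y.1.2⟩
      left_inv := fun x => rfl
      right_inv := by
        rintro ⟨⟨a, ha⟩, ⟨x, hx⟩⟩
        exact Sigma.subtype_ext (Subtype.ext hx) rfl }
  have := Fintype.ofFinite {a // P a}
  rw [Nat.card_congr e, Nat.card_sigma]
  simp only [hq, Finset.sum_const, Finset.card_univ, smul_eq_mul, Nat.card_eq_fintype_card,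
    mul_comm]

theorem encard_fiber_eq_of_equiv_cover {X Y A B C : Type*} [Finite X] [Finite Y] [Finite A]
    [Finite B] {q : X → A} {q' : Y → B} {m : ℕ} (hm : 0 < m)
    (hq : ∀ a, Nat.card {x // q x = a} = m) (hq' : ∀ b, Nat.card {y // q' y = b} = m) {f : A → C}
    {f' : B → C} (π : X ≃ Y) (h : ∀ x, f' (q' (π x)) = f (q x)) (c : C) :
    Set.encard {a | f a = c} = Set.encard {b | f' b = c} := by
  have hcard : m * Nat.card {a // f a = c} = m * Nat.card {b // f' b = c} := by
    rw [← card_subtype_comp q hq fun a => f a = c, ← card_subtype_comp q' hq' fun b => f' b = c]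
    exact Nat.card_congr (π.subtypeEquiv fun x => by rw [h])
  rw [← (Set.toFinite {a | f a = c}).cast_ncard_eq, ← (Set.toFinite {b | f' b = c}).cast_ncard_eq]
  exact congrArg Nat.cast (Nat.eq_of_mul_eq_mul_left hm hcard)

section Cover

variable {X Y A B : Type*} [Finite X] [Finite Y] [Finite A] [Finite B] {k : ℕ}
  {R : (Fin k → X) → (Fin k → Y) → Prop} {q : X → A} {q' : Y → B} {m : ℕ} {C : Type}
  {χ : (Fin k → A) → C} {χ' : (Fin k → B) → C}

theorem IsBackForth.wlFinalColor_comp_eq (hR : IsBackForth R) (hm : 0 < m)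
    (hq : ∀ a, Nat.card {x // q x = a} = m) (hq' : ∀ b, Nat.card {y // q' y = b} = m)
    (hχ : ∀ g h, R g h → χ (q ∘ g) = χ' (q' ∘ h)) (g : Fin k → X) (h : Fin k → Y)
    (hgh : R g h) : wlFinalColor χ (q ∘ g) = wlFinalColor χ' (q' ∘ h) := by
  funext i
  change wlColor χ i (q ∘ g) = wlColor χ' i (q' ∘ h)
  induction i generalizing g h with
  | zero => exact hχ g h hgh
  | succ i ih =>
    obtain ⟨π, hπ⟩ := hR.step g h hgh
    refine Prod.ext (ih g h hgh) (funext (encard_fiber_eq_of_equiv_cover hm hq hq' π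
      fun x => funext fun j => ?_))
    simpa only [Function.comp_update] using (ih _ _ (hπ j x)).symm

/-- The colour relation replaces the image of `R` under the covering maps, which need not be a
back-and-forth relation: a bijection of the covers does not descend. -/
theorem IsBackForth.isBackForth_wlFinalColor_of_cover (hR : IsBackForth R) (hm : 0 < m)
    (hq : ∀ a, Nat.card {x // q x = a} = m) (hq' : ∀ b, Nat.card {y // q' y = b} = m)
    (hχ : ∀ g h, R g h → χ (q ∘ g) = χ' (q' ∘ h)) :
    IsBackForth fun g h => wlFinalColor χ g = wlFinalColor χ' h :=
  let ⟨_, _, hgh⟩ := hR.nonempty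
  isBackForth_wlFinalColor_eq (hR.wlFinalColor_comp_eq hm hq hq' hχ _ _ hgh)

end Cover

/-! ### Invariant predicates -/

section Invariant

variable {X Y : Type*} (R : (Fin 3 → X) → (Fin 3 → Y) → Prop)

/-- A pair of unary predicates that related triples do not separate. -/
def Invariant₁ (P : X → Prop) (P' : Y → Prop) : Prop :=
  ∀ ⦃g h⦄, R g h → ∀ i, P (g i) ↔ P' (h i)

/-- A pair of binary predicates that related triples do not separate. -/
def Invariant₂ (P : X → X → Prop) (P' : Y → Y → Prop) : Prop :=
  ∀ ⦃g h⦄, R g h → ∀ i j, P (g i) (g j) ↔ P' (h i) (h j)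

/-- A pair of ternary predicates that related triples do not separate. -/
def Invariant₃ (P : X → X → X → Prop) (P' : Y → Y → Y → Prop) : Prop :=
  ∀ ⦃g h⦄, R g h → ∀ i j k, P (g i) (g j) (g k) ↔ P' (h i) (h j) (h k)

variable {R}

theorem IsBackForth.step_invariant₃ (hR : IsBackForth R) {g : Fin 3 → X} {h : Fin 3 → Y}
    (hgh : R g h) : ∃ π : X ≃ Y, ∀ P P', Invariant₃ R P P' →
      ∀ i j w, P (g i) (g j) w ↔ P' (h i) (h j) (π w) := by
  obtain ⟨π, hπ⟩ := hR.step g h hgh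
  refine ⟨π, fun P P' hP i j w => ?_⟩
  -- Three pebbles suffice to keep two entries while a third one is moved.
  obtain ⟨l, hil, hjl⟩ : ∃ l, i ≠ l ∧ j ≠ l := by decide +revert
  simpa only [Function.update_self, Function.update_of_ne hil, Function.update_of_ne hjl]
    using hP (hπ l w) i j l

namespace Invariant₃

variable {P : X → X → X → Prop} {P' : Y → Y → Y → Prop}

theorem exists_last (hP : Invariant₃ R P P') (hR : IsBackForth R) :
    Invariant₂ R (fun x y => ∃ z, P x y z) (fun x y => ∃ z, P' x y z) := by
  intro g h hgh i j
  obtain ⟨π, hπ⟩ := hR.step_invariant₃ hgh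
  exact π.exists_congr (hπ _ _ hP i j)

theorem forall_last (hP : Invariant₃ R P P') (hR : IsBackForth R) :
    Invariant₂ R (fun x y => ∀ z, P x y z) (fun x y => ∀ z, P' x y z) := by
  intro g h hgh i j
  obtain ⟨π, hπ⟩ := hR.step_invariant₃ hgh
  exact π.forall_congr (hπ _ _ hP i j)

theorem transfer (hP : Invariant₃ R P P') (hR : IsBackForth R) (hall : ∀ x y z, P x y z)
    (x y z : Y) : P' x y z := by
  obtain ⟨g, hg⟩ := hR.exists_left ![x, y, z]
  exact (hP hg 0 1 2).1 (hall _ _ _)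

end Invariant₃

theorem IsBackForth.invariant₃_exists_of_pairs (hR : IsBackForth R) {A B C : X → X → X → Prop}
    {A' B' C' : Y → Y → Y → Prop} (hA : Invariant₃ R A A') (hB : Invariant₃ R B B')
    (hC : Invariant₃ R C C') :
    Invariant₃ R (fun x y z => ∃ w, A x y w ∧ B y z w ∧ C x z w)
      (fun x y z => ∃ w, A' x y w ∧ B' y z w ∧ C' x z w) := by
  intro g h hgh i j k
  obtain ⟨π, hπ⟩ := hR.step_invariant₃ hgh
  exact π.exists_congr fun w =>
    and_congr (hπ _ _ hA i j w) (and_congr (hπ _ _ hB j k w) (hπ _ _ hC i k w))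

namespace Invariant₂

variable {P Q : X → X → Prop} {P' Q' : Y → Y → Prop}

theorem and (hP : Invariant₂ R P P') (hQ : Invariant₂ R Q Q') :
    Invariant₂ R (fun x y => P x y ∧ Q x y) (fun x y => P' x y ∧ Q' x y) :=
  fun _ _ hgh i j => and_congr (hP hgh i j) (hQ hgh i j)

theorem not (hP : Invariant₂ R P P') :
    Invariant₂ R (fun x y => ¬ P x y) (fun x y => ¬ P' x y) :=
  fun _ _ hgh i j => not_congr (hP hgh i j)

theorem exists_last (hP : Invariant₂ R P P') (hR : IsBackForth R) :
    Invariant₁ R (fun x => ∃ y, P x y) (fun x => ∃ y, P' x y) :=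
  fun _ _ hgh i => Invariant₃.exists_last (P := fun x _ z => P x z) (P' := fun x _ z => P' x z)
    (fun _ _ hgh i _ k => hP hgh i k) hR hgh i i

theorem forall_last (hP : Invariant₂ R P P') (hR : IsBackForth R) :
    Invariant₁ R (fun x => ∀ y, P x y) (fun x => ∀ y, P' x y) :=
  fun _ _ hgh i => Invariant₃.forall_last (P := fun x _ z => P x z) (P' := fun x _ z => P' x z)
    (fun _ _ hgh i _ k => hP hgh i k) hR hgh i i

theorem card_eq (hP : Invariant₂ R P P') (hR : IsBackForth R) {g : Fin 3 → X} {h : Fin 3 → Y}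
    (hgh : R g h) (i : Fin 3) : Nat.card {x // P (g i) x} = Nat.card {y // P' (h i) y} := by
  obtain ⟨π, hπ⟩ := hR.step_invariant₃ hgh
  exact Nat.card_congr (π.subtypeEquiv (hπ (fun x _ z => P x z) (fun x _ z => P' x z)
    (fun _ _ hgh i _ k => hP hgh i k) i i))

theorem transfer (hP : Invariant₂ R P P') (hR : IsBackForth R) (hall : ∀ x y, P x y) (x y : Y) :
    P' x y := by
  obtain ⟨g, hg⟩ := hR.exists_left ![x, y, y]
  exact (hP hg 0 1).1 (hall _ _)

end Invariant₂

theorem Invariant₁.transfer {P : X → Prop} {P' : Y → Prop} (hP : Invariant₁ R P P')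
    (hR : IsBackForth R) (hall : ∀ x, P x) (y : Y) : P' y := by
  obtain ⟨g, hg⟩ := hR.exists_left fun _ => y
  exact (hP hg 0).1 (hall _)

end Invariant

/-! ### Disjoint unions of graphs -/

/-- The relation on tuples of a disjoint union that places each entry of a pair of tuples on
opposite sides, taking the entries from two `R`-related pairs. -/
def SumSwap {V W : Type*} {k : ℕ} (R : (Fin k → V) → (Fin k → W) → Prop)
    (t t' : Fin k → V ⊕ W) : Prop :=
  ∃ g h g' h', R g h ∧ R g' h' ∧ ∀ i, (t i = Sum.inl (g i) ∧ t' i = Sum.inr (h i)) ∨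
    (t i = Sum.inr (h' i) ∧ t' i = Sum.inl (g' i))

section SumSwap

variable {V W : Type*} {k : ℕ} {R : (Fin k → V) → (Fin k → W) → Prop}

theorem sumSwap_inl_inr {g : Fin k → V} {h : Fin k → W} (hgh : R g h) :
    SumSwap R (fun i => Sum.inl (g i)) (fun i => Sum.inr (h i)) :=
  ⟨g, h, g, h, hgh, hgh, fun _ => Or.inl ⟨rfl, rfl⟩⟩

theorem IsBackForth.sumSwap (hR : IsBackForth R) : IsBackForth (SumSwap R) := by
  refine ⟨?_, ?_⟩
  · obtain ⟨g, h, hgh⟩ := hR.nonempty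
    exact ⟨_, _, sumSwap_inl_inr hgh⟩
  rintro t t' ⟨g, h, g', h', hgh, hgh', ht⟩
  obtain ⟨π, hπ⟩ := hR.step g h hgh
  obtain ⟨π', hπ'⟩ := hR.step g' h' hgh'
  refine ⟨(Equiv.sumCongr π π'.symm).trans (Equiv.sumComm W V), ?_⟩
  rintro j (x | y)
  · refine ⟨_, _, g', h', hπ j x, hgh', fun i => ?_⟩
    obtain rfl | hij := eq_or_ne i j
    · simp
    · simpa [hij] using ht i
  · refine ⟨g, h, _, _, hgh, hπ' j (π'.symm y), fun i => ?_⟩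
    obtain rfl | hij := eq_or_ne i j
    · simp
    · simpa [hij] using ht i

variable {Γ : SimpleGraph V} {Γ' : SimpleGraph W}

theorem graphType_eq_graphType_iff {g : Fin k → V} {h : Fin k → W} :
    graphType Γ g = graphType Γ' h ↔
      ∀ i j, (g i = g j ↔ h i = h j) ∧ (Γ.Adj (g i) (g j) ↔ Γ'.Adj (h i) (h j)) := by
  simp only [graphType, funext_iff, Prod.ext_iff, eq_iff_iff]

theorem SumSwap.graphType_eq (htype : ∀ g h, R g h → graphType Γ g = graphType Γ' h)
    {t t' : Fin k → V ⊕ W} (ht : SumSwap R t t') :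
    graphType (Γ ⊕g Γ') t = graphType (Γ ⊕g Γ') t' := by
  obtain ⟨g, h, g', h', hgh, hgh', ht⟩ := ht
  have hleft := graphType_eq_graphType_iff.1 (htype _ _ hgh)
  have hright := graphType_eq_graphType_iff.1 (htype _ _ hgh')
  refine graphType_eq_graphType_iff.2 fun i j => ?_
  rcases ht i with ⟨hi, hi'⟩ | ⟨hi, hi'⟩ <;> rcases ht j with ⟨hj, hj'⟩ | ⟨hj, hj'⟩ <;>
    simp [hi, hi', hj, hj', hleft, hright]

theorem IsBackForth.not_graphWLDistinguishes (hR : IsBackForth R)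
    (htype : ∀ g h, R g h → graphType Γ g = graphType Γ' h) : ¬ GraphWLDistinguishes k Γ Γ' := by
  obtain ⟨f, hf⟩ := hR.exists_equiv
  exact not_not_intro ⟨f, fun g => hR.sumSwap.wlFinalColor_eq
    (fun _ _ => SumSwap.graphType_eq htype) _ _ (sumSwap_inl_inr (hf g))⟩

end SumSwap

/-! ### Groups of nilpotency class two -/

section ClassTwo

variable {G : Type*} [Group G]

/-- In a group with central commutators, `x ↦ ⁅x, y⁆` as a homomorphism to the center. -/
def commutatorHom (hG : ∀ x y : G, ⁅x, y⁆ ∈ Subgroup.center G) (y : G) :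
    G →* Subgroup.center G where
  toFun x := ⟨⁅x, y⁆, hG x y⟩
  map_one' := Subtype.ext (commutatorElement_one_left y)
  map_mul' a b := Subtype.ext <| by
    have ha := Subgroup.mem_center_iff.1 (hG a y)
    have hb := Subgroup.mem_center_iff.1 (hG b y)
    change ⁅a * b, y⁆ = ⁅a, y⁆ * ⁅b, y⁆
    rw [commutatorElement_mul_left_eq_conj_mul, hb, mul_inv_cancel_right, ha]

variable {hG : ∀ x y : G, ⁅x, y⁆ ∈ Subgroup.center G}

theorem commutatorHom_inv (x y : G) : (commutatorHom hG x y)⁻¹ = commutatorHom hG y x :=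
  Subtype.ext (commutatorElement_inv y x)

theorem commutatorHom_eq_one_iff {x y : G} : commutatorHom hG y x = 1 ↔ Commute x y :=
  Subtype.ext_iff.trans commutatorElement_eq_one_iff_commute

end ClassTwo

/-! ### Heisenberg groups -/

/-- The Heisenberg group over `R`, of the upper unitriangular matrices
`[[1, a, c], [0, 1, b], [0, 0, 1]]`. Its commutators detect the pairs of generators of a Mekler
group that do not commute. -/
@[ext] structure Heisenberg (R : Type*) where
  a : R
  b : R
  c : R

namespace Heisenberg

variable {R : Type*} [CommRing R]

instance : Group (Heisenberg R) where
  mul x y := ⟨x.a + y.a, x.b + y.b, x.c + y.c + x.a * y.b⟩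
  one := ⟨0, 0, 0⟩
  inv x := ⟨-x.a, -x.b, -x.c + x.a * x.b⟩
  mul_assoc x y z := Heisenberg.ext (add_assoc _ _ _) (add_assoc _ _ _) <| by
    change x.c + y.c + x.a * y.b + z.c + (x.a + y.a) * z.b =
      x.c + (y.c + z.c + y.a * z.b) + x.a * (y.b + z.b)
    ring
  one_mul x := Heisenberg.ext (zero_add _) (zero_add _) <| by
    change 0 + x.c + 0 * x.b = x.c
    ring
  mul_one x := Heisenberg.ext (add_zero _) (add_zero _) <| by
    change x.c + 0 + x.a * 0 = x.c
    ring
  inv_mul_cancel x := Heisenberg.ext (neg_add_cancel _) (neg_add_cancel _) <| by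
    change -x.c + x.a * x.b + x.c + -x.a * x.b = 0
    ring

theorem mul_def (x y : Heisenberg R) :
    x * y = ⟨x.a + y.a, x.b + y.b, x.c + y.c + x.a * y.b⟩ := rfl

/-- The projection to the abelianization. -/
def abHom (R : Type*) [CommRing R] : Heisenberg R →* Multiplicative (R × R) where
  toFun x := Multiplicative.ofAdd (x.a, x.b)
  map_one' := rfl
  map_mul' _ _ := rfl

theorem commute_iff (x y : Heisenberg R) : Commute x y ↔ x.a * y.b = y.a * x.b := by
  change x * y = y * x ↔ _
  rw [mul_def, mul_def, Heisenberg.ext_iff, add_comm y.c x.c]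
  exact ⟨fun h => add_left_cancel h.2.2,
    fun h => ⟨add_comm _ _, add_comm _ _, congrArg (x.c + y.c + ·) h⟩⟩

theorem commute_commutator (x y z : Heisenberg R) : Commute ⁅x, y⁆ z := by
  have hab : abHom R ⁅x, y⁆ = 1 := by
    rw [map_commutatorElement, commutatorElement_eq_one_iff_commute]
    exact Commute.all _ _
  have ha : ⁅x, y⁆.a = 0 := congrArg Prod.fst hab
  have hb : ⁅x, y⁆.b = 0 := congrArg Prod.snd hab
  rw [commute_iff, ha, hb, zero_mul, mul_zero]

theorem pow_of_mul_eq_zero {a b : R} (h : a * b = 0) (n : ℕ) :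
    (⟨a, b, 0⟩ : Heisenberg R) ^ n = ⟨n * a, n * b, 0⟩ := by
  induction n with
  | zero => rw [pow_zero, Nat.cast_zero, zero_mul, zero_mul]; rfl
  | succ n ih =>
    rw [pow_succ, ih, mul_def, Nat.cast_succ]
    ext
    · ring
    · ring
    · linear_combination (n : R) * h

end Heisenberg

/-! ### Mekler groups -/

namespace MeklerGroup

variable {V : Type u} {p : ℕ} {Γ : SimpleGraph V}

/-- The generator `x_v`. -/
def gen (p : ℕ) (Γ : SimpleGraph V) (v : V) : MeklerGroup p Γ := PresentedGroup.of v

theorem gen_pow (v : V) : gen p Γ v ^ p = 1 := by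
  rw [gen, PresentedGroup.of, ← map_pow]
  exact PresentedGroup.one_of_mem (Or.inl (Or.inl ⟨v, rfl⟩))

theorem commute_commutator_gen (u v w : V) : Commute ⁅gen p Γ u, gen p Γ v⁆ (gen p Γ w) := by
  rw [← commutatorElement_eq_one_iff_commute, gen, gen, gen, PresentedGroup.of, PresentedGroup.of,
    PresentedGroup.of, ← map_commutatorElement, ← map_commutatorElement]
  exact PresentedGroup.one_of_mem (Or.inl (Or.inr ⟨u, v, w, rfl⟩))

theorem commute_gen_of_adj {u v : V} (h : Γ.Adj u v) : Commute (gen p Γ u) (gen p Γ v) := by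
  rw [← commutatorElement_eq_one_iff_commute, gen, gen, PresentedGroup.of, PresentedGroup.of,
    ← map_commutatorElement]
  exact PresentedGroup.one_of_mem (Or.inr ⟨u, v, h, rfl⟩)

section Lift

variable {K : Type*} [Group K] {f : V → K} (hpow : ∀ v, f v ^ p = 1)
  (hclass : ∀ u v w, Commute ⁅f u, f v⁆ (f w)) (hadj : ∀ u v, Γ.Adj u v → Commute (f u) (f v))

/-- The homomorphism determined by images of the generators that satisfy the relations. -/
def lift : MeklerGroup p Γ →* K :=
  PresentedGroup.toGroup (f := f) <| by
    rintro r ((⟨i, rfl⟩ | ⟨i, j, k, rfl⟩) | ⟨i, j, hij, rfl⟩)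
    · simpa only [map_pow, FreeGroup.lift_apply_of] using hpow i
    · simpa only [map_commutatorElement, FreeGroup.lift_apply_of] using
        commutatorElement_eq_one_iff_commute.2 (hclass i j k)
    · simpa only [map_commutatorElement, FreeGroup.lift_apply_of] using
        commutatorElement_eq_one_iff_commute.2 (hadj i j hij)

theorem lift_gen (v : V) : lift hpow hclass hadj (gen p Γ v) = f v :=
  PresentedGroup.toGroup.of _

end Lift

theorem commute_of_forall_gen {K : Type*} [Group K] (φ : MeklerGroup p Γ →* K) {y : K}
    (h : ∀ v, Commute (φ (gen p Γ v)) y) (x : MeklerGroup p Γ) : Commute (φ x) y :=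
  Subgroup.mem_centralizer_singleton_iff.1 <| Subgroup.mem_comap.1 <|
    PresentedGroup.generated_by _ ((Subgroup.centralizer {y}).comap φ)
      (fun v => Subgroup.mem_centralizer_singleton_iff.2 (h v)) x

theorem commutator_mem_center (x y : MeklerGroup p Γ) :
    ⁅x, y⁆ ∈ Subgroup.center (MeklerGroup p Γ) := by
  let π := QuotientGroup.mk' (Subgroup.center (MeklerGroup p Γ))
  have hgen : ∀ u v, Commute (π (gen p Γ u)) (π (gen p Γ v)) := fun u v => by
    rw [← commutatorElement_eq_one_iff_commute, ← map_commutatorElement]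
    exact (QuotientGroup.eq_one_iff _).2 (Subgroup.mem_center_iff.2
      (commute_of_forall_gen (MonoidHom.id _) fun w => (commute_commutator_gen u v w).symm))
  have hπ : Commute (π x) (π y) :=
    commute_of_forall_gen π (fun u => (commute_of_forall_gen π (hgen · u) y).symm) x
  rw [← commutatorElement_eq_one_iff_commute, ← map_commutatorElement] at hπ
  exact (QuotientGroup.eq_one_iff _).1 hπ

open Classical in
/-- The exponent vector as a homomorphism. -/
noncomputable def vecHom (p : ℕ) (Γ : SimpleGraph V) :
    MeklerGroup p Γ →* Multiplicative (V → ZMod p) :=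
  lift (f := fun v => Multiplicative.ofAdd (Pi.single v 1))
    (fun v => by
      rw [← ofAdd_nsmul, ← Pi.single_smul', nsmul_one, CharP.cast_eq_zero, Pi.single_zero,
        ofAdd_zero])
    (fun _ _ _ => Commute.all _ _) fun _ _ _ => Commute.all _ _

/-- The exponent vector of an element. -/
noncomputable def vec (x : MeklerGroup p Γ) : V → ZMod p := (vecHom p Γ x).toAdd

theorem vec_mul (x y : MeklerGroup p Γ) : vec (x * y) = vec x + vec y := by
  rw [vec, map_mul, toAdd_mul, vec, vec]

theorem vec_one : vec (1 : MeklerGroup p Γ) = 0 := by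
  rw [vec, map_one, toAdd_one]

theorem vec_pow (x : MeklerGroup p Γ) (n : ℕ) : vec (x ^ n) = n • vec x := by
  rw [vec, map_pow, toAdd_pow, vec]

theorem vec_gen [DecidableEq V] (v : V) : vec (gen p Γ v) = Pi.single v 1 := by
  rw [vec, vecHom, lift_gen, toAdd_ofAdd]
  convert rfl

theorem vec_gen_pow_val [DecidableEq V] [NeZero p] (v : V) (c : ZMod p) :
    vec (gen p Γ v ^ c.val) = Pi.single v c := by
  rw [vec_pow, vec_gen, ← Pi.single_smul', nsmul_one, ZMod.natCast_zmod_val]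

theorem vec_surjective [Finite V] [NeZero p] : Function.Surjective (vec (p := p) (Γ := Γ)) := by
  classical
  intro f
  induction f using Pi.single_induction with
  | zero => exact ⟨1, vec_one⟩
  | add f g hf hg =>
    obtain ⟨⟨x, rfl⟩, y, rfl⟩ := hf, hg
    exact ⟨x * y, vec_mul x y⟩
  | single v c => exact ⟨_, vec_gen_pow_val v c⟩

theorem exists_hom_heisenberg {u v : V} (huv : u ≠ v) (hadj : ¬ Γ.Adj u v) :
    ∃ φ : MeklerGroup p Γ →* Heisenberg (ZMod p), ∀ x, (φ x).a = vec x u ∧ (φ x).b = vec x v := by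
  classical
  let f : V → Heisenberg (ZMod p) :=
    fun w => ⟨(Pi.single w 1 : V → ZMod p) u, (Pi.single w 1 : V → ZMod p) v, 0⟩
  have hpow : ∀ w, f w ^ p = 1 := fun w => by
    have hab : (Pi.single w 1 : V → ZMod p) u * (Pi.single w 1 : V → ZMod p) v = 0 := by
      simp only [Pi.single_apply]
      grind
    rw [Heisenberg.pow_of_mul_eq_zero hab, CharP.cast_eq_zero, zero_mul, zero_mul]
    rfl
  have hcomm : ∀ w w', Γ.Adj w w' → Commute (f w) (f w') := fun w w' h => by
    rw [Heisenberg.commute_iff]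
    have h' := h.symm
    simp only [f, Pi.single_apply]
    grind
  let φ := lift hpow (fun _ _ _ => Heisenberg.commute_commutator _ _ _) hcomm
  let evalHom : Multiplicative (V → ZMod p) →* Multiplicative (ZMod p × ZMod p) :=
    ((Pi.evalAddMonoidHom _ u).prod (Pi.evalAddMonoidHom _ v)).toMultiplicative
  have hφ : (Heisenberg.abHom (ZMod p)).comp φ = evalHom.comp (vecHom p Γ) :=
    PresentedGroup.ext fun w => by
      change Heisenberg.abHom _ (φ (gen p Γ w)) = evalHom (Multiplicative.ofAdd (vec (gen p Γ w)))
      rw [lift_gen, vec_gen]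
      rfl
  exact ⟨φ, fun x => Prod.ext_iff.1 (DFunLike.congr_fun hφ x)⟩

theorem vec_mul_vec_eq_of_commute {x y : MeklerGroup p Γ} (h : Commute x y) {u v : V}
    (huv : u ≠ v) (hadj : ¬ Γ.Adj u v) : vec x u * vec y v = vec y u * vec x v := by
  obtain ⟨φ, hφ⟩ := exists_hom_heisenberg (p := p) huv hadj
  simpa only [hφ] using (Heisenberg.commute_iff _ _).1 (h.map φ)

variable [NeZero p]

theorem hom_eq_prod [Fintype V] {A : Type*} [CommGroup A] (ψ : MeklerGroup p Γ →* A)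
    (x : MeklerGroup p Γ) : ψ x = ∏ v, ψ (gen p Γ v) ^ (vec x v).val := by
  classical
  have hpow : ∀ v, ψ (gen p Γ v) ^ p = 1 := fun v => by rw [← map_pow, gen_pow, map_one]
  let φ : MeklerGroup p Γ →* A :=
    MonoidHom.mk' (fun x => ∏ v, ψ (gen p Γ v) ^ (vec x v).val) fun x y => by
      rw [← Finset.prod_mul_distrib]
      refine Finset.prod_congr rfl fun v _ => ?_
      rw [vec_mul, Pi.add_apply, ZMod.val_add, ← pow_add, ← pow_eq_pow_mod _ (hpow v)]
  refine DFunLike.congr_fun (PresentedGroup.ext (ψ := φ) fun v => ?_) x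
  change ψ (gen p Γ v) = ∏ w, ψ (gen p Γ w) ^ (vec (gen p Γ v) w).val
  rw [vec_gen, Finset.prod_eq_single_of_mem v (Finset.mem_univ v), Pi.single_eq_same,
    ZMod.val_one_eq_one_mod, ← pow_eq_pow_mod _ (hpow v), pow_one]
  intro w _ hw
  rw [Pi.single_eq_of_ne hw, ZMod.val_zero, pow_zero]

theorem mem_commutator_of_vec_eq_zero [Finite V] {x : MeklerGroup p Γ} (h : vec x = 0) :
    x ∈ commutator (MeklerGroup p Γ) := by
  cases nonempty_fintype V
  rw [← Abelianization.ker_of, MonoidHom.mem_ker, hom_eq_prod Abelianization.of, h]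
  simp only [Pi.zero_apply, ZMod.val_zero, pow_zero, Finset.prod_const_one]

section Commutator

open scoped IsMulCommutative

theorem commutatorHom_eq_prod [Fintype V] (x y : MeklerGroup p Γ) :
    commutatorHom commutator_mem_center y x = ∏ a : V × V,
      commutatorHom commutator_mem_center (gen p Γ a.2) (gen p Γ a.1) ^
        ((vec y a.2).val * (vec x a.1).val) := by
  have hgen : ∀ u, commutatorHom commutator_mem_center y (gen p Γ u) = ∏ v,
      commutatorHom commutator_mem_center (gen p Γ v) (gen p Γ u) ^ (vec y v).val := fun u => by
    rw [← commutatorHom_inv, hom_eq_prod (commutatorHom commutator_mem_center (gen p Γ u)) y,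
      ← Finset.prod_inv_distrib]
    simp only [← inv_pow, commutatorHom_inv]
  rw [hom_eq_prod (commutatorHom commutator_mem_center y) x, Fintype.prod_prod_type]
  simp only [hgen, ← Finset.prod_pow, ← pow_mul]

theorem commutator_congr [Finite V] {x x' y y' : MeklerGroup p Γ} (hx : vec x = vec x')
    (hy : vec y = vec y') : ⁅x, y⁆ = ⁅x', y'⁆ := by
  cases nonempty_fintype V
  refine congrArg Subtype.val (?_ : commutatorHom commutator_mem_center y x =
    commutatorHom commutator_mem_center y' x')
  rw [commutatorHom_eq_prod, commutatorHom_eq_prod, hx, hy]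

theorem commute_iff [Finite V] {x y : MeklerGroup p Γ} : Commute x y ↔
    ∀ u v, u ≠ v → ¬ Γ.Adj u v → vec x u * vec y v = vec y u * vec x v := by
  cases nonempty_fintype V
  refine ⟨fun h u v => vec_mul_vec_eq_of_commute h, fun h => ?_⟩
  let c : V → V → Subgroup.center (MeklerGroup p Γ) :=
    fun u v => commutatorHom commutator_mem_center (gen p Γ v) (gen p Γ u)
  have hpow : ∀ u v, c u v ^ p = 1 := fun u v => by rw [← map_pow, gen_pow, map_one]
  have hmul : ∀ u v, c u v * c v u = 1 := fun u v =>
    mul_eq_one_iff_eq_inv.2 (commutatorHom_inv (gen p Γ u) (gen p Γ v)).symm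
  have hone : ∀ u v, u = v ∨ Γ.Adj u v → c u v = 1 := fun u v huv =>
    commutatorHom_eq_one_iff.2 (huv.elim (fun h => h ▸ .refl _) commute_gen_of_adj)
  rw [← commutatorHom_eq_one_iff (hG := commutator_mem_center), commutatorHom_eq_prod]
  -- The factors at `(u, v)` and `(v, u)` are inverse to each other.
  refine Finset.prod_involution (fun a _ => a.swap) ?_ ?_ (fun _ _ => Finset.mem_univ _)
    fun a _ => a.swap_swap
  · rintro ⟨u, v⟩ -
    change c u v ^ ((vec y v).val * (vec x u).val) * c v u ^ ((vec y u).val * (vec x v).val) = 1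
    by_cases huv : u = v ∨ Γ.Adj u v
    · rw [hone u v huv, hone v u (huv.imp Eq.symm SimpleGraph.Adj.symm), one_pow, one_pow, one_mul]
    · rw [not_or] at huv
      have hmod : (vec y u).val * (vec x v).val % p = (vec y v).val * (vec x u).val % p := by
        rw [← ZMod.natCast_eq_natCast_iff']
        push_cast
        rw [ZMod.natCast_zmod_val, ZMod.natCast_zmod_val, ZMod.natCast_zmod_val,
          ZMod.natCast_zmod_val, ← h u v huv.1 huv.2, mul_comm]
      rw [pow_eq_pow_mod (_ * (vec x v).val) (hpow v u), hmod, ← pow_eq_pow_mod _ (hpow v u),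
        ← mul_pow, hmul, one_pow]
  · rintro ⟨u, v⟩ - hne heq
    obtain rfl : v = u := congrArg Prod.fst heq
    exact hne (by change c v v ^ _ = 1; rw [hone v v (Or.inl rfl), one_pow])

end Commutator

instance [Finite V] : Finite (MeklerGroup p Γ) := by
  have hsurj : Function.Surjective (vec (p := p) (Γ := Γ)) := vec_surjective
  have hcomm : Finite (commutatorSet (MeklerGroup p Γ)) := by
    refine ((Set.finite_range fun a : (V → ZMod p) × (V → ZMod p) =>
      ⁅Function.surjInv hsurj a.1, Function.surjInv hsurj a.2⁆).subset ?_).to_subtype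
    rintro _ ⟨x, y, rfl⟩
    exact ⟨(vec x, vec y), commutator_congr (Function.surjInv_eq _ _) (Function.surjInv_eq _ _)⟩
  have hcommutator : Finite (commutator (MeklerGroup p Γ)) := inferInstance
  have hker : Finite (vecHom p Γ).ker :=
    Finite.Set.subset (commutator (MeklerGroup p Γ) : Set (MeklerGroup p Γ))
      fun x hx => mem_commutator_of_vec_eq_zero hx
  have hquot : Finite (MeklerGroup p Γ ⧸ (vecHom p Γ).ker) :=
    Finite.of_equiv (V → ZMod p)
      (QuotientGroup.quotientKerEquivOfSurjective (vecHom p Γ) hsurj).symm.toEquiv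
  exact Finite.of_equiv _ (Subgroup.groupEquivQuotientProdSubgroup (s := (vecHom p Γ).ker)).symm

end MeklerGroup

/-! ### Singular elements -/

section Singular

variable {K : Type*} [Group K]

/-- An element is singular if it is not central and its centralizer is not abelian. -/
def IsSingular (x : K) : Prop :=
  (∃ y, ¬ Commute x y) ∧ ∃ y, Commute x y ∧ ∃ z, Commute x z ∧ ¬ Commute y z

/-- Two elements have the same centralizer. -/
def SameCentralizer (x y : K) : Prop := ∀ z, Commute x z ↔ Commute y z

namespace SameCentralizer

theorem refl (x : K) : SameCentralizer x x := fun _ => Iff.rfl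

variable {x x' y y' z : K}

theorem symm (h : SameCentralizer x y) : SameCentralizer y x := fun z => (h z).symm

theorem trans (h : SameCentralizer x y) (h' : SameCentralizer y z) : SameCentralizer x z :=
  fun w => (h w).trans (h' w)

theorem commute_congr (hx : SameCentralizer x x') (hy : SameCentralizer y y') :
    Commute x y ↔ Commute x' y' := by
  rw [hx y, Commute.symm_iff, hy x', Commute.symm_iff]

theorem congr (hx : SameCentralizer x x') (hy : SameCentralizer y y') :
    SameCentralizer x y ↔ SameCentralizer x' y' :=
  ⟨fun h => hx.symm.trans (h.trans hy), fun h => hx.trans (h.trans hy.symm)⟩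

end SameCentralizer

/-- The map `q` identifies the classes of singular elements with the vertices of `Δ`, such that
adjacency is commutation. -/
structure IsReading {W : Type*} (Δ : SimpleGraph W) (q : {x : K // IsSingular x} → W) : Prop where
  surjective : Function.Surjective q
  eq_iff : ∀ x y, q x = q y ↔ SameCentralizer (x : K) y
  adj_iff : ∀ x y, Δ.Adj (q x) (q y) ↔ Commute (x : K) y ∧ ¬ SameCentralizer (x : K) y

theorem IsReading.comp_iso {W W' : Type*} {Δ : SimpleGraph W} {Δ' : SimpleGraph W'}
    {q : {x : K // IsSingular x} → W} (hq : IsReading Δ q) (e : Δ ≃g Δ') :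
    IsReading Δ' (e ∘ q) where
  surjective := e.surjective.comp hq.surjective
  eq_iff x y := e.injective.eq_iff.trans (hq.eq_iff x y)
  adj_iff x y := e.map_rel_iff.trans (hq.adj_iff x y)

/-- The setoid of singular elements with the same centralizer. -/
def singularSetoid (K : Type*) [Group K] : Setoid {x : K // IsSingular x} where
  r x y := SameCentralizer (x : K) y
  iseqv := ⟨fun _ => .refl _, fun h => h.symm, fun h h' => h.trans h'⟩

/-- The commutation graph on the classes of singular elements. -/
def singularGraph (K : Type*) [Group K] : SimpleGraph (Quotient (singularSetoid K)) where
  Adj := Quotient.lift₂ (fun x y => Commute (x : K) y ∧ ¬ SameCentralizer (x : K) y)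
    fun _ _ _ _ hx hy => propext (and_congr (hx.commute_congr hy) (not_congr (hx.congr hy)))
  symm := ⟨by
    rintro ⟨x⟩ ⟨y⟩ ⟨hcomm, hne⟩
    exact ⟨hcomm.symm, fun h => hne h.symm⟩⟩
  loopless := ⟨by
    rintro ⟨x⟩ ⟨_, h⟩
    exact h (.refl _)⟩

theorem isReading_singularGraph (K : Type*) [Group K] :
    IsReading (singularGraph K) (Quotient.mk (singularSetoid K)) where
  surjective := Quotient.mk_surjective
  eq_iff _ _ := Quotient.eq
  adj_iff _ _ := Iff.rfl

/-- The elements that are products of at most `m` singular elements modulo the center. -/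
def WeightLE : ℕ → K → Prop
  | 0, x => ∀ y, Commute x y
  | m + 1, x => WeightLE m x ∨ ∃ d, IsSingular d ∧ WeightLE m (x * d)

/-- The class of the singular element `u` occurs in every shortest expression of `x` as a product of
singular elements modulo the center. -/
def InSupport (x u : K) : Prop :=
  ∃ m, ¬ WeightLE m x ∧ ∃ d, (IsSingular d ∧ SameCentralizer u d) ∧ WeightLE m (x * d)

theorem InSupport.congr {x u u' : K} (h : SameCentralizer u u') :
    InSupport x u ↔ InSupport x u' :=
  exists_congr fun _ => and_congr_right fun _ => exists_congr fun d =>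
    and_congr_left fun _ => and_congr_right fun _ => h.congr (.refl d)

/-- The products of `m` commutators. -/
def IsCommutatorProd : ℕ → K → Prop
  | 0, x => x = 1
  | m + 1, x => ∃ c ∈ commutatorSet K, IsCommutatorProd m (x * c)

theorem mem_commutator_iff_exists_isCommutatorProd (x : K) :
    x ∈ commutator K ↔ ∃ m, IsCommutatorProd m x := by
  constructor
  · intro hx
    rw [commutator_eq_closure] at hx
    induction hx using Subgroup.closure_induction_right with
    | one => exact ⟨0, rfl⟩
    | mul_right y _ c hc ih =>
      obtain ⟨m, hm⟩ := ih
      obtain ⟨a, b, rfl⟩ := hc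
      refine ⟨m + 1, ⁅b, a⁆, ⟨b, a, rfl⟩, ?_⟩
      rwa [mul_assoc, ← commutatorElement_inv a b, mul_inv_cancel, mul_one]
    | mul_inv_cancel y _ c hc ih =>
      obtain ⟨m, hm⟩ := ih
      refine ⟨m + 1, c, hc, ?_⟩
      rwa [mul_assoc, inv_mul_cancel, mul_one]
  · rintro ⟨m, hm⟩
    induction m generalizing x with
    | zero => exact hm ▸ one_mem _
    | succ m ih =>
      obtain ⟨c, hc, h⟩ := hm
      have hmem : c ∈ commutator K := commutator_eq_closure K ▸ Subgroup.subset_closure hc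
      exact (Subgroup.mul_mem_cancel_right _ hmem).1 (ih _ h)

end Singular

/-- Graphs without triangles and `4`-cycles in which every vertex has at least two neighbours. -/
structure IsSparse {V : Type*} (Γ : SimpleGraph V) : Prop where
  eq_of_adj : ∀ {u v z z'}, u ≠ v → Γ.Adj u z → Γ.Adj v z → Γ.Adj u z' → Γ.Adj v z' → z = z'
  not_adj : ∀ {u v w}, Γ.Adj u v → Γ.Adj v w → ¬ Γ.Adj u w
  exists_two : ∀ v, ∃ w w', w ≠ w' ∧ Γ.Adj v w ∧ Γ.Adj v w'

theorem IsSparse.exists_not_adj {V : Type*} {Γ : SimpleGraph V} (hΓ : IsSparse Γ) (u : V) :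
    ∃ v, v ≠ u ∧ ¬ Γ.Adj u v := by
  obtain ⟨w, _, _, hw, _⟩ := hΓ.exists_two u
  obtain ⟨a, b, hab, ha, hb⟩ := hΓ.exists_two w
  obtain rfl | hau := eq_or_ne a u
  · exact ⟨b, hab.symm, hΓ.not_adj hw hb⟩
  · exact ⟨a, hau, hΓ.not_adj hw ha⟩

namespace MeklerGroup

variable {V : Type u} {p : ℕ} {Γ : SimpleGraph V}

/-- The vertices with nonzero exponent in `x`. -/
def support (x : MeklerGroup p Γ) : Set V := Function.support (vec x)

theorem support_mul_sdiff {v : V} {d : MeklerGroup p Γ} (hd : support d = {v})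
    (x : MeklerGroup p Γ) : support (x * d) \ {v} = support x \ {v} := by
  ext u
  refine and_congr_left fun hu => ?_
  have hdu : vec d u = 0 := by
    rw [← Function.notMem_support]
    exact fun h => hu (hd ▸ h)
  rw [support, Function.mem_support, vec_mul, Pi.add_apply, hdu, add_zero]
  rfl

theorem exists_support_eq [Finite V] [Fact p.Prime] (S : Set V) :
    ∃ x : MeklerGroup p Γ, support x = S := by
  obtain ⟨x, hx⟩ := vec_surjective (p := p) (Γ := Γ) (S.indicator 1)
  refine ⟨x, ?_⟩
  rw [support, hx, Set.support_indicator, Function.support_one, Set.inter_univ]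

theorem exists_support_mul_eq_sdiff [Finite V] [NeZero p] {x : MeklerGroup p Γ} {v : V}
    (hv : v ∈ support x) :
    ∃ d : MeklerGroup p Γ, support d = {v} ∧ support (x * d) = support x \ {v} := by
  classical
  obtain ⟨d, hd⟩ := vec_surjective (p := p) (Γ := Γ) (Pi.single v (-vec x v))
  have hdv : support d = {v} := by
    rw [support, hd]
    exact Pi.support_single_of_ne (neg_ne_zero.2 hv)
  refine ⟨d, hdv, ?_⟩
  have hvxd : v ∉ support (x * d) := by
    rw [support, Function.notMem_support, vec_mul, hd, Pi.add_apply, Pi.single_eq_same,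
      add_neg_cancel]
  rw [← support_mul_sdiff hdv, Set.sdiff_singleton_eq_self hvxd]

theorem card_support_eq_singleton [Finite V] [NeZero p] (v : V) :
    Nat.card {x : MeklerGroup p Γ // support x = {v}} =
      Nat.card (vecHom p Γ).ker * Nat.card {c : ZMod p // c ≠ 0} := by
  classical
  have hfiber : ∀ f, Nat.card {x : MeklerGroup p Γ // vec x = f} = Nat.card (vecHom p Γ).ker := by
    intro f
    obtain ⟨x, rfl⟩ := vec_surjective (p := p) (Γ := Γ) f
    exact Nat.card_congr ((vecHom p Γ).fiberEquivKer x)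
  let e : {c : ZMod p // c ≠ 0} ≃ {f : V → ZMod p // Function.support f = {v}} :=
    { toFun := fun c => ⟨Pi.single v c, Pi.support_single_of_ne c.2⟩
      invFun := fun f => ⟨f.1 v, by
        rw [← Function.mem_support, f.2]
        rfl⟩
      left_inv := fun c => Subtype.ext (Pi.single_eq_same (M := fun _ => ZMod p) v c.1)
      right_inv := fun f => Subtype.ext <| by
        ext u
        obtain rfl | hu := eq_or_ne u v
        · exact Pi.single_eq_same (M := fun _ => ZMod p) u (f.1 u)
        · refine (Pi.single_eq_of_ne hu _).trans (Function.notMem_support.1 ?_).symm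
          rw [f.2]
          exact hu }
  rw [Nat.card_congr e]
  exact card_subtype_comp vec hfiber fun f => Function.support f = {v}

variable [Finite V] [Fact p.Prime] {x y z d : MeklerGroup p Γ} {u v : V}

theorem commute_iff_of_support_eq (hx : support x = {v}) :
    Commute x y ↔ ∀ u ∈ support y, u = v ∨ Γ.Adj v u := by
  have hv : v ∈ support x := hx ▸ Set.mem_singleton v
  have hzero : ∀ u, u ≠ v → vec x u = 0 := fun u hu =>
    Function.notMem_support.1 fun h : u ∈ support x => hu (hx.subset h)
  refine ⟨fun h u hu => ?_, fun h => commute_iff.2 fun r s hrs hadj => ?_⟩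
  · by_contra! hne
    have heq := vec_mul_vec_eq_of_commute h hne.1.symm hne.2
    rw [hzero u hne.1, mul_zero] at heq
    exact mul_ne_zero hv hu heq
  · have hy : ∀ u, u ≠ v → ¬ Γ.Adj v u → vec y u = 0 := fun u hu hvu =>
      not_not.1 fun hyu => (h u hyu).elim hu hvu
    obtain rfl | hr := eq_or_ne r v
    · rw [hy s hrs.symm hadj, hzero s hrs.symm, mul_zero, mul_zero]
    obtain rfl | hs := eq_or_ne s v
    · rw [hy r hrs fun h => hadj h.symm, hzero r hr, zero_mul, zero_mul]
    · rw [hzero r hr, hzero s hs, zero_mul, mul_zero]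

theorem commute_iff_eq_or_adj (hx : support x = {u}) (hy : support y = {v}) :
    Commute x y ↔ u = v ∨ Γ.Adj u v := by
  rw [commute_iff_of_support_eq hx, hy]
  simp only [Set.mem_singleton_iff, forall_eq, @eq_comm V v]

theorem forall_commute_iff (hΓ : IsSparse Γ) : (∀ y, Commute x y) ↔ support x = ∅ := by
  constructor
  · refine fun h => Set.eq_empty_iff_forall_notMem.2 fun u hu => ?_
    obtain ⟨v, hvu, hadj⟩ := hΓ.exists_not_adj u
    obtain ⟨y, hy⟩ := exists_support_eq (p := p) (Γ := Γ) {v}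
    exact ((commute_iff_of_support_eq hy).1 (h y).symm u hu).elim hvu.symm fun h => hadj h.symm
  · intro h y
    have hx : vec x = 0 := Function.support_eq_empty_iff.1 h
    refine commute_iff.2 fun r s _ _ => ?_
    rw [hx, Pi.zero_apply, Pi.zero_apply, zero_mul, mul_zero]

theorem sameCentralizer_iff (hΓ : IsSparse Γ) (hx : support x = {u}) (hy : support y = {v}) :
    SameCentralizer x y ↔ u = v := by
  constructor
  · intro h
    by_contra huv
    have hcomm : ∀ w, u = w ∨ Γ.Adj u w → v = w ∨ Γ.Adj v w := fun w hw => by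
      obtain ⟨z, hz⟩ := exists_support_eq (p := p) (Γ := Γ) {w}
      exact (commute_iff_eq_or_adj hy hz).1 ((h z).1 ((commute_iff_eq_or_adj hx hz).2 hw))
    have hadj : Γ.Adj v u := (hcomm u (Or.inl rfl)).resolve_left (Ne.symm huv)
    obtain ⟨a, b, hab, ha, hb⟩ := hΓ.exists_two u
    have heq : ∀ w, Γ.Adj u w → v = w := fun w hw =>
      (hcomm w (Or.inr hw)).resolve_right (hΓ.not_adj hadj hw)
    exact hab ((heq a ha).symm.trans (heq b hb))
  · rintro rfl z
    rw [commute_iff_of_support_eq hx, commute_iff_of_support_eq hy]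

theorem exists_ne_forall_mem_support_adj (hy : Commute x y) (hz : Commute x z)
    (hyz : ¬ Commute y z) : ∃ r s, r ≠ s ∧ ∀ u ∈ support x, Γ.Adj r u ∧ Γ.Adj s u := by
  rw [commute_iff] at hyz
  push Not at hyz
  obtain ⟨r, s, hrs, hadj, hne⟩ := hyz
  have hyrs := vec_mul_vec_eq_of_commute hy hrs hadj
  have hzrs := vec_mul_vec_eq_of_commute hz hrs hadj
  have hr : vec x r = 0 := by
    by_contra hr
    exact hne (mul_left_cancel₀ hr (by linear_combination vec y r * hzrs - vec z r * hyrs))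
  have hs : vec x s = 0 := by
    by_contra hs
    exact hne (mul_left_cancel₀ hs (by linear_combination vec y s * hzrs - vec z s * hyrs))
  have hzero : ∀ u ∈ support x, ∀ t, vec x t = 0 → ¬ Γ.Adj t u → ∀ w, Commute x w →
      vec w t = 0 := fun u hu t ht htu w hw => by
    have heq := vec_mul_vec_eq_of_commute hw (fun h : t = u => hu (h ▸ ht)) htu
    rw [ht, zero_mul] at heq
    exact (mul_eq_zero.1 heq.symm).resolve_right hu
  refine ⟨r, s, hrs, fun u hu => ⟨?_, ?_⟩⟩ <;> by_contra h
  · rw [hzero u hu r hr h y hy, hzero u hu r hr h z hz, zero_mul, zero_mul] at hne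
    exact hne rfl
  · rw [hzero u hu s hs h y hy, hzero u hu s hs h z hz, mul_zero, mul_zero] at hne
    exact hne rfl

theorem isSingular_iff (hΓ : IsSparse Γ) : IsSingular x ↔ ∃ v, support x = {v} := by
  constructor
  · rintro ⟨hx, y, hy, z, hz, hyz⟩
    rw [← not_forall, forall_commute_iff hΓ] at hx
    obtain ⟨r, s, hrs, hadj⟩ := exists_ne_forall_mem_support_adj hy hz hyz
    obtain ⟨v, hv⟩ := Set.nonempty_iff_ne_empty.2 hx
    exact ⟨v, Set.eq_singleton_iff_unique_mem.2 ⟨hv, fun u hu =>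
      hΓ.eq_of_adj hrs (hadj u hu).1 (hadj u hu).2 (hadj v hv).1 (hadj v hv).2⟩⟩
  · rintro ⟨v, hv⟩
    obtain ⟨w, w', hww, hw, hw'⟩ := hΓ.exists_two v
    obtain ⟨y, hy⟩ := exists_support_eq (p := p) (Γ := Γ) {w}
    obtain ⟨z, hz⟩ := exists_support_eq (p := p) (Γ := Γ) {w'}
    refine ⟨?_, y, (commute_iff_eq_or_adj hv hy).2 (Or.inr hw), z,
      (commute_iff_eq_or_adj hv hz).2 (Or.inr hw'), ?_⟩
    · rw [← not_forall, forall_commute_iff hΓ, hv]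
      exact Set.singleton_ne_empty v
    · rw [commute_iff_eq_or_adj hy hz, not_or]
      exact ⟨hww, fun h => hΓ.not_adj hw h hw'⟩

theorem exists_isReading (hΓ : IsSparse Γ) :
    ∃ q : {x : MeklerGroup p Γ // IsSingular x} → V, IsReading Γ q ∧
      ∀ x : {x : MeklerGroup p Γ // IsSingular x}, support x.1 = {q x} := by
  choose q hq using fun x : {x : MeklerGroup p Γ // IsSingular x} => (isSingular_iff hΓ).1 x.2
  refine ⟨q, ⟨fun v => ?_, fun x y => (sameCentralizer_iff hΓ (hq x) (hq y)).symm,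
    fun x y => ?_⟩, hq⟩
  · obtain ⟨x, hx⟩ := exists_support_eq (p := p) (Γ := Γ) {v}
    refine ⟨⟨x, (isSingular_iff hΓ).2 ⟨v, hx⟩⟩, ?_⟩
    exact Set.singleton_injective ((hq _).symm.trans hx)
  · rw [commute_iff_eq_or_adj (hq x) (hq y), sameCentralizer_iff hΓ (hq x) (hq y)]
    exact ⟨fun h => ⟨Or.inr h, h.ne⟩, fun h => h.1.resolve_left h.2⟩

theorem weightLE_iff (hΓ : IsSparse Γ) {m : ℕ} : WeightLE m x ↔ (support x).ncard ≤ m := by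
  induction m generalizing x with
  | zero => rw [WeightLE, forall_commute_iff hΓ, Nat.le_zero, Set.ncard_eq_zero]
  | succ m ih =>
    rw [WeightLE, ih]
    constructor
    · rintro (h | ⟨d, hd, h⟩)
      · exact h.trans m.le_succ
      · obtain ⟨v, hv⟩ := (isSingular_iff hΓ).1 hd
        rw [ih] at h
        have hsub : support x \ {v} ⊆ support (x * d) :=
          (support_mul_sdiff hv x).symm.subset.trans Set.sdiff_subset
        have hle := (Set.ncard_le_ncard_sdiff_add_ncard (support x) {v}).trans
          (Nat.add_le_add_right ((Set.ncard_le_ncard hsub).trans h) _)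
        rwa [Set.ncard_singleton] at hle
    · intro h
      obtain hempty | ⟨v, hv⟩ := (support x).eq_empty_or_nonempty
      · rw [hempty, Set.ncard_empty]
        exact Or.inl m.zero_le
      · obtain ⟨d, hd, hxd⟩ := exists_support_mul_eq_sdiff hv
        refine Or.inr ⟨d, (isSingular_iff hΓ).2 ⟨v, hd⟩, ?_⟩
        rw [ih, hxd, Set.ncard_sdiff_singleton_of_mem hv]
        exact Nat.sub_le_of_le_add h

theorem inSupport_iff (hΓ : IsSparse Γ) (hy : support y = {v}) :
    InSupport x y ↔ v ∈ support x := by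
  constructor
  · rintro ⟨m, hm, d, ⟨hd, hyd⟩, h⟩
    obtain ⟨w, hw⟩ := (isSingular_iff hΓ).1 hd
    obtain rfl : v = w := (sameCentralizer_iff hΓ hy hw).1 hyd
    by_contra hv
    rw [weightLE_iff hΓ] at hm h
    have hsub : support x ⊆ support (x * d) := by
      rw [← Set.sdiff_singleton_eq_self hv, ← support_mul_sdiff hw]
      exact Set.sdiff_subset
    exact hm ((Set.ncard_le_ncard hsub).trans h)
  · intro hv
    obtain ⟨d, hd, hxd⟩ := exists_support_mul_eq_sdiff hv
    refine ⟨(support (x * d)).ncard, ?_, d, ⟨(isSingular_iff hΓ).2 ⟨v, hd⟩,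
      (sameCentralizer_iff hΓ hy hd).2 rfl⟩, (weightLE_iff hΓ).2 le_rfl⟩
    rw [weightLE_iff hΓ, hxd, not_le]
    exact Set.ncard_sdiff_singleton_lt_of_mem hv

end MeklerGroup

/-! ### Games on groups -/

/-- A back-and-forth relation between triples of elements of two groups such that related triples
satisfy the same equations. -/
structure IsGroupGame {G H : Type*} [Group G] [Group H] (R : (Fin 3 → G) → (Fin 3 → H) → Prop) :
    Prop extends IsBackForth R where
  markedType_eq : ∀ g h, R g h → markedType g = markedType h

theorem GroupWLEquiv.isGroupGame {G H : Type*} [Group G] [Group H] [Finite G] [Finite H]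
    (h : GroupWLEquiv 3 G H) :
    IsGroupGame fun (g : Fin 3 → G) (h : Fin 3 → H) =>
      wlFinalColor markedType g = wlFinalColor markedType h :=
  let ⟨_, hf⟩ := h
  { toIsBackForth := isBackForth_wlFinalColor_eq (hf 1)
    markedType_eq := fun _ _ hgh => congrFun hgh 0 }

namespace IsGroupGame

variable {G H : Type*} [Group G] [Group H] {R : (Fin 3 → G) → (Fin 3 → H) → Prop}
  (hR : IsGroupGame R)

include hR

theorem lift_eq_one_iff {g : Fin 3 → G} {h : Fin 3 → H} (hgh : R g h) (w : FreeGroup (Fin 3)) :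
    FreeGroup.lift g w = 1 ↔ FreeGroup.lift h w = 1 := by
  have hker : (FreeGroup.lift g).ker = (FreeGroup.lift h).ker := hR.markedType_eq g h hgh
  rw [← MonoidHom.mem_ker, hker, MonoidHom.mem_ker]

theorem invariant_eq : Invariant₂ R (· = ·) (· = ·) := fun g h hgh i j => by
  simpa only [map_mul, map_inv, FreeGroup.lift_apply_of, mul_inv_eq_one]
    using hR.lift_eq_one_iff hgh (.of i * (.of j)⁻¹)

theorem invariant_commute : Invariant₂ R Commute Commute := fun g h hgh i j => by
  simpa only [map_commutatorElement, FreeGroup.lift_apply_of, commutatorElement_eq_one_iff_commute]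
    using hR.lift_eq_one_iff hgh ⁅FreeGroup.of i, FreeGroup.of j⁆

theorem invariant_eq_commutator :
    Invariant₃ R (fun c x y => ⁅x, y⁆ = c) (fun c x y => ⁅x, y⁆ = c) := fun g h hgh i j k => by
  simpa only [map_mul, map_inv, map_commutatorElement, FreeGroup.lift_apply_of, mul_inv_eq_one]
    using hR.lift_eq_one_iff hgh (⁅FreeGroup.of j, FreeGroup.of k⁆ * (.of i)⁻¹)

theorem invariant_commute_commutator :
    Invariant₃ R (fun x y z => Commute ⁅x, y⁆ z) (fun x y z => Commute ⁅x, y⁆ z) :=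
  fun g h hgh i j k => by
    simpa only [map_commutatorElement, FreeGroup.lift_apply_of,
      commutatorElement_eq_one_iff_commute] using hR.lift_eq_one_iff hgh
        ⁅⁅FreeGroup.of i, FreeGroup.of j⁆, FreeGroup.of k⁆

theorem invariant_pow_eq_one (n : ℕ) : Invariant₁ R (· ^ n = 1) (· ^ n = 1) :=
  fun g h hgh i => by
    simpa only [map_pow, FreeGroup.lift_apply_of] using hR.lift_eq_one_iff hgh (.of i ^ n)

theorem invariant_mul_pow {P : G → Prop} {P' : H → Prop} (hP : Invariant₁ R P P') (n : ℕ) :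
    Invariant₂ R (fun x y => P (x * y ^ n)) (fun x y => P' (x * y ^ n)) := by
  have hprod : Invariant₃ R (fun x y z => x * y ^ n = z ∧ P z)
      (fun x y z => x * y ^ n = z ∧ P' z) :=
    fun g h hgh i j k => and_congr (by
      simpa only [map_mul, map_inv, map_pow, FreeGroup.lift_apply_of, mul_inv_eq_one]
        using hR.lift_eq_one_iff hgh (.of i * .of j ^ n * (.of k)⁻¹)) (hP hgh k)
  simpa only [exists_eq_left'] using hprod.exists_last hR.toIsBackForth

theorem invariant_mul {P : G → Prop} {P' : H → Prop} (hP : Invariant₁ R P P') :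
    Invariant₂ R (fun x y => P (x * y)) (fun x y => P' (x * y)) := by
  simpa only [pow_one] using hR.invariant_mul_pow hP 1

theorem invariant_central : Invariant₁ R (fun x => ∀ y, Commute x y) (fun x => ∀ y, Commute x y) :=
  hR.invariant_commute.forall_last hR.toIsBackForth

theorem invariant_isSingular : Invariant₁ R IsSingular IsSingular := by
  have hcomm := hR.invariant_commute
  have hpair : Invariant₃ R (fun x y z : G => Commute x z ∧ ¬ Commute y z)
      (fun x y z : H => Commute x z ∧ ¬ Commute y z) :=
    fun _ _ hgh i j k => and_congr (hcomm hgh i k) (not_congr (hcomm hgh j k))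
  exact fun _ _ hgh i => and_congr (hcomm.not.exists_last hR.toIsBackForth hgh i)
    ((hcomm.and (hpair.exists_last hR.toIsBackForth)).exists_last hR.toIsBackForth hgh i)

theorem invariant_sameCentralizer : Invariant₂ R SameCentralizer SameCentralizer :=
  Invariant₃.forall_last (P := fun x y z : G => Commute x z ↔ Commute y z)
    (P' := fun x y z : H => Commute x z ↔ Commute y z) (fun _ _ hgh i j k =>
      iff_congr (hR.invariant_commute hgh i k) (hR.invariant_commute hgh j k)) hR.toIsBackForth

theorem invariant_isSingular_and_sameCentralizer :
    Invariant₂ R (fun x y => IsSingular y ∧ SameCentralizer x y)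
      (fun x y => IsSingular y ∧ SameCentralizer x y) :=
  fun _ _ hgh i j => and_congr (hR.invariant_isSingular hgh j)
    (hR.invariant_sameCentralizer hgh i j)

theorem invariant_weightLE (m : ℕ) : Invariant₁ R (WeightLE m) (WeightLE m) := by
  induction m with
  | zero => exact hR.invariant_central
  | succ m ih =>
    have hfactor : Invariant₂ R (fun x d => IsSingular d ∧ WeightLE m (x * d))
        (fun x d => IsSingular d ∧ WeightLE m (x * d)) := fun _ _ hgh i j =>
      and_congr (hR.invariant_isSingular hgh j) (hR.invariant_mul ih hgh i j)
    exact fun _ _ hgh i => or_congr (ih hgh i) (hfactor.exists_last hR.toIsBackForth hgh i)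

theorem invariant_inSupport : Invariant₂ R InSupport InSupport := by
  have hfactor : ∀ m, Invariant₃ R
      (fun x u d => (IsSingular d ∧ SameCentralizer u d) ∧ WeightLE m (x * d))
      (fun x u d => (IsSingular d ∧ SameCentralizer u d) ∧ WeightLE m (x * d)) :=
    fun m _ _ hgh i j k => and_congr (hR.invariant_isSingular_and_sameCentralizer hgh j k)
      (hR.invariant_mul (hR.invariant_weightLE m) hgh i k)
  exact fun _ _ hgh i j => exists_congr fun m => and_congr
    (not_congr (hR.invariant_weightLE m hgh i)) ((hfactor m).exists_last hR.toIsBackForth hgh i j)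

theorem invariant_isCommutatorProd (m : ℕ) :
    Invariant₁ R (IsCommutatorProd m) (IsCommutatorProd m) := by
  induction m with
  | zero =>
    have hone := hR.invariant_pow_eq_one 1
    simp only [pow_one] at hone
    exact hone
  | succ m ih =>
    have hset : Invariant₁ R (· ∈ commutatorSet G) (· ∈ commutatorSet H) :=
      (hR.invariant_eq_commutator.exists_last hR.toIsBackForth).exists_last hR.toIsBackForth
    have hfactor : Invariant₂ R (fun x c => c ∈ commutatorSet G ∧ IsCommutatorProd m (x * c))
        (fun x c => c ∈ commutatorSet H ∧ IsCommutatorProd m (x * c)) := fun _ _ hgh i j =>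
      and_congr (hset hgh j) (hR.invariant_mul ih hgh i j)
    exact hfactor.exists_last hR.toIsBackForth

theorem update_of_mem {g : Fin 3 → G} {h : Fin 3 → H} (hgh : R g h) (i j : Fin 3) :
    R (Function.update g j (g i)) (Function.update h j (h i)) := by
  obtain rfl | hij := eq_or_ne i j
  · rwa [Function.update_eq_self, Function.update_eq_self]
  obtain ⟨π, hπ⟩ := hR.step g h hgh
  have hstep := hπ j (g i)
  have heq := hR.invariant_eq hstep i j
  simp only [Function.update_self, Function.update_of_ne hij, true_iff] at heq
  rwa [heq]

theorem piecewise {g : Fin 3 → G} {h : Fin 3 → H} (hgh : R g h) (i : Fin 3)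
    (s : Finset (Fin 3)) : R (s.piecewise (fun _ => g i) g) (s.piecewise (fun _ => h i) h) := by
  induction s using Finset.induction_on with
  | empty => rwa [Finset.piecewise_empty, Finset.piecewise_empty]
  | insert k s _ ih =>
    have hleft : s.piecewise (fun _ => g i) g i = g i := ite_self (g i)
    have hright : s.piecewise (fun _ => h i) h i = h i := ite_self (h i)
    have hupd := hR.update_of_mem ih i k
    rw [hleft, hright] at hupd
    rwa [Finset.piecewise_insert, Finset.piecewise_insert]

end IsGroupGame

section Reading

variable {G H A B : Type*} [Group G] [Group H] {R : (Fin 3 → G) → (Fin 3 → H) → Prop}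
  {Δ : SimpleGraph A} {Δ' : SimpleGraph B} {q : {x : G // IsSingular x} → A}
  {q' : {x : H // IsSingular x} → B} {m : ℕ}

theorem IsReading.card_fiber (hq : IsReading Δ q) (x : {x : G // IsSingular x}) :
    Nat.card {y // q y = q x} = Nat.card {y : G // IsSingular y ∧ SameCentralizer (x : G) y} :=
  Nat.card_congr
    { toFun := fun y => ⟨y.1.1, y.1.2, (hq.eq_iff _ _).1 y.2.symm⟩
      invFun := fun y => ⟨⟨y.1, y.2.1⟩, ((hq.eq_iff x ⟨y.1, y.2.1⟩).2 y.2.2).symm⟩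
      left_inv := fun _ => rfl
      right_inv := fun _ => rfl }

theorem IsGroupGame.card_fiber_eq (hR : IsGroupGame R) (hq : IsReading Δ q)
    (hq' : IsReading Δ' q') (hm : ∀ a, Nat.card {x // q x = a} = m) (b : B) :
    Nat.card {y // q' y = b} = m := by
  obtain ⟨y, rfl⟩ := hq'.surjective b
  obtain ⟨g, hg⟩ := hR.exists_left fun _ => (y : H)
  have hs : IsSingular (g 0) := (hR.invariant_isSingular hg 0).2 y.2
  rw [hq'.card_fiber, ← hm (q ⟨g 0, hs⟩), hq.card_fiber]
  exact (hR.invariant_isSingular_and_sameCentralizer.card_eq hR.toIsBackForth hg 0).symm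

/-- A game on two groups together with readings of their singular elements as the vertices of two
graphs, such that every vertex of the first graph is read off the same number `m` of elements. -/
structure ReadingGame (R : (Fin 3 → G) → (Fin 3 → H) → Prop)
    (Δ : SimpleGraph A) (Δ' : SimpleGraph B) (q : {x : G // IsSingular x} → A)
    (q' : {x : H // IsSingular x} → B) (m : ℕ) : Prop extends IsGroupGame R where
  left : IsReading Δ q
  right : IsReading Δ' q'
  card_left : ∀ a, Nat.card {x // q x = a} = m
  exists_isSingular : ∃ x : G, IsSingular x

namespace ReadingGame

variable (hG : ReadingGame R Δ Δ' q q' m)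

include hG

theorem card_right (b : B) : Nat.card {y // q' y = b} = m :=
  hG.toIsGroupGame.card_fiber_eq hG.left hG.right hG.card_left b

theorem finite_left [Finite G] : Finite A := Finite.of_surjective q hG.left.surjective

theorem finite_right [Finite H] : Finite B := Finite.of_surjective q' hG.right.surjective

theorem pos [Finite G] : 0 < m := by
  obtain ⟨x, hx⟩ := hG.exists_isSingular
  have : Nonempty {y // q y = q ⟨x, hx⟩} := ⟨⟨_, rfl⟩⟩
  exact hG.card_left (q ⟨x, hx⟩) ▸ Nat.card_pos

theorem isBackForth_val :
    IsBackForth fun (g : Fin 3 → {x : G // IsSingular x}) (h : Fin 3 → {x : H // IsSingular x}) =>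
      R (Subtype.val ∘ g) (Subtype.val ∘ h) :=
  hG.restrict (D := {x | IsSingular x}) (D' := {x | IsSingular x})
    (fun _ _ hgh => hG.invariant_isSingular hgh) hG.exists_isSingular three_ne_zero

theorem graphType_eq (g : Fin 3 → {x : G // IsSingular x}) (h : Fin 3 → {x : H // IsSingular x})
    (hgh : R (Subtype.val ∘ g) (Subtype.val ∘ h)) :
    graphType Δ (q ∘ g) = graphType Δ' (q' ∘ h) := by
  refine graphType_eq_graphType_iff.2 fun i j => ?_
  have hsame := hG.invariant_sameCentralizer hgh i j
  have hcomm := hG.invariant_commute hgh i j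
  simp only [Function.comp_apply, hG.left.eq_iff, hG.right.eq_iff, hG.left.adj_iff,
    hG.right.adj_iff] at hsame hcomm ⊢
  exact ⟨hsame, and_congr hcomm (not_congr hsame)⟩

variable [Finite G] [Finite H]

theorem wlFinalColor_eq (g : Fin 3 → {x : G // IsSingular x})
    (h : Fin 3 → {x : H // IsSingular x}) (hgh : R (Subtype.val ∘ g) (Subtype.val ∘ h)) :
    wlFinalColor (graphType Δ) (q ∘ g) = wlFinalColor (graphType Δ') (q' ∘ h) :=
  have := hG.finite_left
  have := hG.finite_right
  hG.isBackForth_val.wlFinalColor_comp_eq hG.pos hG.card_left hG.card_right hG.graphType_eq g h hgh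

theorem isBackForth :
    IsBackForth fun (g : Fin 3 → A) (h : Fin 3 → B) =>
      wlFinalColor (graphType Δ) g = wlFinalColor (graphType Δ') h :=
  have := hG.finite_left
  have := hG.finite_right
  hG.isBackForth_val.isBackForth_wlFinalColor_of_cover hG.pos hG.card_left hG.card_right
    hG.graphType_eq

end ReadingGame

end Reading

theorem mem_of_weightLE {K : Type*} [Group K] {S : Subgroup K} (hcenter : Subgroup.center K ≤ S)
    (hsing : ∀ x, IsSingular x → x ∈ S) {m : ℕ} {x : K} (hx : WeightLE m x) : x ∈ S := by
  induction m generalizing x with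
  | zero => exact hcenter (Subgroup.mem_center_iff.2 fun y => (hx y).symm)
  | succ m ih =>
    obtain hx | ⟨d, hd, hxd⟩ := hx
    · exact ih hx
    · exact (Subgroup.mul_mem_cancel_right _ (hsing d hd)).1 (ih hxd)

theorem commutator_le_of_sup_center_eq_top {K : Type*} [Group K] {S : Subgroup K}
    (h : S ⊔ Subgroup.center K = ⊤) : commutator K ≤ S := by
  rw [commutator_def, Subgroup.commutator_le]
  intro a _ b _
  have hmul : ∀ x : K, ∃ s ∈ S, ∃ z ∈ Subgroup.center K, s * z = x := fun x =>
    Subgroup.mem_sup_of_normal_right.1 (h ▸ Subgroup.mem_top x)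
  obtain ⟨s, hs, z, hz, rfl⟩ := hmul a
  obtain ⟨t, ht, w, hw, rfl⟩ := hmul b
  have hz' : ⁅z, t * w⁆ = 1 :=
    commutatorElement_eq_one_iff_commute.2 (Subgroup.mem_center_iff.1 hz _).symm
  have hw' : ⁅s, w⁆ = 1 := commutatorElement_eq_one_iff_commute.2 (Subgroup.mem_center_iff.1 hw _)
  have heq : ⁅s * z, t * w⁆ = ⁅s, t⁆ := by
    rw [commutatorElement_mul_left_eq_conj_mul, hz', mul_one, mul_inv_cancel, one_mul,
      commutatorElement_mul_right_eq_mul_conj, hw', mul_one, mul_inv_cancel_right]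
  rw [heq, commutatorElement_def]
  exact mul_mem (mul_mem (mul_mem hs ht) (inv_mem hs)) (inv_mem ht)

namespace MeklerGroup

variable {V : Type u} [Finite V] {p : ℕ} [Fact p.Prime] {Γ : SimpleGraph V} {H : Type*} [Group H]
  {R : (Fin 3 → MeklerGroup p Γ) → (Fin 3 → H) → Prop}

theorem exists_readingGame [Nonempty V] (hΓ : IsSparse Γ) (hR : IsGroupGame R) {B : Type*}
    {Δ : SimpleGraph B} {q' : {x : H // IsSingular x} → B} (hq' : IsReading Δ q') :
    ∃ (q : {x : MeklerGroup p Γ // IsSingular x} → V) (m : ℕ),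
      ReadingGame R Γ Δ q q' m ∧ ∀ x, support x.1 = {q x} := by
  obtain ⟨q, hq, hqs⟩ := exists_isReading (p := p) hΓ
  obtain ⟨x, hx⟩ := exists_support_eq (p := p) (Γ := Γ) {Classical.arbitrary V}
  have hfiber : ∀ v, Nat.card {x // q x = v} =
      Nat.card {x : MeklerGroup p Γ // support x = {v}} := fun v => Nat.card_congr
    { toFun := fun x => ⟨x.1.1, by rw [hqs x.1, x.2]⟩
      invFun := fun x => ⟨⟨x.1, (isSingular_iff hΓ).2 ⟨v, x.2⟩⟩,
        Set.singleton_injective ((hqs _).symm.trans x.2)⟩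
      left_inv := fun _ => rfl
      right_inv := fun _ => rfl }
  exact ⟨q, _, ⟨hR, hq, hq', fun v => (hfiber v).trans (card_support_eq_singleton v),
    x, (isSingular_iff hΓ).2 ⟨_, hx⟩⟩, hqs⟩

variable (hΓ : IsSparse Γ) (hR : IsGroupGame R)

include hΓ hR

theorem exists_pow_eq_one_of_isSingular {x : H} (hx : IsSingular x) :
    ∃ y, y ^ p = 1 ∧ IsSingular y ∧ SameCentralizer x y := by
  have hrep : Invariant₂ R (fun x y => y ^ p = 1 ∧ IsSingular y ∧ SameCentralizer x y)
      (fun x y => y ^ p = 1 ∧ IsSingular y ∧ SameCentralizer x y) := fun _ _ hgh i j =>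
    and_congr (hR.invariant_pow_eq_one p hgh j)
      (hR.invariant_isSingular_and_sameCentralizer hgh i j)
  have himp : Invariant₁ R
      (fun x => IsSingular x → ∃ y, y ^ p = 1 ∧ IsSingular y ∧ SameCentralizer x y)
      (fun x => IsSingular x → ∃ y, y ^ p = 1 ∧ IsSingular y ∧ SameCentralizer x y) :=
    fun _ _ hgh i => imp_congr (hR.invariant_isSingular hgh i)
      (hrep.exists_last hR.toIsBackForth hgh i)
  refine himp.transfer hR.toIsBackForth (fun x hx => ?_) x hx
  classical
  obtain ⟨v, hv⟩ := (isSingular_iff hΓ).1 hx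
  have hgen : support (gen p Γ v) = {v} := by
    rw [support, vec_gen, Pi.support_single_of_ne one_ne_zero]
  exact ⟨gen p Γ v, gen_pow v, (isSingular_iff hΓ).2 ⟨v, hgen⟩,
    (sameCentralizer_iff hΓ hv hgen).2 rfl⟩

theorem exists_forall_commute_mul_pow {x y : H} (hx : IsSingular x) (hy : IsSingular y)
    (hxy : SameCentralizer x y) : ∃ n : ℕ, ∀ z, Commute (x * y ^ n) z := by
  have hinv : Invariant₂ R
      (fun x y => IsSingular x → IsSingular y ∧ SameCentralizer x y →
        ∃ n : ℕ, ∀ z, Commute (x * y ^ n) z)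
      (fun x y => IsSingular x → IsSingular y ∧ SameCentralizer x y →
        ∃ n : ℕ, ∀ z, Commute (x * y ^ n) z) := fun _ _ hgh i j =>
    imp_congr (hR.invariant_isSingular hgh i) <|
      imp_congr (hR.invariant_isSingular_and_sameCentralizer hgh i j) <|
        exists_congr fun n => hR.invariant_mul_pow hR.invariant_central n hgh i j
  refine hinv.transfer hR.toIsBackForth ?_ x y hx ⟨hy, hxy⟩
  rintro x y hx ⟨hy, hxy⟩
  obtain ⟨v, hv⟩ := (isSingular_iff hΓ).1 hx
  obtain ⟨w, hw⟩ := (isSingular_iff hΓ).1 hy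
  obtain rfl := (sameCentralizer_iff hΓ hv hw).1 hxy
  refine ⟨(-(vec x v) * (vec y v)⁻¹).val, (forall_commute_iff hΓ).2 ?_⟩
  rw [support, Function.support_eq_empty_iff]
  funext u
  rw [vec_mul, vec_pow, Pi.add_apply, Pi.smul_apply, Pi.zero_apply, nsmul_eq_mul,
    ZMod.natCast_zmod_val]
  obtain rfl | hu := eq_or_ne u v
  · have hne : vec y u ≠ 0 := Function.mem_support.1 (hw.ge (Set.mem_singleton u))
    rw [inv_mul_cancel_right₀ hne, add_neg_cancel]
  · have hx0 : vec x u = 0 := Function.notMem_support.1 fun h => hu (hv.le h)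
    have hy0 : vec y u = 0 := Function.notMem_support.1 fun h => hu (hw.le h)
    rw [hx0, hy0, mul_zero, add_zero]

theorem exists_weightLE (x : H) : ∃ m, WeightLE m x :=
  have hinv : Invariant₁ R (fun x => ∃ m, WeightLE m x) (fun x => ∃ m, WeightLE m x) :=
    fun _ _ hgh i => exists_congr fun m => hR.invariant_weightLE m hgh i
  hinv.transfer hR.toIsBackForth (fun _ => ⟨_, (weightLE_iff hΓ).2 le_rfl⟩) x

theorem center_le_commutator : Subgroup.center H ≤ commutator H := by
  have hinv : Invariant₁ R (fun x => (∀ y, Commute x y) → ∃ m, IsCommutatorProd m x)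
      (fun x => (∀ y, Commute x y) → ∃ m, IsCommutatorProd m x) := fun _ _ hgh i =>
    imp_congr (hR.invariant_central hgh i)
      (exists_congr fun m => hR.invariant_isCommutatorProd m hgh i)
  intro z hz
  refine (mem_commutator_iff_exists_isCommutatorProd z).2 <|
    hinv.transfer hR.toIsBackForth (fun x hx => ?_) z fun y => (Subgroup.mem_center_iff.1 hz y).symm
  exact (mem_commutator_iff_exists_isCommutatorProd x).1 <| mem_commutator_of_vec_eq_zero <|
    Function.support_eq_empty_iff.1 <| (forall_commute_iff hΓ).1 hx

theorem surjective_of_forall_exists_sameCentralizer {φ : MeklerGroup p Γ →* H}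
    (hφ : ∀ x, IsSingular x → ∃ y, IsSingular (φ y) ∧ SameCentralizer x (φ y)) :
    Function.Surjective φ := by
  have hsing : ∀ x, IsSingular x → x ∈ φ.range ⊔ Subgroup.center H := fun x hx => by
    obtain ⟨y, hy, hxy⟩ := hφ x hx
    obtain ⟨n, hn⟩ := exists_forall_commute_mul_pow hΓ hR hx hy hxy
    have hpow : φ y ^ n ∈ φ.range ⊔ Subgroup.center H :=
      pow_mem (le_sup_left (a := φ.range) ⟨y, rfl⟩) n
    exact (Subgroup.mul_mem_cancel_right _ hpow).1 <|
      (le_sup_right : Subgroup.center H ≤ _) (Subgroup.mem_center_iff.2 fun z => (hn z).symm)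
  have htop : φ.range ⊔ Subgroup.center H = ⊤ := (Subgroup.eq_top_iff' _).2 fun x =>
    let ⟨_, hm⟩ := exists_weightLE hΓ hR x
    mem_of_weightLE le_sup_right hsing hm
  have hcenter : Subgroup.center H ≤ φ.range :=
    (center_le_commutator hΓ hR).trans (commutator_le_of_sup_center_eq_top htop)
  rw [← MonoidHom.range_eq_top, ← htop, sup_eq_left.2 hcenter]

theorem nonempty_mulEquiv {q' : {x : H // IsSingular x} → V} (hq' : IsReading Γ q') :
    Nonempty (MeklerGroup p Γ ≃* H) := by
  have hrep : ∀ v, ∃ x : H, x ^ p = 1 ∧ ∃ hx : IsSingular x, q' ⟨x, hx⟩ = v := fun v => by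
    obtain ⟨x, rfl⟩ := hq'.surjective v
    obtain ⟨y, hyp, hy, hxy⟩ := exists_pow_eq_one_of_isSingular hΓ hR x.2
    exact ⟨y, hyp, hy, ((hq'.eq_iff x ⟨y, hy⟩).2 hxy).symm⟩
  choose r hrp hrs hrq using hrep
  have hclass : ∀ x y z : H, Commute ⁅x, y⁆ z :=
    hR.invariant_commute_commutator.transfer hR.toIsBackForth fun x y z =>
      (Subgroup.mem_center_iff.1 (commutator_mem_center x y) z).symm
  let φ : MeklerGroup p Γ →* H := lift hrp (fun _ _ _ => hclass _ _ _) fun u v huv => by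
    rw [← hrq u, ← hrq v, hq'.adj_iff] at huv
    exact huv.1
  have hφ : ∀ v, φ (gen p Γ v) = r v := lift_gen _ _ _
  have hsurj : Function.Surjective φ :=
    surjective_of_forall_exists_sameCentralizer hΓ hR fun x hx => by
      refine ⟨gen p Γ (q' ⟨x, hx⟩), ?_⟩
      rw [hφ]
      exact ⟨hrs _, (hq'.eq_iff ⟨x, hx⟩ ⟨_, hrs _⟩).1 (hrq _).symm⟩
  obtain ⟨g, h, hgh⟩ := hR.nonempty
  obtain ⟨π, -⟩ := hR.step g h hgh
  exact ⟨MulEquiv.ofBijective φ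
    ((Nat.bijective_iff_surjective_and_card φ).2 ⟨hsurj, Nat.card_congr π⟩)⟩

end MeklerGroup

theorem bool_eq_of_eq_iff_eq : ∀ {a b c : Bool}, (a = b ↔ a = c) → b = c := by decide

/-! ### Even strings on a three-element set -/

/-- The parity condition on the strings that label the internal vertices of a CFI gadget. -/
abbrev IsEvenString {N : Type*} (s : N → Bool) : Prop := Even (Nat.card {w // s w = true})

section EvenStrings

variable {N : Type*} (hN : Nat.card N = 3)

include hN

theorem nontrivial_of_card_eq_three : Nontrivial N :=
  have : Finite N := Nat.finite_of_card_ne_zero (by omega)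
  Finite.one_lt_card_iff_nontrivial.1 (by omega)

theorem exists_third {a b : N} (hab : a ≠ b) :
    ∃ c, c ≠ a ∧ c ≠ b ∧ ∀ x, x = a ∨ x = b ∨ x = c := by
  classical
  have : Finite N := Nat.finite_of_card_ne_zero (by omega)
  have := Fintype.ofFinite N
  have hcard : ({a, b}ᶜ : Finset N).card = 1 := by
    rw [Finset.card_compl, ← Nat.card_eq_fintype_card, hN, Finset.card_pair hab]
  obtain ⟨c, hc⟩ := Finset.card_eq_one.1 hcard
  have hmem (x : N) : (x ≠ a ∧ x ≠ b) ↔ x = c := by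
    simpa using Finset.ext_iff.1 hc x
  exact ⟨c, ((hmem c).2 rfl).1, ((hmem c).2 rfl).2, fun x => by have := hmem x; tauto⟩

theorem isEvenString_iff {a b c : N} (hab : a ≠ b) (hca : c ≠ a) (hcb : c ≠ b) {s : N → Bool} :
    IsEvenString s ↔ s c = (s a ^^ s b) := by
  classical
  have : Finite N := Nat.finite_of_card_ne_zero (by omega)
  have := Fintype.ofFinite N
  have huniv : (Finset.univ : Finset N) = {a, b, c} := by
    refine (Finset.eq_univ_of_card _ ?_).symm
    rw [Finset.card_eq_three.2 ⟨a, b, c, hab, hca.symm, hcb.symm, rfl⟩,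
      ← Nat.card_eq_fintype_card, hN]
  rw [IsEvenString, Nat.card_eq_fintype_card, Fintype.card_subtype, huniv, Finset.filter_insert,
    Finset.filter_insert, Finset.filter_singleton]
  cases s a <;> cases s b <;> cases s c <;>
    simp [hab, hca.symm, hcb.symm, show ¬ Even 3 by decide]

theorem exists_isEvenString {a b : N} (hab : a ≠ b) (x y : Bool) :
    ∃ s : N → Bool, IsEvenString s ∧ s a = x ∧ s b = y := by
  classical
  obtain ⟨c, hca, hcb, -⟩ := exists_third hN hab
  refine ⟨fun w => if w = a then x else if w = b then y else x ^^ y, ?_, by simp,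
    by simp [hab.symm]⟩
  rw [isEvenString_iff hN hab hca hcb]
  cases x <;> cases y <;> simp [hab.symm, hca, hcb]

theorem exists_isEvenString_apply_eq (a : N) (x : Bool) :
    ∃ s : N → Bool, IsEvenString s ∧ s a = x := by
  have := nontrivial_of_card_eq_three hN
  obtain ⟨b, hb⟩ := exists_ne a
  obtain ⟨s, hs, ha, -⟩ := exists_isEvenString hN hb.symm x x
  exact ⟨s, hs, ha⟩

theorem IsEvenString.eq_of_eq_of_eq {s t : N → Bool} (hs : IsEvenString s) (ht : IsEvenString t)
    {a b : N} (hab : a ≠ b) (ha : s a = t a) (hb : s b = t b) : s = t := by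
  obtain ⟨c, hca, hcb, hcover⟩ := exists_third hN hab
  rw [isEvenString_iff hN hab hca hcb] at hs ht
  have hc : s c = t c := by rw [hs, ht, ha, hb]
  funext x
  rcases hcover x with rfl | rfl | rfl <;> assumption

theorem card_isEvenString :
    Nat.card {s : N → Bool // IsEvenString s} = 4 := by
  have := nontrivial_of_card_eq_three hN
  obtain ⟨a, b, hab⟩ := exists_pair_ne N
  have hbij : Function.Bijective
      fun s : {s : N → Bool // IsEvenString s} => (s.1 a, s.1 b) := by
    refine ⟨fun s t hst => Subtype.ext ?_, fun ⟨x, y⟩ => ?_⟩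
    · exact s.2.eq_of_eq_of_eq hN t.2 hab (congrArg Prod.fst hst) (congrArg Prod.snd hst)
    · obtain ⟨s, hs, rfl, rfl⟩ := exists_isEvenString hN hab x y
      exact ⟨⟨s, hs⟩, rfl⟩
  rw [Nat.card_eq_of_bijective _ hbij]
  simp

theorem IsEvenString.exists_eq {s t : N → Bool} (hs : IsEvenString s) (ht : IsEvenString t) :
    ∃ a, s a = t a := by
  have := nontrivial_of_card_eq_three hN
  obtain ⟨a, b, hab⟩ := exists_pair_ne N
  obtain ⟨c, hca, hcb, -⟩ := exists_third hN hab
  rw [isEvenString_iff hN hab hca hcb] at hs ht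
  by_contra! h
  have hc : s c = t c := by rw [hs, ht, Bool.eq_not.2 (h a), Bool.eq_not.2 (h b), Bool.not_xor_not]
  exact h c hc

theorem IsEvenString.eq_or_eq_or_eq {s t r : N → Bool} (hs : IsEvenString s)
    (ht : IsEvenString t) (hr : IsEvenString r) {a : N} (hst : s a = t a) (htr : t a = r a) :
    s = t ∨ s = r ∨ t = r := by
  have := nontrivial_of_card_eq_three hN
  obtain ⟨b, hb⟩ := exists_ne a
  have pigeonhole : ∀ x y z : Bool, x = y ∨ x = z ∨ y = z := by decide
  exact (pigeonhole _ _ _).imp (hs.eq_of_eq_of_eq hN ht hb.symm hst)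
    (.imp (hs.eq_of_eq_of_eq hN hr hb.symm (hst.trans htr)) (ht.eq_of_eq_of_eq hN hr hb.symm htr))

theorem exists_pair_isEvenString_ne (s t : N → Bool) :
    ∃ r r' : N → Bool, IsEvenString r ∧ IsEvenString r' ∧ r ≠ r' ∧
      (s ≠ r ∧ t ≠ r) ∧ s ≠ r' ∧ t ≠ r' := by
  have := nontrivial_of_card_eq_three hN
  obtain ⟨a, b, hab⟩ := exists_pair_ne N
  have four : ∀ x y : Bool × Bool, ∃ z z', z ≠ z' ∧ (x ≠ z ∧ y ≠ z) ∧ x ≠ z' ∧ y ≠ z' := by decide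
  obtain ⟨z, z', hzz, ⟨hsz, htz⟩, hsz', htz'⟩ := four (s a, s b) (t a, t b)
  obtain ⟨r, hr, ha, hb⟩ := exists_isEvenString hN hab z.1 z.2
  obtain ⟨r', hr', ha', hb'⟩ := exists_isEvenString hN hab z'.1 z'.2
  have hrz : (r a, r b) = z := Prod.ext ha hb
  have hrz' : (r' a, r' b) = z' := Prod.ext ha' hb'
  exact ⟨r, r', hr, hr', fun h => hzz (hrz.symm.trans (h ▸ hrz')),
    ⟨fun h => hsz (h ▸ hrz), fun h => htz (h ▸ hrz)⟩,
    fun h => hsz' (h ▸ hrz'), fun h => htz' (h ▸ hrz')⟩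

end EvenStrings

/-! ### Distance relations in graphs -/

section Relations

variable {V : Type*} (Γ : SimpleGraph V)

/-- Two different vertices have a common neighbour. -/
def AtTwo (x y : V) : Prop := x ≠ y ∧ ∃ z, Γ.Adj x z ∧ Γ.Adj z y

/-- Two vertices belong to a set of four vertices any two of which have a common neighbour. In a
CFI graph these are the pairs of different internal vertices of a gadget, see
`CFIVertex.twin_iff`. -/
def Twin (x y : V) : Prop :=
  AtTwo Γ x y ∧ ∃ a, (AtTwo Γ x a ∧ AtTwo Γ y a) ∧ ∃ b, AtTwo Γ x b ∧ AtTwo Γ y b ∧ AtTwo Γ a b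

/-- The vertex has a twin. This is the intrinsic description of the internal vertices of a CFI
graph. -/
def IsInner (x : V) : Prop := ∃ y, Twin Γ x y

/-- The vertices are equal or twins. On inner vertices this is the intrinsic description of lying
in the same gadget. -/
def SameGadget (x y : V) : Prop := x = y ∨ Twin Γ x y

/-- Inner vertices that are joined by a walk of length three. In a CFI graph these are the strings
of adjacent gadgets that agree along the connecting edge, or disagree if it is twisted. -/
def Matched (x y : V) : Prop := (IsInner Γ x ∧ IsInner Γ y) ∧ ∃ z, AtTwo Γ x z ∧ Γ.Adj z y

/-- Inner vertices in adjacent gadgets. -/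
def BaseAdj (x y : V) : Prop := ∃ y', SameGadget Γ y y' ∧ Matched Γ x y'

/-- The outer vertex `z` belongs to the gadget of the inner vertex `x`. -/
def Near (z x : V) : Prop :=
  (¬ IsInner Γ z ∧ IsInner Γ x) ∧ ∃ x', SameGadget Γ x x' ∧ Γ.Adj z x'

/-- The outer vertex `z` has a neighbour in the gadget of the inner vertex `x`, but is not part
of it. -/
def Far (z x : V) : Prop :=
  (¬ IsInner Γ z ∧ IsInner Γ x) ∧ ∃ x', SameGadget Γ x x' ∧ AtTwo Γ z x'

variable {Γ}

theorem AtTwo.symm {x y : V} (h : AtTwo Γ x y) : AtTwo Γ y x :=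
  ⟨h.1.symm, h.2.imp fun _ hz => ⟨hz.2.symm, hz.1.symm⟩⟩

end Relations

/-! ### Distance relations in CFI graphs -/

namespace CFIVertex

variable {V : Type u} {Γ : SimpleGraph V}

/-- The vertex of the base graph in whose gadget the vertex lies. -/
def base : CFIVertex Γ → V
  | ext v _ _ _ => v
  | int v _ _ => v

/-- The vertex of the base graph that an external vertex is directed to. The value at internal
vertices is not used. -/
def far : CFIVertex Γ → V
  | ext _ w _ _ => w
  | int v _ _ => v

/-- The internal vertices. -/
def Internal : CFIVertex Γ → Prop
  | ext _ _ _ _ => False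
  | int _ _ _ => True

theorem internal_iff {x : CFIVertex Γ} : x.Internal ↔ ∃ v s hs, x = int v s hs := by
  rcases x with ⟨v, w, h, b⟩ | ⟨v, s, hs⟩
  · simp [Internal]
  · exact iff_of_true trivial ⟨v, s, hs, rfl⟩

theorem not_internal_iff {x : CFIVertex Γ} : ¬ x.Internal ↔ ∃ v w h b, x = ext v w h b := by
  rcases x with ⟨v, w, h, b⟩ | ⟨v, s, hs⟩
  · exact iff_of_true id ⟨v, w, h, b, rfl⟩
  · simp [Internal]

variable {T : Set (Sym2 V)}

theorem adj_int_ext {v w : V} {s hs h b} :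
    (cfiTwist Γ T).Adj (int v s hs) (ext v w h b) ↔ s ⟨w, h⟩ = b :=
  ⟨fun ⟨_, h⟩ => h, fun h => ⟨rfl, h⟩⟩

theorem adj_ext_int {v w : V} {s hs h b} :
    (cfiTwist Γ T).Adj (ext v w h b) (int v s hs) ↔ s ⟨w, h⟩ = b :=
  ⟨fun ⟨_, h⟩ => h, fun h => ⟨rfl, h⟩⟩

theorem adj_ext_ext {v w : V} {h h' b b'} :
    (cfiTwist Γ T).Adj (ext v w h b) (ext w v h' b') ↔ (b = b' ↔ s(v, w) ∉ T) :=
  ⟨fun h => h.2.2, fun h => ⟨rfl, rfl, h⟩⟩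

theorem adj_int_iff {v : V} {s hs} {y : CFIVertex Γ} :
    (cfiTwist Γ T).Adj (int v s hs) y ↔ ∃ w, ∃ h : Γ.Adj v w, y = ext v w h (s ⟨w, h⟩) := by
  constructor
  · rcases y with ⟨v', w, h, b⟩ | ⟨v', t, ht⟩
    · rintro ⟨rfl, rfl⟩
      exact ⟨w, h, rfl⟩
    · exact False.elim
  · rintro ⟨w, h, rfl⟩
    exact adj_int_ext.2 rfl

theorem adj_ext_iff {v w : V} {h b} {y : CFIVertex Γ} :
    (cfiTwist Γ T).Adj (ext v w h b) y ↔ (∃ s hs, s ⟨w, h⟩ = b ∧ y = int v s hs) ∨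
      ∃ b', (b = b' ↔ s(v, w) ∉ T) ∧ y = ext w v h.symm b' := by
  constructor
  · rcases y with ⟨v', w', h', b'⟩ | ⟨v', t, ht⟩
    · rintro ⟨rfl, rfl, hb⟩
      exact .inr ⟨b', hb, rfl⟩
    · rintro ⟨rfl, rfl⟩
      exact .inl ⟨t, ht, rfl, rfl⟩
  · rintro (⟨s, hs, rfl, rfl⟩ | ⟨b', hb, rfl⟩)
    · exact adj_ext_int.2 rfl
    · exact adj_ext_ext.2 hb

theorem exists_adj_ext_ext (T : Set (Sym2 V)) {v w : V} (h : Γ.Adj v w) (b : Bool) :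
    ∃ b', (cfiTwist Γ T).Adj (ext v w h b) (ext w v h.symm b') := by
  by_cases hT : s(v, w) ∈ T
  · exact ⟨!b, adj_ext_ext.2 (by simp [hT])⟩
  · exact ⟨b, adj_ext_ext.2 (by simp [hT])⟩

theorem not_adj_of_internal {x y : CFIVertex Γ} (hx : x.Internal) (hy : y.Internal) :
    ¬ (cfiTwist Γ T).Adj x y := by
  obtain ⟨v, s, hs, rfl⟩ := internal_iff.1 hx
  obtain ⟨w, t, ht, rfl⟩ := internal_iff.1 hy
  exact id

theorem base_eq_of_adj {x y : CFIVertex Γ} (hy : y.Internal) (h : (cfiTwist Γ T).Adj x y) :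
    x.base = y.base := by
  obtain ⟨v, s, hs, rfl⟩ := internal_iff.1 hy
  obtain ⟨w, h, rfl⟩ := adj_int_iff.1 h.symm
  rfl

theorem base_eq_far_of_adj {x y : CFIVertex Γ} (hx : ¬ x.Internal) (hy : ¬ y.Internal)
    (h : (cfiTwist Γ T).Adj x y) : y.base = x.far ∧ y.far = x.base := by
  obtain ⟨v, w, _, b, rfl⟩ := not_internal_iff.1 hx
  obtain ⟨_, _, -, rfl⟩ | ⟨b', -, rfl⟩ := adj_ext_iff.1 h
  · exact (hy trivial).elim
  · exact ⟨rfl, rfl⟩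

theorem adj_base_far {x : CFIVertex Γ} (hx : ¬ x.Internal) : Γ.Adj x.base x.far := by
  obtain ⟨v, w, h, b, rfl⟩ := not_internal_iff.1 hx
  exact h

theorem eq_of_adj_of_not_internal {x y z : CFIVertex Γ} (hx : ¬ x.Internal) (hy : ¬ y.Internal)
    (hz : ¬ z.Internal) (hxy : (cfiTwist Γ T).Adj x y) (hxz : (cfiTwist Γ T).Adj x z) :
    y = z := by
  obtain ⟨v, w, h, b, rfl⟩ := not_internal_iff.1 hx
  obtain ⟨_, _, -, rfl⟩ | ⟨b₁, h₁, rfl⟩ := adj_ext_iff.1 hxy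
  · exact (hy trivial).elim
  obtain ⟨_, _, -, rfl⟩ | ⟨b₂, h₂, rfl⟩ := adj_ext_iff.1 hxz
  · exact (hz trivial).elim
  rw [bool_eq_of_eq_iff_eq (h₁.trans h₂.symm)]

theorem base_eq_of_atTwo {x y : CFIVertex Γ} (hx : x.Internal) (hy : y.Internal)
    (h : AtTwo (cfiTwist Γ T) x y) : x.base = y.base := by
  obtain ⟨-, z, hxz, hzy⟩ := h
  rw [← base_eq_of_adj hx hxz.symm, base_eq_of_adj hy hzy]

theorem far_eq_of_atTwo {x y : CFIVertex Γ} (hx : ¬ x.Internal) (hy : y.Internal)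
    (h : AtTwo (cfiTwist Γ T) x y) : x.far = y.base := by
  obtain ⟨-, z, hxz, hzy⟩ := h
  rw [← base_eq_of_adj hy hzy,
    (base_eq_far_of_adj hx (fun hz => not_adj_of_internal hz hy hzy) hxz).1]

theorem base_eq_and_far_ne_of_atTwo {x y : CFIVertex Γ} (hx : ¬ x.Internal) (hy : ¬ y.Internal)
    (h : AtTwo (cfiTwist Γ T) x y) : x.base = y.base ∧ x.far ≠ y.far := by
  obtain ⟨hne, z, hxz, hzy⟩ := h
  have hz : z.Internal := by
    by_contra hz
    exact hne (eq_of_adj_of_not_internal hz hx hy hxz.symm hzy)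
  obtain ⟨v, s, hs, rfl⟩ := internal_iff.1 hz
  obtain ⟨w, hw, rfl⟩ := adj_int_iff.1 hxz.symm
  obtain ⟨w', hw', rfl⟩ := adj_int_iff.1 hzy
  refine ⟨rfl, fun h : w = w' => hne ?_⟩
  subst h
  rfl

theorem atTwo_ext_int {v w : V} {s hs h b} :
    AtTwo (cfiTwist Γ T) (ext w v h b) (int v s hs) ↔
      (b = s ⟨w, h.symm⟩ ↔ s(w, v) ∉ T) := by
  constructor
  · rintro ⟨-, z, hxz, hzy⟩
    obtain ⟨w', h', rfl⟩ := adj_int_iff.1 hzy.symm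
    obtain ⟨-, rfl, hb⟩ := hxz
    exact hb
  · intro hb
    exact ⟨by simp, ext v w h.symm (s ⟨w, h.symm⟩), adj_ext_ext.2 hb, adj_ext_int.2 rfl⟩

theorem not_internal_of_triangle {x y z : CFIVertex Γ} (hxy : AtTwo (cfiTwist Γ T) x y)
    (hxz : AtTwo (cfiTwist Γ T) x z) (hyz : AtTwo (cfiTwist Γ T) y z) (hx : ¬ x.Internal)
    (hy : ¬ y.Internal) : ¬ z.Internal := fun hz =>
  (base_eq_and_far_ne_of_atTwo hx hy hxy).2
    ((far_eq_of_atTwo hx hz hxz).trans (far_eq_of_atTwo hy hz hyz).symm)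

section Cubic

variable (hΓ : ∀ v, Nat.card (Γ.neighborSet v) = 3)

include hΓ

theorem atTwo_int_int {v : V} {s t hs ht} :
    AtTwo (cfiTwist Γ T) (int v s hs) (int v t ht) ↔ s ≠ t := by
  constructor
  · rintro ⟨h, -⟩ rfl
    exact h rfl
  · intro h
    obtain ⟨⟨w, hw⟩, hst⟩ := IsEvenString.exists_eq (hΓ v) hs ht
    exact ⟨by simpa using h, ext v w hw (s ⟨w, hw⟩), adj_int_ext.2 rfl, adj_ext_int.2 hst.symm⟩

theorem not_clique_of_not_internal {x y a b : CFIVertex Γ} (hx : ¬ x.Internal) (hy : ¬ y.Internal)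
    (ha : ¬ a.Internal) (hb : ¬ b.Internal) (hxy : AtTwo (cfiTwist Γ T) x y)
    (hxa : AtTwo (cfiTwist Γ T) x a) (hya : AtTwo (cfiTwist Γ T) y a)
    (hxb : AtTwo (cfiTwist Γ T) x b) (hyb : AtTwo (cfiTwist Γ T) y b) :
    ¬ AtTwo (cfiTwist Γ T) a b := fun hab => by
  have hxy := base_eq_and_far_ne_of_atTwo hx hy hxy
  have hxa := base_eq_and_far_ne_of_atTwo hx ha hxa
  have hxb := base_eq_and_far_ne_of_atTwo hx hb hxb
  obtain ⟨c, -, -, hcover⟩ := exists_third (hΓ x.base) (a := ⟨x.far, adj_base_far hx⟩)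
    (b := ⟨y.far, hxy.1 ▸ adj_base_far hy⟩) (fun h => hxy.2 (congrArg Subtype.val h))
  have ha' := hcover ⟨a.far, hxa.1 ▸ adj_base_far ha⟩
  have hb' := hcover ⟨b.far, hxb.1 ▸ adj_base_far hb⟩
  simp only [Subtype.ext_iff] at ha' hb'
  have hya := (base_eq_and_far_ne_of_atTwo hy ha hya).2
  have hyb := (base_eq_and_far_ne_of_atTwo hy hb hyb).2
  have hab := (base_eq_and_far_ne_of_atTwo ha hb hab).2
  grind

theorem not_clique_of_internal {x y a b : CFIVertex Γ} (hx : ¬ x.Internal) (hy : y.Internal)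
    (ha : a.Internal) (hb : b.Internal) (hxy : AtTwo (cfiTwist Γ T) x y)
    (hxa : AtTwo (cfiTwist Γ T) x a) (hya : AtTwo (cfiTwist Γ T) y a)
    (hxb : AtTwo (cfiTwist Γ T) x b) (hyb : AtTwo (cfiTwist Γ T) y b) :
    ¬ AtTwo (cfiTwist Γ T) a b := fun hab => by
  obtain ⟨w, v, h, i, rfl⟩ := not_internal_iff.1 hx
  obtain ⟨v₁, s₁, hs₁, rfl⟩ := internal_iff.1 hy
  obtain ⟨v₂, s₂, hs₂, rfl⟩ := internal_iff.1 ha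
  obtain ⟨v₃, s₃, hs₃, rfl⟩ := internal_iff.1 hb
  obtain rfl : v = v₁ := far_eq_of_atTwo hx hy hxy
  obtain rfl : v = v₂ := far_eq_of_atTwo hx ha hxa
  obtain rfl : v = v₃ := far_eq_of_atTwo hx hb hxb
  rw [atTwo_ext_int] at hxy hxa hxb
  rw [atTwo_int_int hΓ] at hya hyb hab
  rcases IsEvenString.eq_or_eq_or_eq (hΓ v) hs₁ hs₂ hs₃ (bool_eq_of_eq_iff_eq (hxy.trans hxa.symm))
    (bool_eq_of_eq_iff_eq (hxa.trans hxb.symm)) with h | h | h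
  exacts [hya h, hyb h, hab h]

theorem internal_of_clique {x y a b : CFIVertex Γ} (hxy : AtTwo (cfiTwist Γ T) x y)
    (hxa : AtTwo (cfiTwist Γ T) x a) (hya : AtTwo (cfiTwist Γ T) y a)
    (hxb : AtTwo (cfiTwist Γ T) x b) (hyb : AtTwo (cfiTwist Γ T) y b)
    (hab : AtTwo (cfiTwist Γ T) a b) : x.Internal := by
  by_contra hx
  by_cases hy : y.Internal
  · have ha : a.Internal := by_contra fun ha => not_internal_of_triangle hxa hxy hya.symm hx ha hy
    have hb : b.Internal := by_contra fun hb => not_internal_of_triangle hxb hxy hyb.symm hx hb hy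
    exact not_clique_of_internal hΓ hx hy ha hb hxy hxa hya hxb hyb hab
  · have ha := not_internal_of_triangle hxy hxa hya hx hy
    have hb := not_internal_of_triangle hxy hxb hyb hx hy
    exact not_clique_of_not_internal hΓ hx hy ha hb hxy hxa hya hxb hyb hab

theorem twin_iff {x y : CFIVertex Γ} : Twin (cfiTwist Γ T) x y ↔
    x.Internal ∧ y.Internal ∧ x.base = y.base ∧ x ≠ y := by
  constructor
  · rintro ⟨hxy, a, ⟨hxa, hya⟩, b, hxb, hyb, hab⟩
    have hx := internal_of_clique hΓ hxy hxa hya hxb hyb hab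
    have hy := internal_of_clique hΓ hxy.symm hya hxa hyb hxb hab
    exact ⟨hx, hy, base_eq_of_atTwo hx hy hxy, hxy.1⟩
  · rintro ⟨hx, hy, hbase, hne⟩
    obtain ⟨v, s, hs, rfl⟩ := internal_iff.1 hx
    obtain ⟨_, t, ht, rfl⟩ := internal_iff.1 hy
    obtain rfl : v = _ := hbase
    obtain ⟨r, r', hr, hr', hrr, ⟨hsr, htr⟩, hsr', htr'⟩ := exists_pair_isEvenString_ne (hΓ v) s t
    simp only [ne_eq, int.injEq, heq_eq_eq, true_and] at hne
    exact ⟨(atTwo_int_int hΓ).2 hne, int v r hr,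
      ⟨(atTwo_int_int hΓ).2 hsr, (atTwo_int_int hΓ).2 htr⟩, int v r' hr',
      (atTwo_int_int hΓ).2 hsr', (atTwo_int_int hΓ).2 htr', (atTwo_int_int hΓ).2 hrr⟩

theorem isInner_iff {x : CFIVertex Γ} : IsInner (cfiTwist Γ T) x ↔ x.Internal := by
  refine ⟨fun ⟨_, hy⟩ => ((twin_iff hΓ).1 hy).1, fun hx => ?_⟩
  obtain ⟨v, s, hs, rfl⟩ := internal_iff.1 hx
  obtain ⟨r, -, hr, -, -, ⟨hsr, -⟩, -⟩ := exists_pair_isEvenString_ne (hΓ v) s s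
  exact ⟨int v r hr, (twin_iff hΓ).2 ⟨trivial, trivial, rfl, by simpa using hsr⟩⟩

theorem sameGadget_iff {x y : CFIVertex Γ} (hx : x.Internal) :
    SameGadget (cfiTwist Γ T) x y ↔ y.Internal ∧ x.base = y.base := by
  rw [SameGadget, twin_iff hΓ]
  rcases eq_or_ne x y with rfl | h
  · simp [hx]
  · simp [h, hx]

theorem matched_int_int {v w : V} {s hs t ht} :
    Matched (cfiTwist Γ T) (int v s hs) (int w t ht) ↔
      ∃ h : Γ.Adj v w, (s ⟨w, h⟩ = t ⟨v, h.symm⟩ ↔ s(v, w) ∉ T) := by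
  constructor
  · rintro ⟨-, z, hxz, hzy⟩
    obtain ⟨v', h, rfl⟩ := adj_int_iff.1 hzy.symm
    obtain rfl : v' = v := far_eq_of_atTwo id (y := int v s hs) trivial hxz.symm
    have hst := atTwo_ext_int.1 hxz.symm
    rw [Sym2.eq_swap, eq_comm] at hst
    exact ⟨h.symm, hst⟩
  · rintro ⟨h, hst⟩
    rw [Sym2.eq_swap, eq_comm] at hst
    exact ⟨⟨(isInner_iff hΓ).2 trivial, (isInner_iff hΓ).2 trivial⟩,
      ext w v h.symm (t ⟨v, h.symm⟩), (atTwo_ext_int.2 hst).symm, adj_ext_int.2 rfl⟩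

theorem baseAdj_iff {x y : CFIVertex Γ} : BaseAdj (cfiTwist Γ T) x y ↔
    x.Internal ∧ y.Internal ∧ Γ.Adj x.base y.base := by
  constructor
  · rintro ⟨y', hyy, hxy⟩
    have hx := (isInner_iff hΓ).1 hxy.1.1
    have hy' := (isInner_iff hΓ).1 hxy.1.2
    obtain ⟨hy, hbase⟩ : y.Internal ∧ y.base = y'.base := by
      rcases hyy with rfl | h
      · exact ⟨hy', rfl⟩
      · exact ⟨((twin_iff hΓ).1 h).1, ((twin_iff hΓ).1 h).2.2.1⟩
    obtain ⟨v, s, hs, rfl⟩ := internal_iff.1 hx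
    obtain ⟨w, t, ht, rfl⟩ := internal_iff.1 hy'
    exact ⟨hx, hy, hbase ▸ ((matched_int_int hΓ).1 hxy).1⟩
  · rintro ⟨hx, hy, hadj⟩
    obtain ⟨v, s, hs, rfl⟩ := internal_iff.1 hx
    obtain ⟨w, t, ht, rfl⟩ := internal_iff.1 hy
    obtain ⟨b, hb⟩ := exists_adj_ext_ext T hadj (s ⟨w, hadj⟩)
    obtain ⟨t', ht', rfl⟩ := exists_isEvenString_apply_eq (hΓ w) ⟨v, hadj.symm⟩ b
    exact ⟨int w t' ht', (sameGadget_iff hΓ hy).2 ⟨trivial, rfl⟩,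
      (matched_int_int hΓ).2 ⟨hadj, adj_ext_ext.1 hb⟩⟩

theorem near_iff {z x : CFIVertex Γ} : Near (cfiTwist Γ T) z x ↔
    ¬ z.Internal ∧ x.Internal ∧ z.base = x.base := by
  rw [Near, isInner_iff hΓ, isInner_iff hΓ, and_assoc]
  refine and_congr_right fun hz => and_congr_right fun hx => ?_
  simp only [sameGadget_iff hΓ hx]
  constructor
  · rintro ⟨x', ⟨hx', hbase⟩, hadj⟩
    exact (base_eq_of_adj hx' hadj).trans hbase.symm
  · intro hbase
    obtain ⟨v, w, h, b, rfl⟩ := not_internal_iff.1 hz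
    obtain ⟨s, hs, hb⟩ := exists_isEvenString_apply_eq (hΓ v) ⟨w, h⟩ b
    exact ⟨int v s hs, ⟨trivial, hbase.symm⟩, adj_ext_int.2 hb⟩

theorem far_iff {z x : CFIVertex Γ} : Far (cfiTwist Γ T) z x ↔
    ¬ z.Internal ∧ x.Internal ∧ z.far = x.base := by
  rw [Far, isInner_iff hΓ, isInner_iff hΓ, and_assoc]
  refine and_congr_right fun hz => and_congr_right fun hx => ?_
  simp only [sameGadget_iff hΓ hx]
  constructor
  · rintro ⟨x', ⟨hx', hbase⟩, hadj⟩
    exact (far_eq_of_atTwo hz hx' hadj).trans hbase.symm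
  · intro hbase
    obtain ⟨v, w, h, b, rfl⟩ := not_internal_iff.1 hz
    obtain ⟨b', hb'⟩ := exists_adj_ext_ext T h b
    obtain ⟨s, hs, rfl⟩ := exists_isEvenString_apply_eq (hΓ w) ⟨v, h.symm⟩ b'
    exact ⟨int w s hs, ⟨trivial, hbase.symm⟩, atTwo_ext_int.2 (adj_ext_ext.1 hb')⟩

/-! ### Sparsity of CFI graphs -/

theorem eq_of_adj_of_internal {x x' y z : CFIVertex Γ} (hx : x.Internal) (hx' : x'.Internal)
    (hne : x ≠ x') (hxy : (cfiTwist Γ T).Adj x y) (hxy' : (cfiTwist Γ T).Adj x' y)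
    (hxz : (cfiTwist Γ T).Adj x z) (hxz' : (cfiTwist Γ T).Adj x' z) : y = z := by
  obtain ⟨v, s, hs, rfl⟩ := internal_iff.1 hx
  obtain ⟨v', s', hs', rfl⟩ := internal_iff.1 hx'
  obtain ⟨w, hw, rfl⟩ := adj_int_iff.1 hxy
  obtain ⟨w', hw', rfl⟩ := adj_int_iff.1 hxz
  obtain ⟨rfl, h : s' _ = s _⟩ := hxy'
  obtain ⟨_, h' : s' _ = s _⟩ := hxz'
  by_cases hww : w = w'
  · subst hww
    rfl
  · obtain rfl := IsEvenString.eq_of_eq_of_eq (hΓ _) hs' hs (a := ⟨w, hw⟩) (b := ⟨w', hw'⟩)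
      (fun h => hww (congrArg Subtype.val h)) h h'
    exact (hne rfl).elim

theorem eq_of_adj_of_ne {x x' y z : CFIVertex Γ} (hne : x ≠ x') (hxy : (cfiTwist Γ T).Adj x y)
    (hxy' : (cfiTwist Γ T).Adj x' y) (hxz : (cfiTwist Γ T).Adj x z)
    (hxz' : (cfiTwist Γ T).Adj x' z) : y = z := by
  by_cases hx : x.Internal
  · have hy : ¬ y.Internal := fun h => not_adj_of_internal hx h hxy
    have hz : ¬ z.Internal := fun h => not_adj_of_internal hx h hxz
    by_cases hx' : x'.Internal
    · exact eq_of_adj_of_internal hΓ hx hx' hne hxy hxy' hxz hxz'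
    · exact eq_of_adj_of_not_internal hx' hy hz hxy' hxz'
  by_cases hx' : x'.Internal
  · exact eq_of_adj_of_not_internal hx (fun h => not_adj_of_internal hx' h hxy')
      (fun h => not_adj_of_internal hx' h hxz') hxy hxz
  by_contra hyz
  have internal {y} (h : (cfiTwist Γ T).Adj x y) (h' : (cfiTwist Γ T).Adj x' y) : y.Internal :=
    by_contra fun hy => hne (eq_of_adj_of_not_internal hy hx hx' h.symm h'.symm)
  exact hne (eq_of_adj_of_internal hΓ (internal hxy hxy') (internal hxz hxz') hyz hxy.symm
    hxz.symm hxy'.symm hxz'.symm)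

omit hΓ in
theorem not_internal_of_adj_triangle {x y z : CFIVertex Γ} (hxy : (cfiTwist Γ T).Adj x y)
    (hyz : (cfiTwist Γ T).Adj y z) (hxz : (cfiTwist Γ T).Adj x z) : ¬ x.Internal := fun hx => by
  have hy : ¬ y.Internal := fun h => not_adj_of_internal hx h hxy
  have hz : ¬ z.Internal := fun h => not_adj_of_internal hx h hxz
  exact (adj_base_far hy).ne ((base_eq_of_adj hx hxy.symm).trans
    ((base_eq_of_adj hx hxz.symm).symm.trans (base_eq_far_of_adj hy hz hyz).1))

omit hΓ in
theorem not_adj_of_adj_of_adj {x y z : CFIVertex Γ} (hxy : (cfiTwist Γ T).Adj x y)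
    (hyz : (cfiTwist Γ T).Adj y z) : ¬ (cfiTwist Γ T).Adj x z := fun hxz => by
  have hx := not_internal_of_adj_triangle hxy hyz hxz
  have hy := not_internal_of_adj_triangle hyz hxz.symm hxy.symm
  have hz := not_internal_of_adj_triangle hxz.symm hxy hyz.symm
  exact hyz.ne (eq_of_adj_of_not_internal hx hy hz hxy hxz)

theorem exists_two_adj (x : CFIVertex Γ) :
    ∃ y z, y ≠ z ∧ (cfiTwist Γ T).Adj x y ∧ (cfiTwist Γ T).Adj x z := by
  rcases x with ⟨v, w, h, i⟩ | ⟨v, s, hs⟩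
  · have := nontrivial_of_card_eq_three (hΓ v)
    obtain ⟨c, hc⟩ := exists_ne (⟨w, h⟩ : Γ.neighborSet v)
    obtain ⟨s, hs, hsw, hsc⟩ := exists_isEvenString (hΓ v) hc.symm i true
    obtain ⟨t, ht, htw, htc⟩ := exists_isEvenString (hΓ v) hc.symm i false
    exact ⟨int v s hs, int v t ht, by grind, adj_ext_int.2 hsw, adj_ext_int.2 htw⟩
  · have := nontrivial_of_card_eq_three (hΓ v)
    obtain ⟨a, b, hab⟩ := exists_pair_ne (Γ.neighborSet v)
    refine ⟨ext v a a.2 _, ext v b b.2 _, fun h => hab (Subtype.ext ?_), adj_int_ext.2 rfl,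
      adj_int_ext.2 rfl⟩
    exact congrArg far h

theorem isSparse (T : Set (Sym2 V)) : IsSparse (cfiTwist Γ T) where
  eq_of_adj := eq_of_adj_of_ne hΓ
  not_adj := not_adj_of_adj_of_adj
  exists_two := exists_two_adj hΓ

end Cubic

instance [Finite V] : Finite (CFIVertex Γ) := by
  let toSum : CFIVertex Γ → (V × V × Bool) ⊕ (Σ v, Γ.neighborSet v → Bool)
    | ext v w _ b => Sum.inl (v, w, b)
    | int v s _ => Sum.inr ⟨v, s⟩
  refine Finite.of_injective toSum ?_
  rintro (⟨v, w, h, b⟩ | ⟨v, s, hs⟩) (⟨v', w', h', b'⟩ | ⟨v', s', hs'⟩) heq <;> simp_all [toSum]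

end CFIVertex

/-! ### Recognition of CFI graphs -/

theorem CFIVertex.int_inj {V : Type u} {Γ : SimpleGraph V} {v v' : V} {s s' : V → Bool}
    {hs : IsEvenString fun w : Γ.neighborSet v => s w}
    {hs' : IsEvenString fun w : Γ.neighborSet v' => s' w}
    (h : (CFIVertex.int v (fun w => s w) hs : CFIVertex Γ) = .int v' (fun w => s' w) hs') :
    v = v' ∧ ∀ w, Γ.Adj v w → s w = s' w := by
  injection h with hv hstr
  subst hv
  exact ⟨rfl, fun w hw => congrFun (eq_of_heq hstr) ⟨w, hw⟩⟩

/-- Properties of the maps `γ` and `δ` that send a vertex of a CFI graph over `Γ` to the base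
vertex of its gadget and, if the vertex is external, to the base vertex of the gadget it is directed
to. The predicate `inn` singles out the internal vertices; `δ` is arbitrary on these. -/
structure IsCFILike {V W : Type*} (Γ : SimpleGraph V) (Δ : SimpleGraph W) (inn : W → Prop)
    (γ δ : W → V) : Prop where
  exists_inner : ∀ v, ∃ x, inn x ∧ γ x = v
  not_adj : ∀ {x y}, inn x → inn y → ¬ Δ.Adj x y
  base_eq : ∀ {x z}, inn x → ¬ inn z → Δ.Adj x z → γ z = γ x
  exists_dir : ∀ {x w}, inn x → Γ.Adj (γ x) w → ∃ z, Δ.Adj x z ∧ δ z = w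
  dir_unique : ∀ {x y z}, inn x → Δ.Adj x y → Δ.Adj x z → δ y = δ z → y = z
  exists_common : ∀ {x y}, inn x → inn y → x ≠ y → γ x = γ y → ∃ z, Δ.Adj x z ∧ Δ.Adj y z
  common_unique : ∀ {x y z z'}, inn x → inn y → x ≠ y → Δ.Adj x z → Δ.Adj y z → Δ.Adj x z' →
    Δ.Adj y z' → z' = z
  exists_outer : ∀ {z}, ¬ inn z → ∃ z', ¬ inn z' ∧ Δ.Adj z z'
  outer_unique : ∀ {x y z}, ¬ inn x → ¬ inn y → ¬ inn z → Δ.Adj x y → Δ.Adj x z → y = z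
  base_adj : ∀ {z}, ¬ inn z → Γ.Adj (γ z) (δ z)
  far_eq : ∀ {z z'}, ¬ inn z → ¬ inn z' → Δ.Adj z z' → γ z' = δ z
  outer_eq : ∀ {o y z}, inn o → ¬ inn y → ¬ inn z → γ y = γ o → γ z = γ o → δ y = δ z →
    ¬ Δ.Adj o y → ¬ Δ.Adj o z → y = z

namespace IsCFILike

variable {V : Type u} {W : Type*} {Γ : SimpleGraph V} {Δ : SimpleGraph W} {inn : W → Prop}
  {γ δ : W → V} (h : IsCFILike Γ Δ inn γ δ)

/-- A choice of an internal vertex in the gadget of `v`; it is going to be the string `0`. -/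
noncomputable def origin (v : V) : W := (h.exists_inner v).choose

theorem inn_origin (v : V) : inn (h.origin v) := (h.exists_inner v).choose_spec.1

theorem base_origin (v : V) : γ (h.origin v) = v := (h.exists_inner v).choose_spec.2

open Classical in
/-- The label of an external vertex: it is `a` or `b` according to whether it is adjacent to the
origin of its gadget. -/
noncomputable def bit (z : W) : Bool := decide (¬ Δ.Adj (h.origin (γ z)) z)

open Classical in
/-- The string of an internal vertex, extended by `false` to all vertices of the base graph. -/
noncomputable def str (x : W) (w : V) : Bool := decide (∃ z, Δ.Adj x z ∧ δ z = w ∧ h.bit z = true)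

/-- The edges of the base graph along which the labels are interchanged. -/
def twists : Set (Sym2 V) :=
  {t | ∃ z z', ¬ inn z ∧ ¬ inn z' ∧ Δ.Adj z z' ∧ t = s(γ z, δ z) ∧ h.bit z ≠ h.bit z'}

include h

theorem not_inn_of_adj {x y : W} (hx : inn x) (hxy : Δ.Adj x y) : ¬ inn y :=
  fun hy => h.not_adj hx hy hxy

theorem bit_eq_false_iff {x z : W} (hxz : γ z = γ x) :
    h.bit z = false ↔ Δ.Adj (h.origin (γ x)) z := by
  rw [bit, decide_eq_false_iff_not, not_not, hxz]

theorem bit_eq_bit_iff {y z : W} (hy : ¬ inn y) (hz : ¬ inn z) (hγ : γ y = γ z)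
    (hδ : δ y = δ z) : h.bit y = h.bit z ↔ y = z := by
  refine ⟨fun hyz => ?_, fun hyz => hyz ▸ rfl⟩
  have ho := h.inn_origin (γ z)
  have hoz : γ z = γ (h.origin (γ z)) := (h.base_origin _).symm
  by_cases hbit : h.bit z = false
  · exact h.dir_unique ho ((h.bit_eq_false_iff hγ).1 (hyz.trans hbit))
      ((h.bit_eq_false_iff rfl).1 hbit) hδ
  · exact h.outer_eq ho hy hz (hγ.trans hoz) hoz hδ
      (mt (h.bit_eq_false_iff hγ).2 (hyz ▸ hbit)) (mt (h.bit_eq_false_iff rfl).2 hbit)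

theorem str_apply {x z : W} (hx : inn x) (hxz : Δ.Adj x z) : h.str x (δ z) = h.bit z := by
  classical
  refine Bool.eq_iff_iff.2 (decide_eq_true_iff.trans ⟨?_, fun hbit => ⟨z, hxz, rfl, hbit⟩⟩)
  rintro ⟨y, hxy, hδ, hbit⟩
  exact h.dir_unique hx hxy hxz hδ ▸ hbit

theorem adj_inner_outer_iff {x z : W} (hx : inn x) (hz : ¬ inn z) :
    Δ.Adj x z ↔ γ z = γ x ∧ h.bit z = h.str x (δ z) := by
  refine ⟨fun hxz => ⟨h.base_eq hx hz hxz, (h.str_apply hx hxz).symm⟩, fun ⟨hγ, hbit⟩ => ?_⟩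
  obtain ⟨y, hxy, hδ⟩ := h.exists_dir hx (hγ ▸ h.base_adj hz)
  have hy := h.not_inn_of_adj hx hxy
  rw [← hδ, h.str_apply hx hxy, eq_comm] at hbit
  exact (h.bit_eq_bit_iff hy hz ((h.base_eq hx hy hxy).trans hγ.symm) hδ).1 hbit ▸ hxy

theorem bit_eq_iff_bit_eq {y y' z z' : W} (hy : ¬ inn y) (hy' : ¬ inn y') (hz : ¬ inn z)
    (hz' : ¬ inn z') (hyy : Δ.Adj y y') (hzz : Δ.Adj z z') (hγ : γ y = γ z) (hδ : δ y = δ z) :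
    h.bit y = h.bit y' ↔ h.bit z = h.bit z' := by
  have hγ' : γ y' = γ z' := by rw [h.far_eq hy hy' hyy, h.far_eq hz hz' hzz, hδ]
  have hδ' : δ y' = δ z' := by
    rw [← h.far_eq hy' hy hyy.symm, ← h.far_eq hz' hz hzz.symm, hγ]
  have hcross : h.bit y = h.bit z ↔ h.bit y' = h.bit z' := by
    rw [h.bit_eq_bit_iff hy hz hγ hδ, h.bit_eq_bit_iff hy' hz' hγ' hδ']
    exact ⟨fun e => h.outer_unique hy hy' hz' hyy (e ▸ hzz),
      fun e => h.outer_unique hy' hy hz hyy.symm (e ▸ hzz.symm)⟩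
  generalize h.bit y = a, h.bit y' = a', h.bit z = b, h.bit z' = b' at hcross
  revert a a' b b'
  decide

theorem bit_eq_iff_notMem_twists {z z' : W} (hz : ¬ inn z) (hz' : ¬ inn z')
    (hzz : Δ.Adj z z') : h.bit z = h.bit z' ↔ s(γ z, δ z) ∉ h.twists := by
  refine ⟨?_, fun hT => by_contra fun hne => hT ⟨z, z', hz, hz', hzz, rfl, hne⟩⟩
  rintro hbit ⟨y, y', hy, hy', hyy, heq, hne⟩
  obtain ⟨hγ, hδ⟩ | ⟨hγ, hδ⟩ := Sym2.eq_iff.1 heq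
  · exact hne ((h.bit_eq_iff_bit_eq hy hy' hz hz' hyy hzz hγ.symm hδ.symm).2 hbit)
  · refine hne ((h.bit_eq_iff_bit_eq hy' hy hz hz' hyy.symm hzz ?_ ?_).2 hbit).symm
    · exact (h.far_eq hy hy' hyy).trans hγ.symm
    · exact (h.far_eq hy' hy hyy.symm).symm.trans hδ.symm

theorem adj_outer_outer_iff {z z' : W} (hz : ¬ inn z) (hz' : ¬ inn z') :
    Δ.Adj z z' ↔ γ z' = δ z ∧ δ z' = γ z ∧ (h.bit z = h.bit z' ↔ s(γ z, δ z) ∉ h.twists) := by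
  refine ⟨fun hzz => ⟨h.far_eq hz hz' hzz, (h.far_eq hz' hz hzz.symm).symm,
    h.bit_eq_iff_notMem_twists hz hz' hzz⟩, fun ⟨hγ, hδ, hbit⟩ => ?_⟩
  obtain ⟨y, hy, hzy⟩ := h.exists_outer hz
  have hyz : h.bit y = h.bit z' :=
    bool_eq_of_eq_iff_eq ((h.bit_eq_iff_notMem_twists hz hy hzy).trans hbit.symm)
  exact (h.bit_eq_bit_iff hy hz' ((h.far_eq hz hy hzy).trans hγ.symm)
    ((h.far_eq hy hz hzy.symm).symm.trans hδ.symm)).1 hyz ▸ hzy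

theorem str_origin {x : W} (hxo : x = h.origin (γ x)) (w : V) : h.str x w = false := by
  rw [str, decide_eq_false_iff_not]
  rintro ⟨z, hxz, -, hbit⟩
  have hx : inn x := hxo ▸ h.inn_origin _
  have hγ := h.base_eq hx (h.not_inn_of_adj hx hxz) hxz
  have : h.bit z = false := (h.bit_eq_false_iff hγ).2 (hxo ▸ hxz)
  simp [this] at hbit

theorem isEvenString_str (hΓ : ∀ v, Nat.card (Γ.neighborSet v) = 3) {x : W} (hx : inn x) :
    IsEvenString fun w : Γ.neighborSet (γ x) => h.str x w := by
  by_cases hxo : x = h.origin (γ x)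
  · simp [IsEvenString, h.str_origin hxo]
  have ho := h.inn_origin (γ x)
  obtain ⟨z, hxz, hoz⟩ := h.exists_common hx ho hxo (h.base_origin _).symm
  have hγ {y : W} (hxy : Δ.Adj x y) : γ y = γ x := h.base_eq hx (h.not_inn_of_adj hx hxy) hxy
  have str_z : h.str x (δ z) = false :=
    (h.str_apply hx hxz).trans ((h.bit_eq_false_iff (hγ hxz)).2 hoz)
  have str_ne (w : Γ.neighborSet (γ x)) (hw : (w : V) ≠ δ z) : h.str x w = true := by
    obtain ⟨y, hxy, hyw⟩ := h.exists_dir hx w.2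
    rw [← hyw, h.str_apply hx hxy, ← Bool.not_eq_false, h.bit_eq_false_iff (hγ hxy)]
    exact fun hoy => hw (hyw.symm.trans (congrArg δ (h.common_unique hx ho hxo hxz hoz hxy hoy)))
  let a : Γ.neighborSet (γ x) := ⟨δ z, hγ hxz ▸ h.base_adj (h.not_inn_of_adj hx hxz)⟩
  have := nontrivial_of_card_eq_three (hΓ (γ x))
  obtain ⟨b, hba⟩ := exists_ne a
  obtain ⟨c, hca, hcb, -⟩ := exists_third (hΓ (γ x)) hba.symm
  rw [isEvenString_iff (hΓ _) hba.symm hca hcb, str_ne b (Subtype.coe_ne_coe.2 hba),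
    str_ne c (Subtype.coe_ne_coe.2 hca), str_z]
  rfl

theorem eq_of_str_eq (hΓ : ∀ v, Nat.card (Γ.neighborSet v) = 3) {x y : W} (hx : inn x)
    (hy : inn y) (hγ : γ x = γ y) (hstr : ∀ w, Γ.Adj (γ x) w → h.str x w = h.str y w) :
    x = y := by
  have common (w : Γ.neighborSet (γ x)) : ∃ z, δ z = w ∧ Δ.Adj x z ∧ Δ.Adj y z := by
    obtain ⟨z, hxz, hzw⟩ := h.exists_dir hx w.2
    have hz := h.not_inn_of_adj hx hxz
    obtain ⟨hγz, hbit⟩ := (h.adj_inner_outer_iff hx hz).1 hxz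
    refine ⟨z, hzw, hxz, (h.adj_inner_outer_iff hy hz).2 ⟨hγz.trans hγ, ?_⟩⟩
    rw [hbit, hzw, hstr w w.2]
  have := nontrivial_of_card_eq_three (hΓ (γ x))
  obtain ⟨a, b, hab⟩ := exists_pair_ne (Γ.neighborSet (γ x))
  obtain ⟨z, hza, hxz, hyz⟩ := common a
  obtain ⟨z', hzb, hxz', hyz'⟩ := common b
  by_contra hne
  exact hab (Subtype.ext (by rw [← hza, ← hzb, h.common_unique hx hy hne hxz hyz hxz' hyz']))

open Classical in
/-- The candidate for an isomorphism onto a CFI graph. -/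
noncomputable def toCFIVertex (hΓ : ∀ v, Nat.card (Γ.neighborSet v) = 3) (x : W) : CFIVertex Γ :=
  if hx : inn x then .int (γ x) (fun w => h.str x w) (h.isEvenString_str hΓ hx)
  else .ext (γ x) (δ x) (h.base_adj hx) (h.bit x)

theorem toCFIVertex_of_inn (hΓ : ∀ v, Nat.card (Γ.neighborSet v) = 3) {x : W} (hx : inn x) :
    h.toCFIVertex hΓ x = .int (γ x) (fun w => h.str x w) (h.isEvenString_str hΓ hx) := dif_pos hx

theorem toCFIVertex_of_not_inn (hΓ : ∀ v, Nat.card (Γ.neighborSet v) = 3) {x : W}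
    (hx : ¬ inn x) : h.toCFIVertex hΓ x = .ext (γ x) (δ x) (h.base_adj hx) (h.bit x) := dif_neg hx

theorem injective_toCFIVertex (hΓ : ∀ v, Nat.card (Γ.neighborSet v) = 3) :
    Function.Injective (h.toCFIVertex hΓ) := by
  intro x y hxy
  by_cases hx : inn x <;> by_cases hy : inn y <;>
    simp only [h.toCFIVertex_of_inn, h.toCFIVertex_of_not_inn, hx, hy, not_false_eq_true,
      reduceCtorEq, CFIVertex.ext.injEq] at hxy
  · obtain ⟨hγ, hstr⟩ := CFIVertex.int_inj hxy
    exact h.eq_of_str_eq hΓ hx hy hγ hstr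
  · exact (h.bit_eq_bit_iff hx hy hxy.1 hxy.2.1).1 hxy.2.2

theorem adj_toCFIVertex_iff (hΓ : ∀ v, Nat.card (Γ.neighborSet v) = 3) (x y : W) :
    (cfiTwist Γ h.twists).Adj (h.toCFIVertex hΓ x) (h.toCFIVertex hΓ y) ↔ Δ.Adj x y := by
  have inner_outer {x y : W} (hx : inn x) (hy : ¬ inn y) :
      (cfiTwist Γ h.twists).Adj (h.toCFIVertex hΓ x) (h.toCFIVertex hΓ y) ↔ Δ.Adj x y := by
    rw [h.toCFIVertex_of_inn hΓ hx, h.toCFIVertex_of_not_inn hΓ hy, CFIVertex.adj_int_iff,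
      h.adj_inner_outer_iff hx hy]
    constructor
    · rintro ⟨w, hw, he⟩
      injection he with hγ hδ hbit
      exact ⟨hγ, hδ ▸ hbit⟩
    · rintro ⟨hγ, hbit⟩
      exact ⟨δ y, hγ ▸ h.base_adj hy, by simp only [hγ, hbit]⟩
  by_cases hx : inn x <;> by_cases hy : inn y
  · rw [h.toCFIVertex_of_inn hΓ hx, h.toCFIVertex_of_inn hΓ hy]
    exact iff_of_false (CFIVertex.not_adj_of_internal trivial trivial) (h.not_adj hx hy)
  · exact inner_outer hx hy
  · rw [SimpleGraph.adj_comm, inner_outer hy hx, SimpleGraph.adj_comm]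
  · rw [h.toCFIVertex_of_not_inn hΓ hx, h.toCFIVertex_of_not_inn hΓ hy]
    exact (h.adj_outer_outer_iff hx hy).symm

theorem exists_iso [Finite V] (hΓ : ∀ v, Nat.card (Γ.neighborSet v) = 3)
    (hcard : Nat.card W = Nat.card (CFIVertex Γ)) :
    ∃ T : Set (Sym2 V), T ⊆ Γ.edgeSet ∧ Nonempty (Δ ≃g cfiTwist Γ T) := by
  have hbij : Function.Bijective (h.toCFIVertex hΓ) :=
    (Nat.bijective_iff_injective_and_card _).2 ⟨h.injective_toCFIVertex hΓ, hcard⟩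
  refine ⟨h.twists, ?_, ⟨⟨Equiv.ofBijective _ hbij, h.adj_toCFIVertex_iff hΓ _ _⟩⟩⟩
  rintro _ ⟨z, -, hz, -, -, rfl, -⟩
  exact h.base_adj hz

end IsCFILike

/-! ### Sentences with three variables that hold in CFI graphs -/

section GadgetRelations

variable {V : Type*} (Γ : SimpleGraph V)

/-- Two outer vertices are directed to the same gadget. -/
def SameFar (y z : V) : Prop := ∃ t, Far Γ y t ∧ Far Γ z t

/-- The vertices `x` and `y` have a common neighbour different from `z`. -/
def OtherCommon (x y z : V) : Prop := ∃ w, Γ.Adj x w ∧ Γ.Adj y w ∧ w ≠ z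

variable {Γ}

theorem Twin.symm {x y : V} (h : Twin Γ x y) : Twin Γ y x := by
  obtain ⟨hxy, a, hxa, b, hxb, hyb, hab⟩ := h
  exact ⟨hxy.symm, a, hxa.symm, b, hyb, hxb, hab⟩

theorem SameGadget.symm {x y : V} (h : SameGadget Γ x y) : SameGadget Γ y x :=
  h.imp Eq.symm Twin.symm

theorem SameGadget.isInner {x y : V} (h : SameGadget Γ x y) (hx : IsInner Γ x) : IsInner Γ y := by
  obtain rfl | hxy := h
  exacts [hx, ⟨x, hxy.symm⟩]

theorem near_of_adj {x z : V} (hz : ¬ IsInner Γ z) (hx : IsInner Γ x) (hzx : Γ.Adj z x) :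
    Near Γ z x :=
  ⟨⟨hz, hx⟩, x, .inl rfl, hzx⟩

end GadgetRelations

/-- The inner vertices fall into gadgets, the gadgets form a graph under `BaseAdj`, and every outer
vertex belongs to one gadget and is directed to one gadget. -/
structure HasGadgets {V : Type*} (Γ : SimpleGraph V) : Prop where
  same_trans : ∀ x y z, SameGadget Γ x y → SameGadget Γ y z → SameGadget Γ x z
  base_symm : ∀ x y, BaseAdj Γ x y → BaseAdj Γ y x
  base_not_same : ∀ x y, BaseAdj Γ x y → ¬ SameGadget Γ x y
  exists_near : ∀ z, ¬ IsInner Γ z → ∃ x, Near Γ z x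
  exists_far : ∀ z, ¬ IsInner Γ z → ∃ x, Far Γ z x
  near_same : ∀ z x y, Near Γ z x → Near Γ z y → SameGadget Γ x y
  far_same : ∀ z x y, Far Γ z x → Far Γ z y → SameGadget Γ x y

/-- The adjacencies between inner and outer vertices are as in a CFI graph. All conditions are
sentences with three variables in the relations of the game. -/
structure IsGadgetGraph {V : Type*} (Γ : SimpleGraph V) : Prop extends HasGadgets Γ where
  not_adj : ∀ x y, IsInner Γ x → IsInner Γ y → ¬ Γ.Adj x y
  base_of_near_far : ∀ z x y, Near Γ z x → Far Γ z y → BaseAdj Γ x y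
  near_of_adj_of_far : ∀ z z' x, ¬ IsInner Γ z' → Γ.Adj z z' → Far Γ z x → Near Γ z' x
  exists_outer : ∀ z, ¬ IsInner Γ z → ∃ z', ¬ IsInner Γ z' ∧ Γ.Adj z z'
  outer_unique : ∀ x y z, ¬ IsInner Γ x → ¬ IsInner Γ y → ¬ IsInner Γ z → Γ.Adj x y →
    Γ.Adj x z → y = z
  exists_dir : ∀ x y, BaseAdj Γ x y → ∃ z, Γ.Adj x z ∧ Far Γ z y
  dir_unique : ∀ x y z, IsInner Γ x → Γ.Adj x y → Γ.Adj x z → SameFar Γ y z → y = z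
  outer_eq : ∀ x y z, Near Γ y x → Near Γ z x → SameFar Γ y z → ¬ Γ.Adj x y → ¬ Γ.Adj x z → y = z
  common_unique : ∀ x y z, Twin Γ x y → Γ.Adj x z → Γ.Adj y z → ¬ OtherCommon Γ x y z

section Invariance

variable {X Y : Type*} {R : (Fin 3 → X) → (Fin 3 → Y) → Prop} {Γ : SimpleGraph X}
  {Δ : SimpleGraph Y} (hR : IsBackForth R)
  (htype : ∀ g h, R g h → graphType Γ g = graphType Δ h)

include htype

theorem invariant_eq_of_graphType_eq : Invariant₂ R (fun x y => x = y) (fun x y => x = y) :=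
  fun g h hgh i j => (graphType_eq_graphType_iff.1 (htype g h hgh) i j).1

theorem invariant_adj_of_graphType_eq : Invariant₂ R Γ.Adj Δ.Adj :=
  fun g h hgh i j => (graphType_eq_graphType_iff.1 (htype g h hgh) i j).2

namespace IsBackForth

include hR

theorem invariant_atTwo : Invariant₂ R (AtTwo Γ) (AtTwo Δ) := by
  have hadj := invariant_adj_of_graphType_eq htype
  have hwalk : Invariant₃ R (fun x y z => Γ.Adj x z ∧ Γ.Adj z y)
      (fun x y z => Δ.Adj x z ∧ Δ.Adj z y) :=
    fun _ _ hgh i j k => and_congr (hadj hgh i k) (hadj hgh k j)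
  exact (invariant_eq_of_graphType_eq htype).not.and (hwalk.exists_last hR)

theorem invariant_twin : Invariant₂ R (Twin Γ) (Twin Δ) := by
  have h₂ := hR.invariant_atTwo htype
  have hfourth : Invariant₃ R (fun x y a => ∃ b, AtTwo Γ x b ∧ AtTwo Γ y b ∧ AtTwo Γ a b)
      (fun x y a => ∃ b, AtTwo Δ x b ∧ AtTwo Δ y b ∧ AtTwo Δ a b) := by
    have hxw : Invariant₃ R (fun x _ w => AtTwo Γ x w) (fun x _ w => AtTwo Δ x w) :=
      fun _ _ hgh i _ k => h₂ hgh i k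
    have hyw : Invariant₃ R (fun _ y w => AtTwo Γ y w) (fun _ y w => AtTwo Δ y w) :=
      fun _ _ hgh _ j k => h₂ hgh j k
    exact hR.invariant₃_exists_of_pairs hxw hxw hyw
  exact h₂.and (Invariant₃.exists_last (fun _ _ hgh i j k =>
    and_congr (and_congr (h₂ hgh i k) (h₂ hgh j k)) (hfourth hgh i j k)) hR)

theorem invariant_isInner : Invariant₁ R (IsInner Γ) (IsInner Δ) :=
  (hR.invariant_twin htype).exists_last hR

theorem invariant_sameGadget : Invariant₂ R (SameGadget Γ) (SameGadget Δ) :=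
  fun _ _ hgh i j =>
    or_congr (invariant_eq_of_graphType_eq htype hgh i j) (hR.invariant_twin htype hgh i j)

theorem invariant_matched : Invariant₂ R (Matched Γ) (Matched Δ) := by
  have hinner := hR.invariant_isInner htype
  have hwalk : Invariant₃ R (fun x y z => AtTwo Γ x z ∧ Γ.Adj z y)
      (fun x y z => AtTwo Δ x z ∧ Δ.Adj z y) := fun _ _ hgh i j k =>
    and_congr (hR.invariant_atTwo htype hgh i k) (invariant_adj_of_graphType_eq htype hgh k j)
  exact fun _ _ hgh i j =>
    and_congr (and_congr (hinner hgh i) (hinner hgh j)) (hwalk.exists_last hR hgh i j)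

theorem invariant_baseAdj : Invariant₂ R (BaseAdj Γ) (BaseAdj Δ) :=
  Invariant₃.exists_last (P := fun x y y' => SameGadget Γ y y' ∧ Matched Γ x y')
    (P' := fun x y y' => SameGadget Δ y y' ∧ Matched Δ x y') (fun _ _ hgh i j k =>
      and_congr (hR.invariant_sameGadget htype hgh j k) (hR.invariant_matched htype hgh i k)) hR

theorem invariant_exists_sameGadget {P : X → X → Prop} {P' : Y → Y → Prop}
    (hP : Invariant₂ R P P') :
    Invariant₂ R (fun z x => (¬ IsInner Γ z ∧ IsInner Γ x) ∧ ∃ x', SameGadget Γ x x' ∧ P z x')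
      (fun z x => (¬ IsInner Δ z ∧ IsInner Δ x) ∧ ∃ x', SameGadget Δ x x' ∧ P' z x') := by
  have hinner := hR.invariant_isInner htype
  have hex : Invariant₃ R (fun z x x' => SameGadget Γ x x' ∧ P z x')
      (fun z x x' => SameGadget Δ x x' ∧ P' z x') := fun _ _ hgh i j k =>
    and_congr (hR.invariant_sameGadget htype hgh j k) (hP hgh i k)
  exact fun _ _ hgh i j =>
    and_congr (and_congr (not_congr (hinner hgh i)) (hinner hgh j)) (hex.exists_last hR hgh i j)

theorem invariant_near : Invariant₂ R (Near Γ) (Near Δ) :=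
  hR.invariant_exists_sameGadget htype (invariant_adj_of_graphType_eq htype)

theorem invariant_far : Invariant₂ R (Far Γ) (Far Δ) :=
  hR.invariant_exists_sameGadget htype (hR.invariant_atTwo htype)

theorem invariant_sameFar : Invariant₂ R (SameFar Γ) (SameFar Δ) := by
  have hfar := hR.invariant_far htype
  exact Invariant₃.exists_last (P := fun y z t => Far Γ y t ∧ Far Γ z t)
    (fun _ _ hgh i j k => and_congr (hfar hgh i k) (hfar hgh j k)) hR

theorem invariant_otherCommon : Invariant₃ R (OtherCommon Γ) (OtherCommon Δ) := by
  have hadj := invariant_adj_of_graphType_eq htype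
  have hxw : Invariant₃ R (fun x _ w => Γ.Adj x w) (fun x _ w => Δ.Adj x w) :=
    fun _ _ hgh i _ k => hadj hgh i k
  exact hR.invariant₃_exists_of_pairs hxw hxw
    (C := fun _ z w => w ≠ z) (C' := fun _ z w => w ≠ z)
    fun _ _ hgh _ j k => not_congr (invariant_eq_of_graphType_eq htype hgh k j)

theorem hasGadgets (hΓ : HasGadgets Γ) : HasGadgets Δ := by
  have hI := hR.invariant_isInner htype
  have hS := hR.invariant_sameGadget htype
  have hB := hR.invariant_baseAdj htype
  have hN := hR.invariant_near htype
  have hF := hR.invariant_far htype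
  have hEN := hN.exists_last hR
  have hEF := hF.exists_last hR
  constructor
  · exact Invariant₃.transfer (hall := hΓ.same_trans)
      (fun _ _ hgh i j k => by simp only [hS hgh]) hR
  · exact Invariant₂.transfer (hall := hΓ.base_symm) (fun _ _ hgh i j => by simp only [hB hgh]) hR
  · exact Invariant₂.transfer (hall := hΓ.base_not_same)
      (fun _ _ hgh i j => by simp only [hB hgh, hS hgh]) hR
  · exact Invariant₁.transfer (hall := hΓ.exists_near)
      (fun _ _ hgh i => imp_congr (not_congr (hI hgh i)) (hEN hgh i)) hR
  · exact Invariant₁.transfer (hall := hΓ.exists_far)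
      (fun _ _ hgh i => imp_congr (not_congr (hI hgh i)) (hEF hgh i)) hR
  · exact Invariant₃.transfer (hall := hΓ.near_same)
      (fun _ _ hgh i j k => by simp only [hN hgh, hS hgh]) hR
  · exact Invariant₃.transfer (hall := hΓ.far_same)
      (fun _ _ hgh i j k => by simp only [hF hgh, hS hgh]) hR

theorem isGadgetGraph (hΓ : IsGadgetGraph Γ) : IsGadgetGraph Δ := by
  have hE := invariant_eq_of_graphType_eq htype
  have hA := invariant_adj_of_graphType_eq htype
  have hI := hR.invariant_isInner htype
  have hT := hR.invariant_twin htype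
  have hB := hR.invariant_baseAdj htype
  have hN := hR.invariant_near htype
  have hF := hR.invariant_far htype
  have hSF := hR.invariant_sameFar htype
  have hO := hR.invariant_otherCommon htype
  have hEO := Invariant₂.exists_last (P := fun z z' => ¬ IsInner Γ z' ∧ Γ.Adj z z')
    (P' := fun z z' => ¬ IsInner Δ z' ∧ Δ.Adj z z')
    (fun _ _ hgh i j => and_congr (not_congr (hI hgh j)) (hA hgh i j)) hR
  have hED := Invariant₃.exists_last (P := fun x y z => Γ.Adj x z ∧ Far Γ z y)
    (P' := fun x y z => Δ.Adj x z ∧ Far Δ z y)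
    (fun _ _ hgh i j k => and_congr (hA hgh i k) (hF hgh k j)) hR
  refine ⟨hR.hasGadgets htype hΓ.toHasGadgets, ?_, ?_, ?_, ?_, ?_, ?_, ?_, ?_, ?_⟩
  · exact Invariant₂.transfer (hall := hΓ.not_adj)
      (fun _ _ hgh i j => by simp only [hI hgh, hA hgh]) hR
  · exact Invariant₃.transfer (hall := hΓ.base_of_near_far)
      (fun _ _ hgh i j k => by simp only [hN hgh, hF hgh, hB hgh]) hR
  · exact Invariant₃.transfer (hall := hΓ.near_of_adj_of_far)
      (fun _ _ hgh i j k => by simp only [hN hgh, hF hgh, hI hgh, hA hgh]) hR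
  · exact Invariant₁.transfer (hall := hΓ.exists_outer)
      (fun _ _ hgh i => imp_congr (not_congr (hI hgh i)) (hEO hgh i)) hR
  · exact Invariant₃.transfer (hall := hΓ.outer_unique)
      (fun _ _ hgh i j k => by simp only [hI hgh, hA hgh, hE hgh]) hR
  · exact Invariant₂.transfer (hall := hΓ.exists_dir)
      (fun _ _ hgh i j => imp_congr (hB hgh i j) (hED hgh i j)) hR
  · exact Invariant₃.transfer (hall := hΓ.dir_unique)
      (fun _ _ hgh i j k => by simp only [hI hgh, hSF hgh, hA hgh, hE hgh]) hR
  · exact Invariant₃.transfer (hall := hΓ.outer_eq)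
      (fun _ _ hgh i j k => by simp only [hN hgh, hSF hgh, hA hgh, hE hgh]) hR
  · exact Invariant₃.transfer (hall := hΓ.common_unique)
      (fun _ _ hgh i j k => by simp only [hT hgh, hA hgh, hO hgh]) hR

end IsBackForth

end Invariance

namespace CFIVertex

variable {V : Type u} {Γ : SimpleGraph V} (hΓ : ∀ v, Nat.card (Γ.neighborSet v) = 3)
  {T : Set (Sym2 V)}

theorem exists_internal_base_eq (v : V) : ∃ x : CFIVertex Γ, x.Internal ∧ x.base = v :=
  ⟨int v (fun _ => false) (by simp), trivial, rfl⟩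

theorem eq_of_adj_of_far_eq {x y z : CFIVertex Γ} (hx : x.Internal)
    (hxy : (cfiTwist Γ T).Adj x y) (hxz : (cfiTwist Γ T).Adj x z) (hfar : y.far = z.far) :
    y = z := by
  obtain ⟨v, s, hs, rfl⟩ := internal_iff.1 hx
  obtain ⟨w, hw, rfl⟩ := adj_int_iff.1 hxy
  obtain ⟨w', hw', rfl⟩ := adj_int_iff.1 hxz
  obtain rfl : w = w' := hfar
  rfl

theorem eq_of_not_adj_of_far_eq {x y z : CFIVertex Γ} (hx : x.Internal) (hy : ¬ y.Internal)
    (hz : ¬ z.Internal) (hyx : y.base = x.base) (hzx : z.base = x.base) (hfar : y.far = z.far)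
    (hxy : ¬ (cfiTwist Γ T).Adj x y) (hxz : ¬ (cfiTwist Γ T).Adj x z) : y = z := by
  obtain ⟨v, s, hs, rfl⟩ := internal_iff.1 hx
  obtain ⟨v₁, w, h, b, rfl⟩ := not_internal_iff.1 hy
  obtain ⟨v₂, w', h', b', rfl⟩ := not_internal_iff.1 hz
  obtain rfl : v₁ = v := hyx
  obtain rfl : v₂ = v₁ := hzx
  obtain rfl : w = w' := hfar
  rw [adj_int_ext, ← ne_eq, ← Bool.eq_not] at hxy hxz
  rw [Bool.not_inj (hxy.symm.trans hxz)]

theorem exists_adj_far_eq {x : CFIVertex Γ} (hx : x.Internal) {w : V} (hw : Γ.Adj x.base w) :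
    ∃ z, (cfiTwist Γ T).Adj x z ∧ ¬ z.Internal ∧ z.far = w := by
  obtain ⟨v, s, hs, rfl⟩ := internal_iff.1 hx
  exact ⟨ext v w hw (s ⟨w, hw⟩), adj_int_ext.2 rfl, id, rfl⟩

theorem exists_adj_not_internal {z : CFIVertex Γ} (hz : ¬ z.Internal) :
    ∃ z', ¬ z'.Internal ∧ (cfiTwist Γ T).Adj z z' := by
  obtain ⟨v, w, h, b, rfl⟩ := not_internal_iff.1 hz
  obtain ⟨b', hb⟩ := exists_adj_ext_ext T h b
  exact ⟨_, id, hb⟩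

include hΓ

theorem sameGadget_iff_eq_or {x y : CFIVertex Γ} :
    SameGadget (cfiTwist Γ T) x y ↔ x = y ∨ x.Internal ∧ y.Internal ∧ x.base = y.base := by
  rw [SameGadget, twin_iff hΓ]
  tauto

theorem sameFar_iff {y z : CFIVertex Γ} :
    SameFar (cfiTwist Γ T) y z ↔ ¬ y.Internal ∧ ¬ z.Internal ∧ y.far = z.far := by
  simp only [SameFar, far_iff hΓ]
  constructor
  · rintro ⟨t, ⟨hy, -, hyt⟩, hz, -, hzt⟩
    exact ⟨hy, hz, hyt.trans hzt.symm⟩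
  · rintro ⟨hy, hz, hyz⟩
    obtain ⟨t, ht, hbase⟩ := exists_internal_base_eq (Γ := Γ) y.far
    exact ⟨t, ⟨hy, ht, hbase.symm⟩, hz, ht, hyz.symm.trans hbase.symm⟩

theorem hasGadgets (T : Set (Sym2 V)) : HasGadgets (cfiTwist Γ T) := by
  constructor <;> simp only [sameGadget_iff_eq_or hΓ, isInner_iff hΓ, baseAdj_iff hΓ,
    near_iff hΓ, far_iff hΓ]
  · grind
  · exact fun x y ⟨hx, hy, hadj⟩ => ⟨hy, hx, hadj.symm⟩
  · rintro x y ⟨-, -, hadj⟩ (rfl | ⟨-, -, hbase⟩)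
    exacts [hadj.ne rfl, hadj.ne hbase]
  · intro z hz
    obtain ⟨x, hx, hbase⟩ := exists_internal_base_eq (Γ := Γ) z.base
    exact ⟨x, hz, hx, hbase.symm⟩
  · intro z hz
    obtain ⟨x, hx, hbase⟩ := exists_internal_base_eq (Γ := Γ) z.far
    exact ⟨x, hz, hx, hbase.symm⟩
  · grind
  · grind

theorem isGadgetGraph (T : Set (Sym2 V)) : IsGadgetGraph (cfiTwist Γ T) := by
  refine ⟨hasGadgets hΓ T, ?_, ?_, ?_, ?_, ?_, ?_, ?_, ?_, ?_⟩ <;>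
    simp only [isInner_iff hΓ, baseAdj_iff hΓ, near_iff hΓ, far_iff hΓ, sameFar_iff hΓ,
      twin_iff hΓ]
  · exact fun x y hx hy => not_adj_of_internal hx hy
  · exact fun z x y ⟨hz, hx, hzx⟩ ⟨_, hy, hzy⟩ => ⟨hx, hy, hzx ▸ hzy ▸ adj_base_far hz⟩
  · exact fun z z' x hz' hadj ⟨hz, hx, hzx⟩ =>
      ⟨hz', hx, (base_eq_far_of_adj hz hz' hadj).1.trans hzx⟩
  · exact fun z hz => exists_adj_not_internal hz
  · exact fun x y z hx hy hz => eq_of_adj_of_not_internal hx hy hz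
  · rintro x y ⟨hx, hy, hadj⟩
    obtain ⟨z, hxz, hz, hfar⟩ := exists_adj_far_eq hx hadj
    exact ⟨z, hxz, hz, hy, hfar⟩
  · exact fun x y z hx hxy hxz ⟨_, _, hfar⟩ => eq_of_adj_of_far_eq hx hxy hxz hfar
  · exact fun x y z ⟨hy, hx, hyx⟩ ⟨hz, _, hzx⟩ ⟨_, _, hfar⟩ =>
      eq_of_not_adj_of_far_eq hx hy hz hyx hzx hfar
  · rintro x y z ⟨hx, hy, -, hne⟩ hxz hyz ⟨w, hxw, hyw, hwz⟩
    exact hwz (eq_of_adj_of_internal hΓ hx hy hne hxw hyw hxz hyz)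

end CFIVertex

/-- The map `q` identifies the gadgets of `Δ` with the vertices of `Γ`, such that adjacency is
`BaseAdj`. -/
structure IsBaseMap {V W : Type*} (Γ : SimpleGraph V) (Δ : SimpleGraph W)
    (q : {x // IsInner Δ x} → V) : Prop where
  surjective : Function.Surjective q
  eq_iff : ∀ x y, q x = q y ↔ SameGadget Δ x y
  adj_iff : ∀ x y, Γ.Adj (q x) (q y) ↔ BaseAdj Δ x y

namespace HasGadgets

variable {W : Type*} {Δ : SimpleGraph W} (hΔ : HasGadgets Δ)

/-- The partition of the inner vertices into gadgets. -/
def setoid : Setoid {x // IsInner Δ x} where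
  r x y := SameGadget Δ x y
  iseqv := ⟨fun _ => .inl rfl, SameGadget.symm, hΔ.same_trans _ _ _⟩

include hΔ in
theorem baseAdj_congr {x x' y y' : W} (hx : SameGadget Δ x x') (hy : SameGadget Δ y y')
    (h : BaseAdj Δ x y) : BaseAdj Δ x' y' := by
  have congr_right {x y y' : W} (hy : SameGadget Δ y y') : BaseAdj Δ x y → BaseAdj Δ x y' :=
    fun ⟨z, hyz, hxz⟩ => ⟨z, hΔ.same_trans _ _ _ hy.symm hyz, hxz⟩
  exact hΔ.base_symm _ _ (congr_right hx (hΔ.base_symm _ _ (congr_right hy h)))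

/-- The graph on the set of gadgets. -/
def baseGraph : SimpleGraph (Quotient hΔ.setoid) where
  Adj := Quotient.lift₂ (fun x y => BaseAdj Δ x y) fun _ _ _ _ hx hy =>
    propext ⟨hΔ.baseAdj_congr hx hy,
      hΔ.baseAdj_congr (SameGadget.symm hx) (SameGadget.symm hy)⟩
  symm := ⟨by
    rintro ⟨x⟩ ⟨y⟩ h
    exact hΔ.base_symm _ _ h⟩
  loopless := ⟨by
    rintro ⟨x⟩ h
    exact hΔ.base_not_same _ _ h (.inl rfl)⟩

theorem isBaseMap_mk : IsBaseMap hΔ.baseGraph Δ (Quotient.mk hΔ.setoid) where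
  surjective := Quotient.mk_surjective
  eq_iff _ _ := Quotient.eq
  adj_iff _ _ := .rfl

end HasGadgets

namespace IsBaseMap

variable {V W : Type*} {Γ : SimpleGraph V} {Δ : SimpleGraph W} {q : {x // IsInner Δ x} → V}

theorem comp_iso {V' : Type*} {Γ' : SimpleGraph V'} (hq : IsBaseMap Γ Δ q) (e : Γ ≃g Γ') :
    IsBaseMap Γ' Δ (e ∘ q) where
  surjective := e.surjective.comp hq.surjective
  eq_iff x y := e.injective.eq_iff.trans (hq.eq_iff x y)
  adj_iff x y := e.map_rel_iff.trans (hq.adj_iff x y)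

theorem card_fiber (hq : IsBaseMap Γ Δ q) (x : {x // IsInner Δ x}) :
    Nat.card {y // q y = q x} = Nat.card {y // SameGadget Δ x y} :=
  Nat.card_congr
    { toFun := fun y => ⟨y.1, (hq.eq_iff _ _).1 y.2.symm⟩
      invFun := fun y => ⟨⟨y, y.2.isInner x.2⟩, ((hq.eq_iff x ⟨y, y.2.isInner x.2⟩).2 y.2).symm⟩
      left_inv := fun _ => rfl
      right_inv := fun _ => rfl }

section CFILike

open Classical in
/-- The extension of a base map to a map on all vertices, such that a vertex `z` outside of the
gadgets is mapped to the base vertex of a gadget related to `z` by `P`. It is used for the relations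
`Near` and `Far`. -/
noncomputable def extend (q : {x // IsInner Δ x} → V) (P : W → W → Prop)
    (hP : ∀ z, ¬ IsInner Δ z → ∃ x, IsInner Δ x ∧ P z x) (z : W) : V :=
  if hz : IsInner Δ z then q ⟨z, hz⟩ else q ⟨(hP z hz).choose, (hP z hz).choose_spec.1⟩

variable {P : W → W → Prop} {hP : ∀ z, ¬ IsInner Δ z → ∃ x, IsInner Δ x ∧ P z x}

theorem extend_of_isInner {x : W} (hx : IsInner Δ x) : extend q P hP x = q ⟨x, hx⟩ := dif_pos hx

theorem extend_eq_iff (hq : IsBaseMap Γ Δ q)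
    (hcongr : ∀ {z x y}, SameGadget Δ x y → P z x → P z y)
    (hsame : ∀ z x y, P z x → P z y → SameGadget Δ x y) {x z : W} (hz : ¬ IsInner Δ z)
    (hx : IsInner Δ x) : extend q P hP z = q ⟨x, hx⟩ ↔ P z x := by
  rw [extend, dif_neg hz, hq.eq_iff]
  exact ⟨fun h => hcongr h (hP z hz).choose_spec.2, hsame _ _ _ (hP z hz).choose_spec.2⟩

end CFILike

end IsBaseMap

theorem HasGadgets.near_congr {W : Type*} {Δ : SimpleGraph W} (hΔ : HasGadgets Δ) {z x y : W}
    (hxy : SameGadget Δ x y) : Near Δ z x → Near Δ z y :=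
  fun ⟨⟨hz, hx⟩, x', hxx', hadj⟩ =>
    ⟨⟨hz, hxy.isInner hx⟩, x', hΔ.same_trans _ _ _ hxy.symm hxx', hadj⟩

theorem HasGadgets.far_congr {W : Type*} {Δ : SimpleGraph W} (hΔ : HasGadgets Δ) {z x y : W}
    (hxy : SameGadget Δ x y) : Far Δ z x → Far Δ z y :=
  fun ⟨⟨hz, hx⟩, x', hxx', hadj⟩ =>
    ⟨⟨hz, hxy.isInner hx⟩, x', hΔ.same_trans _ _ _ hxy.symm hxx', hadj⟩

/-- The maps `γ` and `δ` send the vertices outside of the gadgets to the base vertices of the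
gadgets they belong to and are directed to. -/
structure IsExtension {V W : Type*} (Δ : SimpleGraph W) (q : {x // IsInner Δ x} → V)
    (γ δ : W → V) : Prop where
  apply_inner : ∀ x : {x // IsInner Δ x}, γ x = q x
  apply_eq_iff_near : ∀ {z x}, ¬ IsInner Δ z → IsInner Δ x → (γ z = γ x ↔ Near Δ z x)
  apply_eq_iff_far : ∀ {z x}, ¬ IsInner Δ z → IsInner Δ x → (δ z = γ x ↔ Far Δ z x)

theorem IsBaseMap.exists_isExtension {V W : Type*} {Γ : SimpleGraph V} {Δ : SimpleGraph W}
    {q : {x // IsInner Δ x} → V} (hq : IsBaseMap Γ Δ q) (hΔ : HasGadgets Δ) :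
    ∃ γ δ, IsExtension Δ q γ δ := by
  refine ⟨extend q (Near Δ) fun z hz => (hΔ.exists_near z hz).imp fun _ h => ⟨h.1.2, h⟩,
    extend q (Far Δ) fun z hz => (hΔ.exists_far z hz).imp fun _ h => ⟨h.1.2, h⟩,
    fun x => extend_of_isInner x.2, fun hz hx => ?_, fun hz hx => ?_⟩ <;>
    rw [extend_of_isInner hx]
  · exact hq.extend_eq_iff (P := Near Δ) hΔ.near_congr hΔ.near_same hz hx
  · exact hq.extend_eq_iff (P := Far Δ) hΔ.far_congr hΔ.far_same hz hx

namespace IsExtension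

variable {V W : Type*} {Γ : SimpleGraph V} {Δ : SimpleGraph W} {q : {x // IsInner Δ x} → V}
  {γ δ : W → V} (h : IsExtension Δ q γ δ)

include h

theorem adj_iff (hq : IsBaseMap Γ Δ q) {x y : W} (hx : IsInner Δ x) (hy : IsInner Δ y) :
    Γ.Adj (γ x) (γ y) ↔ BaseAdj Δ x y := by
  rw [h.apply_inner ⟨x, hx⟩, h.apply_inner ⟨y, hy⟩, hq.adj_iff]

theorem sameFar_of_eq (hΔ : HasGadgets Δ) {y z : W} (hy : ¬ IsInner Δ y) (hz : ¬ IsInner Δ z)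
    (hyz : δ y = δ z) : SameFar Δ y z := by
  obtain ⟨x, hyx⟩ := hΔ.exists_far y hy
  have hx := hyx.1.2
  exact ⟨x, hyx, (h.apply_eq_iff_far hz hx).1 (hyz ▸ (h.apply_eq_iff_far hy hx).2 hyx)⟩

theorem base_adj (hq : IsBaseMap Γ Δ q) (hΔ : IsGadgetGraph Δ) {z : W} (hz : ¬ IsInner Δ z) :
    Γ.Adj (γ z) (δ z) := by
  obtain ⟨x, hzx⟩ := hΔ.exists_near z hz
  obtain ⟨y, hzy⟩ := hΔ.exists_far z hz
  rw [(h.apply_eq_iff_near hz hzx.1.2).2 hzx, (h.apply_eq_iff_far hz hzy.1.2).2 hzy,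
    h.adj_iff hq hzx.1.2 hzy.1.2]
  exact hΔ.base_of_near_far _ _ _ hzx hzy

theorem far_eq (hΔ : IsGadgetGraph Δ) {z z' : W} (hz : ¬ IsInner Δ z) (hz' : ¬ IsInner Δ z')
    (hadj : Δ.Adj z z') : γ z' = δ z := by
  obtain ⟨x, hzx⟩ := hΔ.exists_far z hz
  rw [(h.apply_eq_iff_far hz hzx.1.2).2 hzx, h.apply_eq_iff_near hz' hzx.1.2]
  exact hΔ.near_of_adj_of_far _ _ _ hz' hadj hzx

theorem exists_dir (hq : IsBaseMap Γ Δ q) (hΔ : IsGadgetGraph Δ) {x : W} {w : V}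
    (hx : IsInner Δ x) (hw : Γ.Adj (γ x) w) : ∃ z, Δ.Adj x z ∧ δ z = w := by
  obtain ⟨⟨y, hy⟩, rfl⟩ := hq.surjective w
  rw [← h.apply_inner ⟨y, hy⟩] at hw ⊢
  obtain ⟨z, hxz, hzy⟩ := hΔ.exists_dir _ _ ((h.adj_iff hq hx hy).1 hw)
  exact ⟨z, hxz, (h.apply_eq_iff_far hzy.1.1 hy).2 hzy⟩

theorem isCFILike (hq : IsBaseMap Γ Δ q) (hΔ : IsGadgetGraph Δ) :
    IsCFILike Γ Δ (IsInner Δ) γ δ := by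
  have outer {x y} (hx : IsInner Δ x) (hxy : Δ.Adj x y) : ¬ IsInner Δ y :=
    fun hy => hΔ.not_adj _ _ hx hy hxy
  have sameFar {y z} := h.sameFar_of_eq hΔ.toHasGadgets (y := y) (z := z)
  constructor
  case exists_inner =>
    intro v
    obtain ⟨x, rfl⟩ := hq.surjective v
    exact ⟨x, x.2, h.apply_inner x⟩
  case not_adj => exact fun hx hy => hΔ.not_adj _ _ hx hy
  case base_eq => exact fun hx hz hxz => (h.apply_eq_iff_near hz hx).2 (near_of_adj hz hx hxz.symm)
  case exists_dir => exact fun hx hw => h.exists_dir hq hΔ hx hw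
  case dir_unique =>
    exact fun hx hxy hxz hδ =>
      hΔ.dir_unique _ _ _ hx hxy hxz (sameFar (outer hx hxy) (outer hx hxz) hδ)
  case exists_common =>
    intro x y hx hy hne hγ
    rw [h.apply_inner ⟨x, hx⟩, h.apply_inner ⟨y, hy⟩, hq.eq_iff] at hγ
    obtain ⟨z, hxz, hzy⟩ := (hγ.resolve_left hne).1.2
    exact ⟨z, hxz, hzy.symm⟩
  case common_unique =>
    intro x y z z' hx hy hne hxz hyz hxz' hyz'
    have hz := outer hx hxz
    have hxy := hΔ.near_same _ _ _ (near_of_adj hz hx hxz.symm) (near_of_adj hz hy hyz.symm)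
    by_contra hzz
    exact hΔ.common_unique _ _ _ (hxy.resolve_left hne) hxz hyz ⟨z', hxz', hyz', hzz⟩
  case exists_outer => exact fun hz => hΔ.exists_outer _ hz
  case outer_unique => exact fun hx hy hz => hΔ.outer_unique _ _ _ hx hy hz
  case base_adj => exact fun hz => h.base_adj hq hΔ hz
  case far_eq => exact fun hz hz' => h.far_eq hΔ hz hz'
  case outer_eq =>
    exact fun ho hy hz hyo hzo hδ => hΔ.outer_eq _ _ _ ((h.apply_eq_iff_near hy ho).1 hyo)
      ((h.apply_eq_iff_near hz ho).1 hzo) (sameFar hy hz hδ)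

end IsExtension

theorem CFIVertex.isBaseMap {V : Type u} {Γ : SimpleGraph V}
    (hΓ : ∀ v, Nat.card (Γ.neighborSet v) = 3) (T : Set (Sym2 V)) :
    IsBaseMap Γ (cfiTwist Γ T) fun x => (x : CFIVertex Γ).base where
  surjective v := by
    obtain ⟨x, hx, hv⟩ := exists_internal_base_eq (Γ := Γ) v
    exact ⟨⟨x, (isInner_iff hΓ).2 hx⟩, hv⟩
  eq_iff x y := by
    simp only [sameGadget_iff hΓ ((isInner_iff hΓ).1 x.2), (isInner_iff hΓ).1 y.2, true_and]
  adj_iff x y := by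
    simp only [baseAdj_iff hΓ, (isInner_iff hΓ).1 x.2, (isInner_iff hΓ).1 y.2, true_and]

theorem CFIVertex.card_isInner_base_eq {V : Type u} {Γ : SimpleGraph V}
    (hΓ : ∀ v, Nat.card (Γ.neighborSet v) = 3) (T : Set (Sym2 V)) (v : V) :
    Nat.card {x : {x // IsInner (cfiTwist Γ T) x} // (x : CFIVertex Γ).base = v} = 4 := by
  rw [← card_isEvenString (hΓ v)]
  refine (Nat.card_eq_of_bijective
    (fun s => ⟨⟨int v s.1 s.2, (isInner_iff hΓ).2 trivial⟩, rfl⟩) ⟨fun s t hst => ?_, ?_⟩).symm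
  · simpa [Subtype.ext_iff] using hst
  · rintro ⟨⟨x, hx⟩, rfl⟩
    obtain ⟨v, s, hs, rfl⟩ := internal_iff.1 ((isInner_iff hΓ).1 hx)
    exact ⟨⟨s, hs⟩, rfl⟩

section BaseGraph

variable {X Y V V' : Type*} {R : (Fin 3 → X) → (Fin 3 → Y) → Prop} {Θ : SimpleGraph X}
  {Δ : SimpleGraph Y} {Γ : SimpleGraph V} {Γ' : SimpleGraph V'} {q : {x // IsInner Θ x} → V}
  {q' : {x // IsInner Δ x} → V'} {m : ℕ}

theorem IsBackForth.card_baseMap_fiber_eq (hR : IsBackForth R)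
    (htype : ∀ g h, R g h → graphType Θ g = graphType Δ h) (hq : IsBaseMap Γ Θ q)
    (hq' : IsBaseMap Γ' Δ q') (hm : ∀ v, Nat.card {x // q x = v} = m) (v' : V') :
    Nat.card {y // q' y = v'} = m := by
  obtain ⟨y, rfl⟩ := hq'.surjective v'
  obtain ⟨g, hg⟩ := hR.exists_left fun _ => (y : Y)
  have hg₀ : IsInner Θ (g 0) := (hR.invariant_isInner htype hg 0).2 y.2
  rw [hq'.card_fiber, ← hm (q ⟨g 0, hg₀⟩), hq.card_fiber]
  exact ((hR.invariant_sameGadget htype).card_eq hR hg 0).symm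

theorem IsBackForth.isBackForth_wlFinalColor_base [Finite X] [Finite Y] [Finite V] [Finite V']
    [Nonempty V] (hR : IsBackForth R) (htype : ∀ g h, R g h → graphType Θ g = graphType Δ h)
    (hq : IsBaseMap Γ Θ q) (hq' : IsBaseMap Γ' Δ q') (hm : ∀ v, Nat.card {x // q x = v} = m)
    (hpos : 0 < m) :
    IsBackForth fun (g : Fin 3 → V) (h : Fin 3 → V') =>
      wlFinalColor (graphType Γ) g = wlFinalColor (graphType Γ') h := by
  obtain ⟨x, -⟩ := hq.surjective (Classical.arbitrary V)
  have hRI := hR.restrict (D := {x | IsInner Θ x}) (D' := {y | IsInner Δ y})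
    (fun _ _ => hR.invariant_isInner htype (g := _) (h := _)) ⟨x, x.2⟩ three_ne_zero
  refine hRI.isBackForth_wlFinalColor_of_cover hpos hm
    (hR.card_baseMap_fiber_eq htype hq hq' hm) fun g h hgh => ?_
  refine graphType_eq_graphType_iff.2 fun i j => ⟨?_, ?_⟩
  · exact (hq.eq_iff _ _).trans
      ((hR.invariant_sameGadget htype hgh i j).trans (hq'.eq_iff _ _).symm)
  · exact (hq.adj_iff _ _).trans
      ((hR.invariant_baseAdj htype hgh i j).trans (hq'.adj_iff _ _).symm)

end BaseGraph

theorem IsBackForth.exists_iso_cfiTwist {V W : Type u} [Finite V] [Finite W] [Nonempty V]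
    {Γ : SimpleGraph V} {Δ : SimpleGraph W} (hΓ : ∀ v, Nat.card (Γ.neighborSet v) = 3)
    {T : Set (Sym2 V)} {R : (Fin 3 → CFIVertex Γ) → (Fin 3 → W) → Prop} (hR : IsBackForth R)
    (htype : ∀ g h, R g h → graphType (cfiTwist Γ T) g = graphType Δ h)
    (hdim : GraphWLDimLE Γ 3) : ∃ T' ⊆ Γ.edgeSet, Nonempty (Δ ≃g cfiTwist Γ T') := by
  have hΔ : IsGadgetGraph Δ := hR.isGadgetGraph htype (CFIVertex.isGadgetGraph hΓ T)
  have hcard : Nat.card W = Nat.card (CFIVertex Γ) := by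
    obtain ⟨g, h, hgh⟩ := hR.nonempty
    obtain ⟨π, -⟩ := hR.step g h hgh
    exact (Nat.card_congr π).symm
  have hbase := hR.isBackForth_wlFinalColor_base htype (CFIVertex.isBaseMap hΓ T)
    hΔ.isBaseMap_mk (CFIVertex.card_isInner_base_eq hΓ T) four_pos
  obtain ⟨φ⟩ : Nonempty (Γ ≃g hΔ.baseGraph) := by
    by_contra hiso
    exact hbase.not_graphWLDistinguishes (fun _ _ hgh => congrFun hgh 0) (hdim _ _ hiso)
  have hq := hΔ.isBaseMap_mk.comp_iso φ.symm
  obtain ⟨γ, δ, hext⟩ := hq.exists_isExtension hΔ.toHasGadgets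
  exact (hext.isCFILike hq hΔ).exists_iso hΓ hcard

/-! ### Switching twists -/

section Switching

open scoped symmDiff

theorem cast_toNat_xor (a b : Bool) :
    ((a ^^ b).toNat : ZMod 2) = (a.toNat : ZMod 2) + (b.toNat : ZMod 2) := by
  revert a b
  decide

theorem isEvenString_iff_sum_eq_zero {N : Type*} [Fintype N] {s : N → Bool} :
    IsEvenString s ↔ ∑ w, ((s w).toNat : ZMod 2) = 0 := by
  classical
  rw [← Nat.cast_sum, ZMod.natCast_eq_zero_iff_even, IsEvenString, Nat.card_eq_fintype_card,
    Fintype.card_subtype, Finset.card_filter]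
  exact iff_of_eq (congrArg Even (Finset.sum_congr rfl fun w _ => by cases s w <;> rfl))

theorem IsEvenString.xor {N : Type*} [Finite N] {s t : N → Bool} (hs : IsEvenString s)
    (ht : IsEvenString t) : IsEvenString fun w => s w ^^ t w := by
  have := Fintype.ofFinite N
  rw [isEvenString_iff_sum_eq_zero] at *
  simp only [cast_toNat_xor, Finset.sum_add_distrib, hs, ht, add_zero]

theorem ncard_symmDiff_add {α : Type*} {S S' : Set α} (hS : S.Finite) (hS' : S'.Finite) :
    (S ∆ S').ncard + 2 * (S ∩ S').ncard = S.ncard + S'.ncard := by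
  have hunion := Set.ncard_union_add_ncard_inter S S' hS hS'
  have hdiff := Set.ncard_sdiff_add_ncard_of_subset
    (Set.inter_subset_left.trans Set.subset_union_left : S ∩ S' ⊆ S ∪ S') (hS.union hS')
  have hsymm : S ∆ S' = (S ∪ S') \ (S ∩ S') := symmDiff_eq_sup_sdiff_inf S S'
  rw [hsymm]
  omega

theorem even_ncard_symmDiff_iff {α : Type*} {S S' : Set α} (hS : S.Finite) (hS' : S'.Finite) :
    Even (S ∆ S').ncard ↔ S.ncard ≡ S'.ncard [MOD 2] := by
  have := ncard_symmDiff_add hS hS'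
  rw [Nat.even_iff, Nat.ModEq]
  omega

/-- A family `f` of even strings, one at every vertex, switches the edges in `D` if its two values
at an edge differ exactly when the edge belongs to `D`. -/
structure IsSwitching {V : Type u} (Γ : SimpleGraph V) (f : ∀ v, Γ.neighborSet v → Bool)
    (D : Set (Sym2 V)) : Prop where
  isEvenString : ∀ v, IsEvenString (f v)
  subset : D ⊆ Γ.edgeSet
  mem_iff : ∀ {v w} (h : Γ.Adj v w), s(v, w) ∈ D ↔ f v ⟨w, h⟩ ≠ f w ⟨v, h.symm⟩

theorem exists_isSwitching {V : Type u} {Γ : SimpleGraph V} {f : ∀ v, Γ.neighborSet v → Bool}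
    (hf : ∀ v, IsEvenString (f v)) : ∃ D, IsSwitching Γ f D := by
  refine ⟨{e | ∃ v w, ∃ h : Γ.Adj v w, s(v, w) = e ∧ f v ⟨w, h⟩ ≠ f w ⟨v, h.symm⟩}, hf, ?_, ?_⟩
  · rintro _ ⟨v, w, h, rfl, -⟩
    exact h
  · refine fun {v w} h => ⟨?_, fun hne => ⟨v, w, h, rfl, hne⟩⟩
    rintro ⟨v', w', h', heq, hne⟩
    obtain ⟨rfl, rfl⟩ | ⟨rfl, rfl⟩ := Sym2.eq_iff.1 heq
    · exact hne
    · exact hne.symm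

/-- The sets of edges that can be switched by a family of even strings. -/
def IsSwitchable {V : Type u} (Γ : SimpleGraph V) (D : Set (Sym2 V)) : Prop :=
  ∃ f, IsSwitching Γ f D

namespace IsSwitchable

variable {V : Type u} {Γ : SimpleGraph V}

theorem empty : IsSwitchable Γ ∅ :=
  ⟨fun _ _ => false, fun v => by simp [IsEvenString], Set.empty_subset _, by simp⟩

variable [Finite V]

theorem symmDiff {D D' : Set (Sym2 V)} (hD : IsSwitchable Γ D) (hD' : IsSwitchable Γ D') :
    IsSwitchable Γ (D ∆ D') := by
  obtain ⟨f, hf⟩ := hD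
  obtain ⟨f', hf'⟩ := hD'
  refine ⟨fun v w => f v w ^^ f' v w, fun v => (hf.isEvenString v).xor (hf'.isEvenString v),
    Set.symmDiff_subset_union.trans (Set.union_subset hf.subset hf'.subset), fun {v w} h => ?_⟩
  rw [Set.mem_symmDiff, hf.mem_iff h, hf'.mem_iff h]
  generalize f v _ = a, f w _ = b, f' v _ = a', f' w _ = b'
  revert a b a' b'
  decide

theorem symmDiff_singleton_of_adj {v u w : V} (hu : Γ.Adj v u) (hw : Γ.Adj v w) :
    IsSwitchable Γ ({s(v, u)} ∆ {s(v, w)}) := by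
  classical
  have := Fintype.ofFinite V
  refine ⟨fun a b => decide (a = v ∧ b.1 = u) ^^ decide (a = v ∧ b.1 = w), fun a => ?_, ?_, ?_⟩
  · rw [isEvenString_iff_sum_eq_zero]
    obtain rfl | ha := eq_or_ne a v
    · have hsum : ∀ x, Γ.Adj a x →
          ∑ b : Γ.neighborSet a, ((decide (b.1 = x)).toNat : ZMod 2) = 1 := fun x hx => by
        rw [Finset.sum_eq_single ⟨x, hx⟩] <;> simp +contextual [Subtype.ext_iff]
      simp only [cast_toNat_xor, Finset.sum_add_distrib, true_and, hsum u hu, hsum w hw]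
      rfl
    · simp [ha]
  · exact Set.symmDiff_subset_union.trans (Set.union_subset (Set.singleton_subset_iff.2 hu)
      (Set.singleton_subset_iff.2 hw))
  · intro a b hab
    have := hab.ne
    have := hu.ne
    have := hw.ne
    simp only [Set.mem_symmDiff, Set.mem_singleton_iff, Sym2.eq_iff, ne_eq]
    by_cases a = v <;> by_cases b = v <;> by_cases a = u <;> by_cases b = u <;>
      by_cases a = w <;> by_cases b = w <;> simp_all

theorem symmDiff_singleton (hc : Γ.Connected) {e e' : Sym2 V} (he : e ∈ Γ.edgeSet)
    (he' : e' ∈ Γ.edgeSet) : IsSwitchable Γ ({e} ∆ {e'}) := by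
  suffices hwalk : ∀ {v v' : V} (_ : Γ.Walk v v') {u u' : V}, Γ.Adj v u → Γ.Adj v' u' →
      IsSwitchable Γ ({s(v, u)} ∆ {s(v', u')}) by
    induction e with | _ v u
    induction e' with | _ v' u'
    obtain ⟨p⟩ := hc.preconnected v v'
    exact hwalk p he he'
  intro v v' p
  induction p with
  | nil => exact symmDiff_singleton_of_adj
  | @cons v v₁ v' h _ ih =>
    intro u u' hu hu'
    have hstep := (symmDiff_singleton_of_adj hu h).symmDiff (ih h.symm hu')
    rwa [Sym2.eq_swap (a := v₁), symmDiff_assoc, symmDiff_symmDiff_cancel_left] at hstep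

theorem of_even_or_odd_ncard (hc : Γ.Connected) (T : Set (Sym2 V)) (hT : T ⊆ Γ.edgeSet) :
    (Even T.ncard → IsSwitchable Γ T) ∧
      (Odd T.ncard → ∀ e ∈ Γ.edgeSet, IsSwitchable Γ (T ∆ {e})) := by
  induction T, T.toFinite using Set.Finite.induction_on with
  | empty => simp [empty]
  | @insert a T ha _ ih =>
    obtain ⟨haE, hTE⟩ := Set.insert_subset_iff.1 hT
    have hinsert : insert a T = T ∆ {a} :=
      Set.union_singleton.symm.trans (Set.disjoint_singleton_right.2 ha).symmDiff_eq_sup.symm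
    obtain ⟨heven, hodd⟩ := ih hTE
    rw [Set.ncard_insert_of_notMem ha, Nat.even_add_one, Nat.not_even_iff_odd, Nat.odd_add_one,
      Nat.not_odd_iff_even, hinsert]
    refine ⟨fun h => hodd h a haE, fun h e he => ?_⟩
    rw [symmDiff_assoc]
    exact (heven h).symmDiff (symmDiff_singleton hc haE he)

theorem of_even_ncard (hc : Γ.Connected) {D : Set (Sym2 V)} (hD : D ⊆ Γ.edgeSet)
    (heven : Even D.ncard) : IsSwitchable Γ D :=
  (of_even_or_odd_ncard hc D hD).1 heven

end IsSwitchable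

namespace CFIVertex

variable {V : Type u} {Γ : SimpleGraph V}

/-- The permutation of the vertices of the CFI graph that adds the string `f v` to all internal
vertices of the gadget of `v`, and exchanges the two external vertices at the places where the
string is true. -/
def switch [Finite V] (f : ∀ v, Γ.neighborSet v → Bool) (hf : ∀ v, IsEvenString (f v)) :
    CFIVertex Γ ≃ CFIVertex Γ :=
  have hinv : Function.Involutive fun x : CFIVertex Γ => (match x with
    | ext v w h b => ext v w h (b ^^ f v ⟨w, h⟩)
    | int v s hs => int v (fun w => s w ^^ f v w) (IsEvenString.xor hs (hf v)) : CFIVertex Γ) := by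
    rintro (⟨v, w, h, b⟩ | ⟨v, s, hs⟩) <;> simp
  hinv.toPerm

theorem nonempty_iso_of_isSwitchable_symmDiff [Finite V] {T T' : Set (Sym2 V)}
    (h : IsSwitchable Γ (T ∆ T')) : Nonempty (cfiTwist Γ T ≃g cfiTwist Γ T') := by
  obtain ⟨f, hf⟩ := h
  refine ⟨⟨switch f hf.isEvenString, ?_⟩⟩
  rintro (⟨v, w, h, b⟩ | ⟨v, s, hs⟩) (⟨v', w', h', b'⟩ | ⟨v', s', hs'⟩)
  · change (v' = w ∧ w' = v ∧ _) ↔ (v' = w ∧ w' = v ∧ _)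
    refine and_congr_right fun h₁ => and_congr_right fun h₂ => ?_
    subst h₁ h₂
    have hmem := hf.mem_iff h
    rw [Set.mem_symmDiff] at hmem
    revert hmem
    generalize f w' ⟨v', h⟩ = c, f v' ⟨w', h'⟩ = c'
    by_cases hT : s(w', v') ∈ T <;> by_cases hT' : s(w', v') ∈ T' <;>
      simp only [hT, hT'] <;> revert b b' c c' <;> decide
  · change (∃ hv : v = v', _) ↔ (∃ hv : v = v', _)
    refine exists_congr fun h₁ => ?_
    subst h₁
    exact Bool.xor_left_inj
  · change (∃ hv : v' = v, _) ↔ (∃ hv : v' = v, _)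
    refine exists_congr fun h₁ => ?_
    subst h₁
    exact Bool.xor_left_inj
  · rfl

theorem nonempty_iso_of_ncard_modEq [Finite V] (hc : Γ.Connected) {T T' : Set (Sym2 V)}
    (hT : T ⊆ Γ.edgeSet) (hT' : T' ⊆ Γ.edgeSet) (h : T.ncard ≡ T'.ncard [MOD 2]) :
    Nonempty (cfiTwist Γ T ≃g cfiTwist Γ T') :=
  nonempty_iso_of_isSwitchable_symmDiff <| .of_even_ncard hc
    (Set.symmDiff_subset_union.trans (Set.union_subset hT hT'))
    ((even_ncard_symmDiff_iff T.toFinite T'.toFinite).2 h)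

end CFIVertex

end Switching

/-! ### The parity of the number of twists -/

theorem card_dart_edge_mem {V : Type u} [Finite V] {Γ : SimpleGraph V} {D : Set (Sym2 V)}
    (hD : D ⊆ Γ.edgeSet) : Nat.card {d : Γ.Dart // d.edge ∈ D} = 2 * D.ncard := by
  classical
  have := Fintype.ofFinite V
  let q (d : Γ.Dart) : Γ.edgeSet := ⟨d.edge, d.edge_mem⟩
  have hq : ∀ e, Nat.card {d // q d = e} = 2 := fun e => by
    rw [Nat.card_eq_fintype_card, Fintype.card_subtype, ← Γ.dart_edge_fiber_card e e.2]
    exact congrArg Finset.card (Finset.filter_congr fun d _ => Subtype.ext_iff)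
  refine (card_subtype_comp q hq fun e => (e : Sym2 V) ∈ D).trans ?_
  exact congrArg (2 * ·) <| (Nat.card_congr <| Equiv.subtypeSubtypeEquivSubtype
    (p := (· ∈ Γ.edgeSet)) (q := (· ∈ D)) fun h => hD h).trans (Nat.card_coe_set_eq D)

theorem IsSwitching.even_ncard {V : Type u} [Finite V] {Γ : SimpleGraph V}
    {f : ∀ v, Γ.neighborSet v → Bool} {D : Set (Sym2 V)} (hf : IsSwitching Γ f D) :
    Even D.ncard := by
  classical
  have := Fintype.ofFinite V
  let b (d : Γ.Dart) : ZMod 2 := (f d.fst ⟨d.snd, d.adj⟩).toNat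
  have hvertex : ∑ d, b d = 0 := by
    rw [← Finset.sum_fiberwise_of_maps_to (t := Finset.univ) (g := fun d => d.fst) (by simp)]
    refine Finset.sum_eq_zero fun v _ => ?_
    rw [Γ.dart_fst_fiber v, Finset.sum_image (Γ.dartOfNeighborSet_injective v).injOn]
    exact isEvenString_iff_sum_eq_zero.1 (hf.isEvenString v)
  have hedge : ∀ e ∈ Γ.edgeFinset, ∑ d with d.edge = e, b d = if e ∈ D then 1 else 0 := by
    intro e he
    induction e with | _ v w
    let d : Γ.Dart := ⟨(v, w), SimpleGraph.mem_edgeFinset.1 he⟩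
    refine (congrArg (Finset.sum · b) d.edge_fiber).trans ?_
    rw [Finset.sum_pair d.symm_ne.symm]
    have hmem := hf.mem_iff d.adj
    change _ + ((f w ⟨v, _⟩).toNat : ZMod 2) = _
    change s(v, w) ∈ D ↔ f v ⟨w, _⟩ ≠ f w ⟨v, _⟩ at hmem
    simp only [hmem]
    change ((f v ⟨w, _⟩).toNat : ZMod 2) + _ = _
    generalize f v _ = x, f w _ = y
    revert x y
    decide
  rw [← ZMod.natCast_eq_zero_iff_even, ← hvertex,
    ← Finset.sum_fiberwise_of_maps_to (t := Γ.edgeFinset) (g := fun d => d.edge)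
      fun d _ => SimpleGraph.mem_edgeFinset.2 d.edge_mem, Finset.sum_congr rfl hedge,
    Finset.sum_boole, Set.ncard_eq_toFinset_card']
  congr 2
  ext e
  simpa using fun he => hf.subset he

/-- A set that contains exactly one inner vertex of every gadget of the graph. -/
structure IsGadgetTransversal {X : Type*} (Δ : SimpleGraph X) (S : Set X) : Prop where
  isInner : ∀ x ∈ S, IsInner Δ x
  exists_sameGadget : ∀ x, IsInner Δ x → ∃ y ∈ S, SameGadget Δ x y
  eq_of_sameGadget : ∀ x ∈ S, ∀ y ∈ S, SameGadget Δ x y → x = y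

namespace CFIVertex

variable {V : Type u} {Γ : SimpleGraph V} (hΓ : ∀ v, Nat.card (Γ.neighborSet v) = 3)
  {T : Set (Sym2 V)}

include hΓ

theorem isGadgetTransversal_iff {S : Set (CFIVertex Γ)} :
    IsGadgetTransversal (cfiTwist Γ T) S ↔
      ∃ f : ∀ v, Γ.neighborSet v → Bool, ∃ hf : ∀ v, IsEvenString (f v),
        S = Set.range fun v => int v (f v) (hf v) := by
  constructor
  · intro hS
    have hstring : ∀ v, ∃ s hs, int v s hs ∈ S := by
      intro v
      obtain ⟨x, hx, rfl⟩ := exists_internal_base_eq (Γ := Γ) v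
      obtain ⟨y, hyS, hxy⟩ := hS.exists_sameGadget x ((isInner_iff hΓ).2 hx)
      obtain ⟨hy, hbase⟩ := (sameGadget_iff hΓ hx).1 hxy
      obtain ⟨v, s, hs, rfl⟩ := internal_iff.1 hy
      exact hbase ▸ ⟨s, hs, hyS⟩
    choose f hf hfS using hstring
    refine ⟨f, hf, Set.Subset.antisymm (fun x hx => ?_) (Set.range_subset_iff.2 hfS)⟩
    have hint := (isInner_iff hΓ).1 (hS.isInner x hx)
    exact ⟨x.base, (hS.eq_of_sameGadget x hx _ (hfS x.base)
      ((sameGadget_iff hΓ hint).2 ⟨trivial, rfl⟩)).symm⟩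
  · rintro ⟨f, hf, rfl⟩
    refine ⟨?_, fun x hx => ?_, ?_⟩
    · rintro _ ⟨v, rfl⟩
      exact (isInner_iff hΓ).2 trivial
    · exact ⟨_, ⟨x.base, rfl⟩, (sameGadget_iff hΓ ((isInner_iff hΓ).1 hx)).2 ⟨trivial, rfl⟩⟩
    · rintro _ ⟨v, rfl⟩ _ ⟨w, rfl⟩ hvw
      obtain rfl : v = w := ((sameGadget_iff hΓ (x := int v (f v) (hf v)) trivial).1 hvw).2
      rfl

open scoped symmDiff in
theorem baseAdj_and_not_matched_iff {f : ∀ v, Γ.neighborSet v → Bool} {D : Set (Sym2 V)}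
    (hf : IsSwitching Γ f D) {v w : V} :
    BaseAdj (cfiTwist Γ T) (int v (f v) (hf.isEvenString v)) (int w (f w) (hf.isEvenString w)) ∧
      ¬ Matched (cfiTwist Γ T) (int v (f v) (hf.isEvenString v))
        (int w (f w) (hf.isEvenString w)) ↔ Γ.Adj v w ∧ s(v, w) ∈ T ∆ D := by
  rw [baseAdj_iff hΓ, matched_int_int hΓ]
  have hiff (h : Γ.Adj v w) : s(v, w) ∈ T ∆ D ↔
      ¬ (f v ⟨w, h⟩ = f w ⟨v, h.symm⟩ ↔ s(v, w) ∉ T) := by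
    have := hf.mem_iff h
    rw [Set.mem_symmDiff]
    tauto
  exact ⟨fun ⟨⟨_, _, h⟩, hne⟩ => ⟨h, (hiff h).2 fun heq => hne ⟨h, heq⟩⟩,
    fun ⟨h, hmem⟩ => ⟨⟨trivial, trivial, h⟩, fun ⟨_, heq⟩ => (hiff h).1 hmem heq⟩⟩

open scoped symmDiff in
theorem card_baseAdj_and_not_matched_modEq [Finite V] (hT : T ⊆ Γ.edgeSet) {S : Set (CFIVertex Γ)}
    (hS : IsGadgetTransversal (cfiTwist Γ T) S) :
    Nat.card {g : Fin 2 → CFIVertex Γ // (∀ i, g i ∈ S) ∧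
      BaseAdj (cfiTwist Γ T) (g 0) (g 1) ∧ ¬ Matched (cfiTwist Γ T) (g 0) (g 1)} ≡
        2 * T.ncard [MOD 2 * 2] := by
  obtain ⟨f, hf, rfl⟩ := (isGadgetTransversal_iff hΓ).1 hS
  obtain ⟨D, hD⟩ := exists_isSwitching hf
  have hTD : T ∆ D ⊆ Γ.edgeSet :=
    Set.symmDiff_subset_union.trans (Set.union_subset hT hD.subset)
  let ι (v : V) : CFIVertex Γ := int v (f v) (hf v)
  have hcard : Nat.card {g : Fin 2 → CFIVertex Γ // (∀ i, g i ∈ Set.range ι) ∧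
      BaseAdj (cfiTwist Γ T) (g 0) (g 1) ∧ ¬ Matched (cfiTwist Γ T) (g 0) (g 1)} =
        Nat.card {d : Γ.Dart // d.edge ∈ T ∆ D} := by
    let pair (d : {d : Γ.Dart // d.edge ∈ T ∆ D}) : {g : Fin 2 → CFIVertex Γ //
        (∀ i, g i ∈ Set.range ι) ∧
          BaseAdj (cfiTwist Γ T) (g 0) (g 1) ∧ ¬ Matched (cfiTwist Γ T) (g 0) (g 1)} :=
      ⟨![ι d.1.fst, ι d.1.snd], Fin.forall_fin_two.2 ⟨⟨_, rfl⟩, ⟨_, rfl⟩⟩,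
        (baseAdj_and_not_matched_iff hΓ hD).2 ⟨d.1.adj, d.2⟩⟩
    refine (Nat.card_congr (Equiv.ofBijective pair ⟨fun d d' hdd => ?_, ?_⟩)).symm
    · have hval := congrArg Subtype.val hdd
      exact Subtype.ext (SimpleGraph.Dart.ext _ _ (Prod.ext (congrArg base (congrFun hval 0))
        (congrArg base (congrFun hval 1))))
    · rintro ⟨g, hg, hmem⟩
      obtain ⟨⟨v, hv⟩, w, hw⟩ := Fin.forall_fin_two.1 hg
      obtain ⟨hadj, hvw⟩ := (baseAdj_and_not_matched_iff hΓ hD).1 (by rwa [← hv, ← hw] at hmem)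
      exact ⟨⟨⟨(v, w), hadj⟩, hvw⟩, Subtype.ext (funext (Fin.forall_fin_two.2 ⟨hv, hw⟩))⟩
  rw [hcard, card_dart_edge_mem hTD]
  refine Nat.ModEq.mul_left' 2 ?_
  have hsum := ncard_symmDiff_add T.toFinite D.toFinite
  have hDeven := Nat.even_iff.1 hD.even_ncard
  unfold Nat.ModEq
  omega

end CFIVertex

/-- A game with two pebbles on two graphs that respects a set of marked vertices on either side and
the final colours of `3`-WL; it arises by keeping a third pebble on a group element whose support
consists of the marked vertices. -/
structure IsMarkedGame {A B : Type*} (Δ : SimpleGraph A) (Δ' : SimpleGraph B) (S : Set A)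
    (S' : Set B) (Q : (Fin 2 → A) → (Fin 2 → B) → Prop) : Prop extends IsBackForth Q where
  mem_iff : ∀ g h, Q g h → ∀ i, g i ∈ S ↔ h i ∈ S'
  wlFinalColor_eq : ∀ g h, Q g h →
    wlFinalColor (graphType Δ) (g ∘ ![0, 0, 1]) = wlFinalColor (graphType Δ') (h ∘ ![0, 0, 1])

theorem IsReading.mem_image_inSupport_iff {G A : Type*} [Group G] {Δ : SimpleGraph A}
    {q : {x : G // IsSingular x} → A} (hq : IsReading Δ q) {x : G} {u : {x : G // IsSingular x}} :
    q u ∈ q '' {u | InSupport x u.1} ↔ InSupport x u.1 :=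
  ⟨fun ⟨_, hv, h⟩ => (InSupport.congr ((hq.eq_iff _ _).1 h)).1 hv, fun h => ⟨u, h, rfl⟩⟩

theorem ReadingGame.exists_isMarkedGame {G H A B : Type*} [Group G] [Group H] [Finite G] [Finite H]
    {R : (Fin 3 → G) → (Fin 3 → H) → Prop} {Δ : SimpleGraph A} {Δ' : SimpleGraph B}
    {q : {x : G // IsSingular x} → A} {q' : {x : H // IsSingular x} → B} {m : ℕ}
    (hG : ReadingGame R Δ Δ' q q' m) (x : G) :
    ∃ S' Q, IsMarkedGame Δ Δ' (q '' {u | InSupport x u.1}) S' Q := by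
  have := hG.finite_left
  have := hG.finite_right
  obtain ⟨h, hxh⟩ := hG.exists_right fun _ => x
  have hpebble := hG.cons (x := x) (y := h 0) ⟨fun _ => x, Fin.tail h, by
    rwa [Fin.cons_self_tail, show (Fin.cons x fun _ => x : Fin 3 → G) = fun _ => x from
      funext (Fin.cases rfl fun _ => rfl)]⟩
  have hsing := hpebble.restrict (D := {x | IsSingular x}) (D' := {x | IsSingular x})
    (fun _ _ hgh j => hG.invariant_isSingular hgh j.succ) hG.exists_isSingular two_ne_zero
  let S' : Set B := q' '' {u | InSupport (h 0) u.1}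
  let χ (g : Fin 2 → A) :=
    (fun i => g i ∈ q '' {u | InSupport x u.1}, wlFinalColor (graphType Δ) (g ∘ ![0, 0, 1]))
  let χ' (g : Fin 2 → B) := (fun i => g i ∈ S', wlFinalColor (graphType Δ') (g ∘ ![0, 0, 1]))
  have hχ : ∀ (u : Fin 2 → {x : G // IsSingular x}) (u' : Fin 2 → {x : H // IsSingular x}),
      R (Fin.cons x (Subtype.val ∘ u) : Fin 3 → G) (Fin.cons (h 0) (Subtype.val ∘ u') : Fin 3 → H) →
        χ (q ∘ u) = χ' (q' ∘ u') := fun u u' huu => by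
    refine Prod.ext (funext fun i => propext ?_) ?_
    · exact hG.left.mem_image_inSupport_iff.trans <|
        (hG.invariant_inSupport huu 0 i.succ).trans hG.right.mem_image_inSupport_iff.symm
    · refine hG.wlFinalColor_eq (u ∘ ![0, 0, 1]) (u' ∘ ![0, 0, 1]) ?_
      convert hG.piecewise huu 1 {0} using 1 <;> funext i <;> fin_cases i <;> rfl
  refine ⟨S', _, hsing.isBackForth_wlFinalColor_of_cover hG.pos hG.card_left hG.card_right hχ,
    fun g g' hgg i => ?_, fun g g' hgg => ?_⟩
  · exact iff_of_eq (congrFun (congrArg Prod.fst (congrFun hgg 0)) i)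
  · exact congrArg Prod.snd (congrFun hgg 0)

namespace IsMarkedGame

variable {A B : Type*} {Δ : SimpleGraph A} {Δ' : SimpleGraph B} {S : Set A} {S' : Set B}
  {Q : (Fin 2 → A) → (Fin 2 → B) → Prop} (hQ : IsMarkedGame Δ Δ' S S' Q)

include hQ

theorem card_eq {P : A → A → Prop} {P' : B → B → Prop}
    (hP : Invariant₂ (fun (g : Fin 3 → A) (h : Fin 3 → B) =>
      wlFinalColor (graphType Δ) g = wlFinalColor (graphType Δ') h) P P') :
    Nat.card {g : Fin 2 → A // (∀ i, g i ∈ S) ∧ P (g 0) (g 1)} =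
      Nat.card {h : Fin 2 → B // (∀ i, h i ∈ S') ∧ P' (h 0) (h 1)} := by
  obtain ⟨f, hf⟩ := hQ.exists_equiv
  exact Nat.card_congr (f.subtypeEquiv fun g =>
    and_congr (forall_congr' (hQ.mem_iff _ _ (hf g))) (hP (hQ.wlFinalColor_eq _ _ (hf g)) 0 2))

theorem isGadgetTransversal (hR : IsBackForth fun (g : Fin 3 → A) (h : Fin 3 → B) =>
      wlFinalColor (graphType Δ) g = wlFinalColor (graphType Δ') h)
    (hS : IsGadgetTransversal Δ S) : IsGadgetTransversal Δ' S' := by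
  have htype : ∀ (g : Fin 3 → A) (h : Fin 3 → B),
      wlFinalColor (graphType Δ) g = wlFinalColor (graphType Δ') h →
        graphType Δ g = graphType Δ' h := fun _ _ hgh => congrFun hgh 0
  have hinner := hR.invariant_isInner htype
  have hgadget := hR.invariant_sameGadget htype
  have hcolor := hQ.wlFinalColor_eq
  refine ⟨fun y hy => ?_, fun y hy => ?_, fun y hy z hz hyz => ?_⟩
  · obtain ⟨g, hg⟩ := hQ.exists_left fun _ => y
    exact (hinner (hcolor _ _ hg) 0).1 (hS.isInner _ ((hQ.mem_iff _ _ hg 0).2 hy))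
  · obtain ⟨g, hg⟩ := hQ.exists_left fun _ => y
    obtain ⟨x, hxS, hx⟩ := hS.exists_sameGadget (g 0) ((hinner (hcolor _ _ hg) 0).2 hy)
    obtain ⟨π, hπ⟩ := hQ.step _ _ hg
    have hstep := hπ 1 x
    exact ⟨π x, (hQ.mem_iff _ _ hstep 1).1 hxS, (hgadget (hcolor _ _ hstep) 0 2).1 hx⟩
  · obtain ⟨g, hg⟩ := hQ.exists_left ![y, z]
    exact (invariant_eq_of_graphType_eq htype (hcolor _ _ hg) 0 2).1 <|
      hS.eq_of_sameGadget _ ((hQ.mem_iff _ _ hg 0).2 hy) _ ((hQ.mem_iff _ _ hg 1).2 hz) <|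
        (hgadget (hcolor _ _ hg) 0 2).2 hyz

end IsMarkedGame

namespace CFIVertex

variable {V : Type u} [Finite V] {Γ : SimpleGraph V} {p : ℕ} [Fact p.Prime]

instance [Nonempty V] : Nonempty (CFIVertex Γ) :=
  ⟨(exists_internal_base_eq (Classical.arbitrary V)).choose⟩

theorem ncard_modEq_of_isGroupGame [Nonempty V] (hΓ : ∀ v, Nat.card (Γ.neighborSet v) = 3)
    {T T' : Set (Sym2 V)} (hT : T ⊆ Γ.edgeSet) (hT' : T' ⊆ Γ.edgeSet) {H : Type*} [Group H]
    [Finite H] {R : (Fin 3 → MeklerGroup p (cfiTwist Γ T)) → (Fin 3 → H) → Prop}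
    (hR : IsGroupGame R) {q' : {x : H // IsSingular x} → CFIVertex Γ}
    (hq' : IsReading (cfiTwist Γ T') q') : T.ncard ≡ T'.ncard [MOD 2] := by
  obtain ⟨q, m, hG, hq⟩ := MeklerGroup.exists_readingGame (isSparse hΓ T) hR hq'
  obtain ⟨S, hS⟩ : ∃ S, IsGadgetTransversal (cfiTwist Γ T) S :=
    ⟨_, (isGadgetTransversal_iff hΓ).2 ⟨fun _ _ => false, fun _ => by simp [IsEvenString], rfl⟩⟩
  obtain ⟨x, hx⟩ := MeklerGroup.exists_support_eq (p := p) (Γ := cfiTwist Γ T) S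
  have hsupport : q '' {u | InSupport x u.1} = S := by
    ext v
    obtain ⟨u, rfl⟩ := hG.left.surjective v
    rw [hG.left.mem_image_inSupport_iff, MeklerGroup.inSupport_iff (isSparse hΓ T) (hq u), hx]
  obtain ⟨S', Q, hQ⟩ := hG.exists_isMarkedGame x
  rw [hsupport] at hQ
  have hgame := hG.isBackForth
  have hcard := hQ.card_eq <| (hgame.invariant_baseAdj fun _ _ hgh => congrFun hgh 0).and
    (hgame.invariant_matched fun _ _ hgh => congrFun hgh 0).not
  refine Nat.ModEq.mul_left_cancel' two_ne_zero ?_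
  exact (card_baseAdj_and_not_matched_modEq hΓ hT hS).symm.trans <| hcard ▸
    card_baseAdj_and_not_matched_modEq hΓ hT' (hQ.isGadgetTransversal hgame hS)

end CFIVertex

open CFIVertex in
theorem nonempty_mulEquiv_of_groupWLEquiv {V : Type u} [Finite V] {Γ : SimpleGraph V} {p : ℕ}
    [Fact p.Prime] (hΓ : ∀ v, Nat.card (Γ.neighborSet v) = 3) (hc : Γ.Connected)
    (hdim : GraphWLDimLE Γ 3) {T : Set (Sym2 V)} (hT : T ⊆ Γ.edgeSet) {H : Type u} [Group H]
    [Finite H] (h : GroupWLEquiv 3 (MeklerGroup p (cfiTwist Γ T)) H) :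
    Nonempty (MeklerGroup p (cfiTwist Γ T) ≃* H) := by
  have := hc.nonempty
  have hR := h.isGroupGame
  have hH := isReading_singularGraph H
  obtain ⟨q, m, hG, -⟩ := MeklerGroup.exists_readingGame (isSparse hΓ T) hR hH
  have := hG.finite_right
  obtain ⟨T', hT', ⟨φ⟩⟩ := hG.isBackForth.exists_iso_cfiTwist hΓ (fun _ _ h => congrFun h 0) hdim
  have hparity := ncard_modEq_of_isGroupGame hΓ hT hT' hR (hH.comp_iso φ)
  obtain ⟨ψ⟩ := nonempty_iso_of_ncard_modEq hc hT' hT hparity.symm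
  exact MeklerGroup.nonempty_mulEquiv (isSparse hΓ T) hR ((hH.comp_iso φ).comp_iso ψ)

open CFIVertex in
theorem mainTheorem8_general {V : Type u} [Finite V] (Γ : SimpleGraph V)
    (hΓ : ∀ v, Nat.card (Γ.neighborSet v) = 3) (p : ℕ) (hp : p.Prime) :
    (∀ T ⊆ Γ.edgeSet, ∀ T' ⊆ Γ.edgeSet, ¬ T.ncard ≡ T'.ncard [MOD 2] →
      GroupWLDistinguishes 3 (MeklerGroup p (cfiTwist Γ T)) (MeklerGroup p (cfiTwist Γ T'))) ∧
    (Γ.Connected → GraphWLDimLE Γ 3 →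
      ∀ T ⊆ Γ.edgeSet, GroupWLIdentifies 3 (MeklerGroup p (cfiTwist Γ T))) := by
  have := Fact.mk hp
  refine ⟨fun T hT T' hT' hne h => hne ?_, fun hc hdim T hT H _ _ hno h =>
    hno (nonempty_mulEquiv_of_groupWLEquiv hΓ hc hdim hT h)⟩
  cases isEmpty_or_nonempty V
  · rw [Subsingleton.elim T T']
  · obtain ⟨q', hq', -⟩ := MeklerGroup.exists_isReading (p := p) (isSparse hΓ T')
    exact ncard_modEq_of_isGroupGame hΓ hT hT' h.isGroupGame hq'

theorem mainTheorem8 {V : Type u} [Fintype V] (Γ₀ : SimpleGraph V) [DecidableRel Γ₀.Adj]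
    (hreg : Γ₀.IsRegularOfDegree 3) (hconn : Γ₀.Connected)
    (p : ℕ) (hp : p.Prime) (hp2 : p ≠ 2)
    (e : Sym2 V) (he : e ∈ Γ₀.edgeSet) :
    GroupWLDistinguishes 3 (MeklerGroup p (CFI Γ₀)) (MeklerGroup p (twistedCFI Γ₀ e)) ∧
      (GraphWLDimLE Γ₀ 3 →
        GroupWLIdentifies 3 (MeklerGroup p (CFI Γ₀)) ∧
          GroupWLIdentifies 3 (MeklerGroup p (twistedCFI Γ₀ e))) := by
  have hΓ : ∀ v, Nat.card (Γ₀.neighborSet v) = 3 := fun v => by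
    rw [Nat.card_eq_fintype_card, SimpleGraph.card_neighborSet_eq_degree, hreg v]
  have he' : {e} ⊆ Γ₀.edgeSet := Set.singleton_subset_iff.2 he
  obtain ⟨hdist, hident⟩ := mainTheorem8_general Γ₀ hΓ p hp
  refine ⟨hdist ∅ (Set.empty_subset _) {e} he' ?_, fun hdim =>
    ⟨hident hconn hdim ∅ (Set.empty_subset _), hident hconn hdim {e} he'⟩⟩
  rw [Set.ncard_empty, Set.ncard_singleton]
  decide
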